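/- **Theorem (convergence to steady state).** Let $d\ge 1$ and let $\Omega\subset\mathbb{R}^d$ be a bounded Lipschitz domain (bounded, open, connected, locally the region above the graph of a Lipschitz function). Let $\eta,\kappa:[0,\infty)\to[0,\infty)$ be continuous and assume that there are constants $c_\eta,c_\kappa>0$ such that $$\eta(w)\ge c_\eta\, w^{1/2}\quad\text{and}\quad \kappa(w)\ge c_\kappa\, w^{1/2}\qquad\text{for all } w\ge 0 .$$ Consider the coupled system with no-flux boundary conditions $$\dot v=\operatorname{div}(\eta(w)\nabla v),\qquad \dot w=\operatorname{div}(\kappa(w)\nabla w)+\eta(w)|\nabla v|^2\quad\text{in } ]0,\infty[\times\Omega,\qquad \eta(w)\nabla v\cdot\mathbf n=0=\kappa(w)\nabla w\cdot\mathbf n\quad\text{on } ]0,\infty[\times\partial\Omega .$$ A *solution* is a pair $v\in C([0,\infty);L^2(\Omega))$, $w\in C([0,\infty);L^1(\Omega))$, $w\ge0$, both measurable in $(t,x)$, such that, with $\Pi(w)=\int_0^w\kappa(s)\,ds$, the weak gradients $\nabla v(t,\cdot)$ and $\nabla\Pi(w(t,\cdot))$ $(=\kappa(w)\nabla w)$ exist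 in $L^1_{\rm loc}(\Omega)$ for a.e. $t>0$ and are measurable in $(t,x)$, such that $\eta(w)\nabla v,\ \nabla\Pi(w)\in L^2(]0,T[\times\Omega)$ and $\eta(w)|\nabla v|^2\in L^1(]0,T[\times\Omega)$ for every $T>0$, and such that for all $t\ge0$ $$\int_\Omega v(t)\varphi\,dx-\int_\Omega v(0)\varphi\,dx=-\int_0^t\!\!\int_\Omega \eta(w)\nabla v\cdot\nabla\varphi\,dx\,ds\qquad\text{for all }\varphi\in H^1(\Omega),$$ $$\int_\Omega w(t)\varphi\,dx-\int_\Omega w(0)\varphi\,dx=\int_0^t\!\!\int_\Omega\big(-\nabla\Pi(w)\cdot\nabla\varphi+\eta(w)|\nabla v|^2\varphi\big)\,dx\,ds\qquad\text{for all }\varphi\in H^1(\Omega)\cap L^\infty(\Omega).$$ Then the Neumann Laplacian on $\Omega$ (in its weak form on $H^1(\Omega)$) has a smallest positive eigenvalue $\lambda_N=\lambda_N(\Omega)>0$ (the first nontrivial eigenvalue). Moreover, let $(v,w)$ be any solution with $w(0,x)\ge c$ for a.e. $x\in\Omega$, for some $c>0$, and put $$V_0=\int_\Omega v(0,x)\,dx,\qquad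 E_0=\int_\Omega\big(\tfrac12 v(0,x)^2+w(0,x)\big)\,dx,\qquad \widehat v=\frac{V_0}{|\Omega|},\qquad \widehat w=\frac1{|\Omega|}\Big(E_0-\frac{V_0^2}{2|\Omega|}\Big).$$ Then $\Lambda:=\sqrt{\widehat w}\,\min\{c_\eta,c_\kappa\}\,\lambda_N>0$ and, for all $t\ge0$, $$\int_\Omega\Big(\tfrac12|v(t,x)-\widehat v|^2+\big|\sqrt{w(t,x)}-\sqrt{\widehat w}\big|^2\Big)dx\ \le\ e^{-\Lambda t}\int_\Omega\Big(\tfrac12|v(0,x)-\widehat v|^2+\big|\sqrt{w(0,x)}-\sqrt{\widehat w}\big|^2\Big)dx .$$ -/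

import Mathlib

open MeasureTheory Set Filter Topology
open scoped ContDiff

noncomputable section

/-- `Ω ⊆ ℝ^d` is a bounded Lipschitz domain: bounded, open, connected (in particular nonempty),
and near each boundary point `p` it is, for a suitable unit vector `e`, the set of points lying
strictly above the graph (in direction `e`) of a Lipschitz function of the component
`x - ⟪e, x⟫ e` of `x` orthogonal to `e`. -/
structure IsBoundedLipschitzDomain {d : ℕ} (Ω : Set (EuclideanSpace ℝ (Fin d))) : Prop where
  isOpen : IsOpen Ω
  isConnected : IsConnected Ω
  isBounded : Bornology.IsBounded Ω
  lipschitz_boundary : ∀ p ∈ frontier Ω,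
    ∃ (e : EuclideanSpace ℝ (Fin d)) (r : ℝ) (K : NNReal) (f : EuclideanSpace ℝ (Fin d) → ℝ),
      ‖e‖ = 1 ∧ 0 < r ∧ LipschitzWith K f ∧
        ∀ x ∈ Metric.ball p r, x ∈ Ω ↔ f (x - inner ℝ e x • e) < inner ℝ e x

/-- `g` is the weak (distributional) gradient of `u` in the open set `Ω`. -/
structure HasWeakGradient {d : ℕ} (Ω : Set (EuclideanSpace ℝ (Fin d)))
    (u : EuclideanSpace ℝ (Fin d) → ℝ)
    (g : EuclideanSpace ℝ (Fin d) → EuclideanSpace ℝ (Fin d)) : Prop where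
  locallyIntegrable : LocallyIntegrableOn u Ω
  locallyIntegrable_grad : LocallyIntegrableOn g Ω
  integral_eq : ∀ φ : EuclideanSpace ℝ (Fin d) → ℝ,
    ContDiff ℝ ∞ φ → HasCompactSupport φ → tsupport φ ⊆ Ω →
      ∀ e : EuclideanSpace ℝ (Fin d),
        ∫ x in Ω, u x * fderiv ℝ φ x e = - ∫ x in Ω, inner ℝ (g x) e * φ x

/-- `u ∈ H¹(Ω)`, with weak gradient `g`. -/
structure MemSobolevH1 {d : ℕ} (Ω : Set (EuclideanSpace ℝ (Fin d)))
    (u : EuclideanSpace ℝ (Fin d) → ℝ)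
    (g : EuclideanSpace ℝ (Fin d) → EuclideanSpace ℝ (Fin d)) : Prop where
  memLp : MemLp u 2 (volume.restrict Ω)
  memLp_grad : MemLp g 2 (volume.restrict Ω)
  hasWeakGradient : HasWeakGradient Ω u g

/-- `lam` is an eigenvalue of the Neumann Laplacian on `Ω`: there is `u ∈ H¹(Ω)`, `u ≠ 0`, with
`-Δu = lam u` in `Ω` and `∇u · n = 0` on the boundary, in the usual weak (variational) sense. -/
def IsNeumannEigenvalue {d : ℕ} (Ω : Set (EuclideanSpace ℝ (Fin d))) (lam : ℝ) : Prop :=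
  ∃ (u : EuclideanSpace ℝ (Fin d) → ℝ) (g : EuclideanSpace ℝ (Fin d) → EuclideanSpace ℝ (Fin d)),
    MemSobolevH1 Ω u g ∧ ¬ (u =ᵐ[volume.restrict Ω] 0) ∧
      ∀ (φ : EuclideanSpace ℝ (Fin d) → ℝ)
        (gφ : EuclideanSpace ℝ (Fin d) → EuclideanSpace ℝ (Fin d)),
        MemSobolevH1 Ω φ gφ →
          ∫ x in Ω, inner ℝ (g x) (gφ x) = lam * ∫ x in Ω, u x * φ x

/-- The positive (nontrivial) eigenvalues of the Neumann Laplacian. -/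
def positiveNeumannEigenvalues {d : ℕ} (Ω : Set (EuclideanSpace ℝ (Fin d))) : Set ℝ :=
  {lam | 0 < lam ∧ IsNeumannEigenvalue Ω lam}

/-- The first nontrivial eigenvalue `λ_N(Ω)` of the Neumann Laplacian on `Ω`. -/
def firstNeumannEigenvalue {d : ℕ} (Ω : Set (EuclideanSpace ℝ (Fin d))) : ℝ :=
  sInf (positiveNeumannEigenvalues Ω)

/-- The pressure function `Π(w) = ∫₀^w κ(s) ds`, so that formally `∇Π(w) = κ(w) ∇w`. -/
def pressure (κ : ℝ → ℝ) (w : ℝ) : ℝ := ∫ s in (0 : ℝ)..w, κ s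

/-- `(v, w)`, with `Gv = ∇v` and `Gp = ∇Π(w) = κ(w)∇w`, is a global weak solution with
square-integrable fluxes of
`∂ₜv = div (η(w)∇v)`, `∂ₜw = div (κ(w)∇w) + η(w)|∇v|²` in `]0,∞[ × Ω`,
with the no-flux conditions `η(w)∇v · n = 0 = κ(w)∇w · n` on the boundary. The no-flux conditions
are encoded by the test functions, which are not required to vanish on the boundary. -/
structure IsWeakSolutionWith {d : ℕ} (Ω : Set (EuclideanSpace ℝ (Fin d))) (η κ : ℝ → ℝ)
    (v w : ℝ → EuclideanSpace ℝ (Fin d) → ℝ)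
    (Gv Gp : ℝ → EuclideanSpace ℝ (Fin d) → EuclideanSpace ℝ (Fin d)) : Prop where
  v_memLp : ∀ t, 0 ≤ t → MemLp (v t) 2 (volume.restrict Ω)
  w_integrable : ∀ t, 0 ≤ t → Integrable (w t) (volume.restrict Ω)
  w_nonneg : ∀ t, 0 ≤ t → ∀ᵐ x ∂(volume.restrict Ω), 0 ≤ w t x
  /-- `v ∈ C([0,∞[; L²(Ω))` -/
  v_continuous : ∀ s, 0 ≤ s →
    Tendsto (fun t => eLpNorm (v t - v s) 2 (volume.restrict Ω)) (𝓝[Ici 0] s) (𝓝 0)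
  /-- `w ∈ C([0,∞[; L¹(Ω))` -/
  w_continuous : ∀ s, 0 ≤ s →
    Tendsto (fun t => eLpNorm (w t - w s) 1 (volume.restrict Ω)) (𝓝[Ici 0] s) (𝓝 0)
  v_measurable : AEStronglyMeasurable (fun p : ℝ × EuclideanSpace ℝ (Fin d) => v p.1 p.2)
    ((volume.restrict (Ioi 0)).prod (volume.restrict Ω))
  w_measurable : AEStronglyMeasurable (fun p : ℝ × EuclideanSpace ℝ (Fin d) => w p.1 p.2)
    ((volume.restrict (Ioi 0)).prod (volume.restrict Ω))
  Gv_measurable : AEStronglyMeasurable (fun p : ℝ × EuclideanSpace ℝ (Fin d) => Gv p.1 p.2)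
    ((volume.restrict (Ioi 0)).prod (volume.restrict Ω))
  grad_v : ∀ᵐ t ∂(volume.restrict (Ioi (0 : ℝ))), HasWeakGradient Ω (v t) (Gv t)
  grad_pressure : ∀ᵐ t ∂(volume.restrict (Ioi (0 : ℝ))),
    HasWeakGradient Ω (fun x => pressure κ (w t x)) (Gp t)
  /-- `η(w)∇v ∈ L²(]0,T[ × Ω)` -/
  flux_v : ∀ T, 0 < T →
    MemLp (fun p : ℝ × EuclideanSpace ℝ (Fin d) => η (w p.1 p.2) • Gv p.1 p.2) 2
      ((volume.restrict (Ioc 0 T)).prod (volume.restrict Ω))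
  /-- `∇Π(w) ∈ L²(]0,T[ × Ω)` -/
  flux_w : ∀ T, 0 < T →
    MemLp (fun p : ℝ × EuclideanSpace ℝ (Fin d) => Gp p.1 p.2) 2
      ((volume.restrict (Ioc 0 T)).prod (volume.restrict Ω))
  /-- `η(w)|∇v|² ∈ L¹(]0,T[ × Ω)` -/
  source : ∀ T, 0 < T →
    Integrable (fun p : ℝ × EuclideanSpace ℝ (Fin d) => η (w p.1 p.2) * ‖Gv p.1 p.2‖ ^ 2)
      ((volume.restrict (Ioc 0 T)).prod (volume.restrict Ω))
  /-- The equation for `v`, tested with all `φ ∈ H¹(Ω)`. -/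
  eq_v : ∀ (φ : EuclideanSpace ℝ (Fin d) → ℝ)
    (gφ : EuclideanSpace ℝ (Fin d) → EuclideanSpace ℝ (Fin d)), MemSobolevH1 Ω φ gφ →
    ∀ t, 0 ≤ t →
      (∫ x in Ω, v t x * φ x) - ∫ x in Ω, v 0 x * φ x
        = - ∫ s in (0 : ℝ)..t, ∫ x in Ω, η (w s x) * inner ℝ (Gv s x) (gφ x)
  /-- The equation for `w`, tested with all `φ ∈ H¹(Ω) ∩ L^∞(Ω)`. -/
  eq_w : ∀ (φ : EuclideanSpace ℝ (Fin d) → ℝ)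
    (gφ : EuclideanSpace ℝ (Fin d) → EuclideanSpace ℝ (Fin d)), MemSobolevH1 Ω φ gφ →
    (∃ M : ℝ, ∀ᵐ x ∂(volume.restrict Ω), |φ x| ≤ M) →
    ∀ t, 0 ≤ t →
      (∫ x in Ω, w t x * φ x) - ∫ x in Ω, w 0 x * φ x
        = ∫ s in (0 : ℝ)..t, ∫ x in Ω,
            (- inner ℝ (Gp s x) (gφ x) + η (w s x) * ‖Gv s x‖ ^ 2 * φ x)

/-- `(v, w)` is a global weak solution with square-integrable fluxes of the coupled system with
viscosity `η`, energy-transport coefficient `κ` and no-flux boundary conditions on `Ω`. -/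
def IsWeakSolution {d : ℕ} (Ω : Set (EuclideanSpace ℝ (Fin d))) (η κ : ℝ → ℝ)
    (v w : ℝ → EuclideanSpace ℝ (Fin d) → ℝ) : Prop :=
  ∃ Gv Gp : ℝ → EuclideanSpace ℝ (Fin d) → EuclideanSpace ℝ (Fin d),
    IsWeakSolutionWith Ω η κ v w Gv Gp

/-- The total momentum `∫_Ω v dx`. -/
def momentum {d : ℕ} (Ω : Set (EuclideanSpace ℝ (Fin d)))
    (v : EuclideanSpace ℝ (Fin d) → ℝ) : ℝ :=
  ∫ x in Ω, v x

/-- The total energy `∫_Ω (½ v² + w) dx`. -/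
def energy {d : ℕ} (Ω : Set (EuclideanSpace ℝ (Fin d)))
    (v w : EuclideanSpace ℝ (Fin d) → ℝ) : ℝ :=
  ∫ x in Ω, ((1 / 2) * v x ^ 2 + w x)

/-- The constant equilibrium velocity `V₀ / |Ω|`. -/
def vHat {d : ℕ} (Ω : Set (EuclideanSpace ℝ (Fin d))) (V₀ : ℝ) : ℝ :=
  V₀ / volume.real Ω

/-- The constant equilibrium internal energy `(E₀ - V₀² / (2|Ω|)) / |Ω|`. -/
def wHat {d : ℕ} (Ω : Set (EuclideanSpace ℝ (Fin d))) (V₀ E₀ : ℝ) : ℝ :=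
  (E₀ - V₀ ^ 2 / (2 * volume.real Ω)) / volume.real Ω

/-- The distance `∫_Ω (½ |v - v̂|² + |√w - √ŵ|²) dx` of `(v, w)` from the constants `(v̂, ŵ)`. -/
def distEquilibrium {d : ℕ} (Ω : Set (EuclideanSpace ℝ (Fin d)))
    (v w : EuclideanSpace ℝ (Fin d) → ℝ) (v₀ w₀ : ℝ) : ℝ :=
  ∫ x in Ω, ((1 / 2) * |v x - v₀| ^ 2 + |Real.sqrt (w x) - Real.sqrt w₀| ^ 2)

end

/-!
The argument is an entropy method for the concave functional `∫ √w`.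

The existence of the first nontrivial Neumann eigenvalue `λ`, and the fact that it is the best
constant in the Poincaré inequality for mean-zero functions, come from minimizing the Rayleigh
quotient (`exists_isMinOn_rayleigh`), the compactness being supplied by Rellich's theorem
(`IsBoundedLipschitzDomain.exists_subseq_cauchySeq`). The latter rests on the uniform cone property
of Lipschitz domains: a Sobolev function is `L²`-close to its averages over small translated balls
inside the cones, and for a weakly convergent sequence these averages converge pointwise.

A solution only satisfies the weak equations, and no time derivatives are available. The two chain
rules in time, `IsWeakSolutionWith.integral_sq_v_sub` for `∫ v²` and
`IsWeakSolutionWith.integral_comp_w_sub` for `∫ Θ(w)` with `Θ` convex, are both obtained from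
`sub_eq_of_integral_increment_le`: testing at time `s` with a function of the solution at time `s`
and using convexity, increments of the functional over `[s, s + h]` dominate the integrated fluxes
for positive and for negative `h`; after averaging in `s` both sides are differentiable at `h = 0`,
where they agree, so their derivatives coincide.

Testing with a truncation of the pressure gives the minimum principle
`IsWeakSolutionWith.le_w`. Hence `w` stays away from `0`, where the coefficients may degenerate,
`∇v` is square integrable, momentum and energy are conserved, and testing with `-1 / √w` gives
`d/dt ∫ √w ≥ min {cη, cκ} ∫ (½ |∇v|² + |∇√w|²)`
(`IsWeakSolutionWith.mul_integral_le_integral_sqrt_sub`).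

For fixed momentum and energy the distance to equilibrium `H` equals `2 |Ω| ŵ - 2 √ŵ ∫ √w`
(`distEquilibrium_eq`), so it decreases at least at the rate `2 √ŵ min {cη, cκ}` times the
dissipation. By the Poincaré inequality twice the dissipation is at least `λ H`
(`mul_distEquilibrium_le`), and Grönwall's inequality gives the exponential decay.
-/

/-! ### Continuity of translations and mollification in `L^p` -/

/-- Translations act continuously on `L^p`. -/
theorem tendsto_eLpNorm_translate_sub {G F : Type*} [NormedAddCommGroup G] [NormedSpace ℝ G]
    [FiniteDimensional ℝ G] [MeasurableSpace G] [BorelSpace G] {μ : Measure G} [μ.IsAddHaarMeasure]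
    [NormedAddCommGroup F] {p : ENNReal} [Fact (1 ≤ p)] (hp : p ≠ ⊤) {f : G → F}
    (hf : MemLp f p μ) :
    Tendsto (fun y : G => eLpNorm (fun x => f (x + y) - f x) p μ) (𝓝 0) (𝓝 0) := by
  have : ProperSpace G := FiniteDimensional.proper ℝ G
  let τ : G → C(G, G) := fun y => ⟨fun x => x + y, by fun_prop⟩
  have hτ : Continuous τ := by
    apply ContinuousMap.continuous_of_continuous_uncurry
    simp only [τ, Function.uncurry_def, ContinuousMap.coe_mk]
    fun_prop
  have hm : ∀ y, MeasurePreserving (τ y) μ μ := fun y => measurePreserving_add_right μ y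
  have hc : Continuous fun y => Lp.compMeasurePreserving (τ y) (hm y) hf.toLp :=
    continuous_const.compMeasurePreservingLp hτ hm hp
  have h0 := tendsto_iff_edist_tendsto_0.1 (hc.tendsto 0)
  refine h0.congr fun y => ?_
  rw [Lp.edist_def]
  refine eLpNorm_congr_ae ?_
  have e1 := Lp.coeFn_compMeasurePreserving hf.toLp (hm y)
  have e2 := Lp.coeFn_compMeasurePreserving hf.toLp (hm 0)
  have e3 := (hm y).quasiMeasurePreserving.ae_eq_comp hf.coeFn_toLp
  have e4 := (hm 0).quasiMeasurePreserving.ae_eq_comp hf.coeFn_toLp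
  filter_upwards [e1, e2, e3, e4] with x h1 h2 h3 h4
  simp only [Pi.sub_apply, h1, h2, h3, h4, Function.comp_apply]
  simp [τ]

/-- Mollification converges in `L¹`. -/
theorem tendsto_lintegral_convolution_sub {G F : Type*} [NormedAddCommGroup G] [NormedSpace ℝ G]
    [FiniteDimensional ℝ G] [MeasurableSpace G] [BorelSpace G] {μ : Measure G} [μ.IsAddHaarMeasure]
    [HasContDiffBump G]
    [NormedAddCommGroup F] [NormedSpace ℝ F] [CompleteSpace F] {ρ : ℕ → ContDiffBump (0 : G)}
    (hρ : Tendsto (fun n => (ρ n).rOut) atTop (𝓝 0)) {f : G → F} (hf : Integrable f μ) :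
    Tendsto (fun n => ∫⁻ x, ‖convolution ((ρ n).normed μ) f (ContinuousLinearMap.lsmul ℝ ℝ) μ x
      - f x‖ₑ ∂μ) atTop (𝓝 0) := by
  have : ProperSpace G := FiniteDimensional.proper ℝ G
  have h1 : Tendsto (fun y : G => ∫⁻ x, ‖f (x - y) - f x‖ₑ ∂μ) (𝓝 0) (𝓝 0) := by
    have := (tendsto_eLpNorm_translate_sub ENNReal.one_ne_top (memLp_one_iff_integrable.2 hf)).comp
      (show Tendsto (fun y : G => -y) (𝓝 0) (𝓝 0) by
        simpa using (continuous_neg (G := G)).tendsto 0)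
    refine this.congr fun y => ?_
    simp [eLpNorm_one_eq_lintegral_enorm, sub_eq_add_neg]
  rw [ENNReal.tendsto_nhds_zero] at h1 ⊢
  intro ε hε
  obtain ⟨δ, hδ, hδε⟩ := Metric.eventually_nhds_iff.1 (h1 ε hε)
  filter_upwards [hρ.eventually_lt_const hδ] with n hn
  set r := (ρ n).normed μ with hr
  have hrc : Continuous r := (ρ n).continuous_normed
  have hmeas : AEMeasurable (fun q : G × G => ‖r q.2‖ₑ * ‖f (q.1 - q.2) - f q.1‖ₑ)
      (μ.prod μ) := by
    refine AEMeasurable.mul (by fun_prop) (AEStronglyMeasurable.enorm (.sub ?_ ?_))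
    · exact hf.1.comp_quasiMeasurePreserving (quasiMeasurePreserving_sub_of_right_invariant μ μ)
    · exact hf.1.comp_quasiMeasurePreserving Measure.quasiMeasurePreserving_fst
  calc ∫⁻ x, ‖convolution r f (ContinuousLinearMap.lsmul ℝ ℝ) μ x - f x‖ₑ ∂μ
      ≤ ∫⁻ x, ∫⁻ y, ‖r y‖ₑ * ‖f (x - y) - f x‖ₑ ∂μ ∂μ := by
        refine lintegral_mono fun x => ?_
        have hi : Integrable (fun y => r y • f (x - y)) μ :=
          (((ρ n).hasCompactSupport_normed (μ := μ)).convolutionExists_left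
            (ContinuousLinearMap.lsmul ℝ ℝ) hrc hf.locallyIntegrable x)
        have hi2 : Integrable (fun y => r y • f x) μ := ((ρ n).integrable_normed).smul_const _
        have : convolution r f (ContinuousLinearMap.lsmul ℝ ℝ) μ x - f x
            = ∫ y, r y • (f (x - y) - f x) ∂μ := by
          simp only [smul_sub]
          rw [integral_sub hi hi2, integral_smul_const, (ρ n).integral_normed, one_smul]
          rfl
        rw [this]
        refine (enorm_integral_le_lintegral_enorm _).trans (le_of_eq ?_)
        simp [enorm_smul]
    _ = ∫⁻ y, ∫⁻ x, ‖r y‖ₑ * ‖f (x - y) - f x‖ₑ ∂μ ∂μ := lintegral_lintegral_swap hmeas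
    _ ≤ ∫⁻ y, ‖r y‖ₑ * ε ∂μ := by
        refine lintegral_mono fun y => ?_
        rw [lintegral_const_mul' _ _ enorm_ne_top]
        by_cases hy : r y = 0
        · simp [hy]
        have : y ∈ Function.support r := hy
        rw [hr, (ρ n).support_normed_eq, mem_ball_zero_iff] at this
        gcongr
        exact hδε (by rw [dist_zero_right]; exact this.trans hn)
    _ = ε := by
        rw [lintegral_mul_const'' _ (by fun_prop),
          ← ofReal_integral_norm_eq_lintegral_enorm (ρ n).integrable_normed]
        simp [Real.norm_of_nonneg ((ρ n).nonneg_normed _), (ρ n).integral_normed]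

/-! ### Weak gradients -/

section

variable {d : ℕ} {Ω : Set (EuclideanSpace ℝ (Fin d))}
  {u u' : EuclideanSpace ℝ (Fin d) → ℝ}
  {g g' : EuclideanSpace ℝ (Fin d) → EuclideanSpace ℝ (Fin d)}

/-- A function dominated by a locally integrable one is locally integrable. -/
theorem LocallyIntegrableOn.mono_norm {X F G : Type*} [TopologicalSpace X] [MeasurableSpace X]
    [OpensMeasurableSpace X]
    [NormedAddCommGroup F] [NormedAddCommGroup G] {μ : Measure X} {s : Set X} {f : X → F}
    {h : X → G} (hh : LocallyIntegrableOn h s μ)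
    (hf : AEStronglyMeasurable f (μ.restrict s))
    (hle : ∀ᵐ x ∂(μ.restrict s), ‖f x‖ ≤ ‖h x‖) : LocallyIntegrableOn f s μ := by
  intro x hx
  obtain ⟨U, hU, hi⟩ := hh x hx
  refine ⟨U ∩ s, inter_mem hU self_mem_nhdsWithin, ?_⟩
  have hle' : μ.restrict (U ∩ s) ≤ μ.restrict s := Measure.restrict_mono inter_subset_right le_rfl
  exact Integrable.mono (hi.mono_set inter_subset_left) (hf.mono_measure hle') (ae_mono hle' hle)

theorem locallyIntegrableOn_of_memLp {F : Type*} [NormedAddCommGroup F] (hΩ : IsOpen Ω)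
    {f : EuclideanSpace ℝ (Fin d) → F} {p : ENNReal} (hp : 1 ≤ p)
    (hf : MemLp f p (volume.restrict Ω)) : LocallyIntegrableOn f Ω := by
  rw [locallyIntegrableOn_iff hΩ.isLocallyClosed]
  intro K hK hKc
  have : IsFiniteMeasure (volume.restrict K : Measure (EuclideanSpace ℝ (Fin d))) :=
    ⟨by simpa using hKc.measure_lt_top⟩
  exact (hf.mono_measure (Measure.restrict_mono hK le_rfl)).integrable hp

theorem integrableOn_mul_of_tsupport_subset {f : EuclideanSpace ℝ (Fin d) → ℝ} (hΩ : IsOpen Ω)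
    (hf : LocallyIntegrableOn f Ω) {φ : EuclideanSpace ℝ (Fin d) → ℝ} (hφ : Continuous φ)
    (hc : HasCompactSupport φ) (hs : tsupport φ ⊆ Ω) :
    Integrable (fun x => f x * φ x) := by
  have h1 : IntegrableOn f (tsupport φ) :=
    (locallyIntegrableOn_iff hΩ.isLocallyClosed).1 hf _ hs hc
  obtain ⟨C, hC⟩ := hc.exists_bound_of_continuous hφ
  have h2 : IntegrableOn (fun x => f x * φ x) (tsupport φ) :=
    h1.mul_bdd (c := C) hφ.aestronglyMeasurable (.of_forall fun x => hC x)
  refine (integrableOn_iff_integrable_of_support_subset ?_).1 h2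
  exact fun x hx => subset_tsupport _ (fun h => hx (by simp [h]))

theorem HasWeakGradient.congr (h : HasWeakGradient Ω u g)
    (hu : u =ᵐ[volume.restrict Ω] u') (hg : g =ᵐ[volume.restrict Ω] g') :
    HasWeakGradient Ω u' g' where
  locallyIntegrable := LocallyIntegrableOn.mono_norm h.1
    ((h.1.aestronglyMeasurable).congr hu) (hu.mono fun x hx => by rw [hx])
  locallyIntegrable_grad := LocallyIntegrableOn.mono_norm h.2
    ((h.2.aestronglyMeasurable).congr hg) (hg.mono fun x hx => by rw [hx])
  integral_eq φ h1 h2 h3 e := by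
    have e1 : ∫ x in Ω, u' x * fderiv ℝ φ x e = ∫ x in Ω, u x * fderiv ℝ φ x e :=
      integral_congr_ae (hu.mono fun x hx => by simp only [hx])
    have e2 : ∫ x in Ω, inner ℝ (g' x) e * φ x = ∫ x in Ω, inner ℝ (g x) e * φ x :=
      integral_congr_ae (hg.mono fun x hx => by simp only [hx])
    rw [e1, e2, h.3 φ h1 h2 h3 e]

theorem continuous_fderiv_apply_of_contDiff {φ : EuclideanSpace ℝ (Fin d) → ℝ}
    (hφ : ContDiff ℝ ∞ φ) (e : EuclideanSpace ℝ (Fin d)) : Continuous fun x => fderiv ℝ φ x e :=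
  (hφ.continuous_fderiv (by simp)).clm_apply continuous_const

theorem hasCompactSupport_fderiv_apply {φ : EuclideanSpace ℝ (Fin d) → ℝ}
    (hc : HasCompactSupport φ) (e : EuclideanSpace ℝ (Fin d)) :
    HasCompactSupport fun x => fderiv ℝ φ x e := hc.fderiv_apply ℝ e

theorem tsupport_fderiv_apply_subset_of_subset {φ : EuclideanSpace ℝ (Fin d) → ℝ}
    (hs : tsupport φ ⊆ Ω) (e : EuclideanSpace ℝ (Fin d)) :
    tsupport (fun x => fderiv ℝ φ x e) ⊆ Ω := (tsupport_fderiv_apply_subset ℝ e).trans hs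

theorem LocallyIntegrableOn.inner_const {f : EuclideanSpace ℝ (Fin d) → EuclideanSpace ℝ (Fin d)}
    (hΩ : IsOpen Ω) (hf : LocallyIntegrableOn f Ω) (e : EuclideanSpace ℝ (Fin d)) :
    LocallyIntegrableOn (fun x => inner ℝ (f x) e) Ω := by
  rw [locallyIntegrableOn_iff hΩ.isLocallyClosed] at hf ⊢
  exact fun K hK hKc => Integrable.inner_const (hf K hK hKc) e

theorem integrable_mul_fderiv (hΩ : IsOpen Ω) (hu : LocallyIntegrableOn u Ω)
    {φ : EuclideanSpace ℝ (Fin d) → ℝ} (h1 : ContDiff ℝ ∞ φ) (h2 : HasCompactSupport φ)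
    (h3 : tsupport φ ⊆ Ω) (e : EuclideanSpace ℝ (Fin d)) :
    Integrable (fun x => u x * fderiv ℝ φ x e) :=
  integrableOn_mul_of_tsupport_subset hΩ hu (φ := fun x => fderiv ℝ φ x e)
    (continuous_fderiv_apply_of_contDiff h1 e) (hasCompactSupport_fderiv_apply h2 e)
    (tsupport_fderiv_apply_subset_of_subset h3 e)

theorem integrable_inner_mul (hΩ : IsOpen Ω) (hg : LocallyIntegrableOn g Ω)
    {φ : EuclideanSpace ℝ (Fin d) → ℝ} (h1 : ContDiff ℝ ∞ φ) (h2 : HasCompactSupport φ)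
    (h3 : tsupport φ ⊆ Ω) (e : EuclideanSpace ℝ (Fin d)) :
    Integrable (fun x => inner ℝ (g x) e * φ x) :=
  integrableOn_mul_of_tsupport_subset hΩ (LocallyIntegrableOn.inner_const hΩ hg e)
    h1.continuous h2 h3

theorem HasWeakGradient.add (h : HasWeakGradient Ω u g) (h' : HasWeakGradient Ω u' g')
    (hΩ : IsOpen Ω) : HasWeakGradient Ω (u + u') (g + g') where
  locallyIntegrable := h.1.add h'.1
  locallyIntegrable_grad := h.2.add h'.2
  integral_eq φ h1 h2 h3 e := by
    simp only [Pi.add_apply, add_mul, inner_add_left]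
    rw [integral_add (integrable_mul_fderiv hΩ h.1 h1 h2 h3 e).integrableOn
      (integrable_mul_fderiv hΩ h'.1 h1 h2 h3 e).integrableOn,
      integral_add (integrable_inner_mul hΩ h.2 h1 h2 h3 e).integrableOn
      (integrable_inner_mul hΩ h'.2 h1 h2 h3 e).integrableOn,
      h.3 φ h1 h2 h3, h'.3 φ h1 h2 h3]
    ring

theorem HasWeakGradient.const_smul (h : HasWeakGradient Ω u g) (c : ℝ) :
    HasWeakGradient Ω (c • u) (c • g) where
  locallyIntegrable := h.1.smul c
  locallyIntegrable_grad := h.2.smul c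
  integral_eq φ h1 h2 h3 e := by
    simp only [Pi.smul_apply, inner_smul_left, smul_eq_mul, mul_assoc, integral_const_mul,
      h.3 φ h1 h2 h3]
    simp

/-- The classical gradient of a `C¹` function is its weak gradient. -/
theorem hasWeakGradient_of_contDiff (hu : ContDiff ℝ 1 u) :
    HasWeakGradient Ω u (gradient u) where
  locallyIntegrable := hu.continuous.locallyIntegrable.locallyIntegrableOn _
  locallyIntegrable_grad := by
    refine Continuous.locallyIntegrable ?_ |>.locallyIntegrableOn _
    exact (InnerProductSpace.toDual ℝ _).symm.continuous.comp (hu.continuous_fderiv (by simp))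
  integral_eq φ h1 h2 h3 e := by
    have hin : ∀ x, inner ℝ (gradient u x) e = fderiv ℝ u x e := fun x => by
      simp [gradient]
    have hs1 : Function.support (fun x => u x * fderiv ℝ φ x e) ⊆ Ω := fun x hx =>
      tsupport_fderiv_apply_subset_of_subset h3 e (subset_tsupport _ (fun h => hx (by simp [h])))
    have hs2 : Function.support (fun x => fderiv ℝ u x e * φ x) ⊆ Ω := fun x hx =>
      h3 (subset_tsupport _ (fun h => hx (by simp [h])))
    simp only [hin]
    rw [setIntegral_eq_integral_of_forall_compl_eq_zero (fun x hx => by_contra fun h => hx (hs1 h)),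
      setIntegral_eq_integral_of_forall_compl_eq_zero (fun x hx => by_contra fun h => hx (hs2 h))]
    have hc := continuous_fderiv_apply_of_contDiff h1 e
    have hcu : Continuous fun x => fderiv ℝ u x e :=
      (hu.continuous_fderiv (by simp)).clm_apply continuous_const
    refine integral_mul_fderiv_eq_neg_fderiv_mul_of_integrable ?_ ?_ ?_ ?_ ?_
    · exact (hcu.mul h1.continuous).integrable_of_hasCompactSupport h2.mul_left
    · exact (hu.continuous.mul hc).integrable_of_hasCompactSupport
        (hasCompactSupport_fderiv_apply h2 e).mul_left
    · exact (hu.continuous.mul h1.continuous).integrable_of_hasCompactSupport h2.mul_left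
    · exact fun x _ => hu.differentiable (by simp) x
    · exact fun x _ => h1.differentiable (by simp) x

end

/-! ### Mollification and the chain rule -/

section

variable {d : ℕ} {Ω : Set (EuclideanSpace ℝ (Fin d))} {u : EuclideanSpace ℝ (Fin d) → ℝ}
  {g : EuclideanSpace ℝ (Fin d) → EuclideanSpace ℝ (Fin d)}

/-- Mollification commutes with weak differentiation at points whose distance to the boundary of
the truncation set `K` exceeds the mollification radius. -/
theorem HasWeakGradient.fderiv_convolution (h : HasWeakGradient Ω u g)
    {K : Set (EuclideanSpace ℝ (Fin d))} (hKΩ : K ⊆ Ω)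
    (hu : Integrable (K.indicator u)) (hg : Integrable (K.indicator g))
    (ρ : ContDiffBump (0 : EuclideanSpace ℝ (Fin d))) (x e : EuclideanSpace ℝ (Fin d))
    (hx : Metric.closedBall x ρ.rOut ⊆ K) :
    fderiv ℝ (convolution (ρ.normed volume) (K.indicator u) (ContinuousLinearMap.lsmul ℝ ℝ)
      volume) x e = inner ℝ (convolution (ρ.normed volume) (K.indicator g)
        (ContinuousLinearMap.lsmul ℝ ℝ) volume x) e := by
  set r := ρ.normed (volume : Measure (EuclideanSpace ℝ (Fin d))) with hr
  have hrs : ContDiff ℝ ∞ r := ρ.contDiff_normed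
  have hrc : HasCompactSupport r := ρ.hasCompactSupport_normed
  -- the mollifier centred at `x` is an admissible test function
  set φ : EuclideanSpace ℝ (Fin d) → ℝ := fun y => r (x - y) with hφ
  have hφs : ContDiff ℝ ∞ φ := hrs.comp (contDiff_const.sub contDiff_id)
  have hφc : HasCompactSupport φ := by
    exact hrc.comp_homeomorph (Homeomorph.subLeft x)
  have hφt : tsupport φ ⊆ K := by
    refine (closure_minimal (fun y hy => ?_) Metric.isClosed_closedBall).trans hx
    have : x - y ∈ Function.support r := hy
    rw [hr, ρ.support_normed_eq, mem_ball_zero_iff] at this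
    rw [Metric.mem_closedBall, dist_comm, dist_eq_norm]
    exact this.le
  have hφd : ∀ y, fderiv ℝ φ y e = - fderiv ℝ r (x - y) e := by
    intro y
    have h1 : HasFDerivAt r (fderiv ℝ r (x - y)) (x - y) :=
      (hrs.differentiable (by simp) _).hasFDerivAt
    have h2 := h1.comp y ((hasFDerivAt_const x y).sub (hasFDerivAt_id y))
    change fderiv ℝ (r ∘ fun y => x - y) y e = _
    rw [h2.fderiv]
    simp
  have key := h.3 φ hφs hφc (hφt.trans hKΩ) e
  have hz : ∀ y, y ∉ K → φ y = 0 := fun y hy => image_eq_zero_of_notMem_tsupport fun h => hy (hφt h)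
  have hz' : ∀ y, y ∉ K → fderiv ℝ φ y e = 0 := fun y hy => image_eq_zero_of_notMem_tsupport
    (f := fun y => fderiv ℝ φ y e) fun h =>
      hy (tsupport_fderiv_apply_subset_of_subset (Ω := K) hφt e h)
  have lhs : fderiv ℝ (convolution r (K.indicator u) (ContinuousLinearMap.lsmul ℝ ℝ) volume) x e
      = - ∫ y in Ω, u y * fderiv ℝ φ y e := by
    rw [← convolution_flip, (hrc.hasFDerivAt_convolution_right _ hu.locallyIntegrable
      (hrs.of_le (by simp)) x).fderiv, convolution_precompR_apply _ hu.locallyIntegrable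
      (hrc.fderiv ℝ) (hrs.continuous_fderiv (by simp)), convolution_def, ← integral_neg,
      setIntegral_eq_integral_of_forall_compl_eq_zero]
    · refine integral_congr_ae (.of_forall fun y => ?_)
      by_cases hy : y ∈ K
      · simp [hy, hφd, mul_comm]
      · simp [hy, hz' y hy]
    · intro y hy
      rw [hz' y fun h => hy (hKΩ h)]; simp
  have rhs : inner ℝ (convolution r (K.indicator g) (ContinuousLinearMap.lsmul ℝ ℝ) volume x) e
      = ∫ y in Ω, inner ℝ (g y) e * φ y := by
    have hi : Integrable (fun y => r (x - y) • K.indicator g y) := by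
      have := hrc.convolutionExists_left (ContinuousLinearMap.lsmul ℝ ℝ) hrs.continuous
        hg.locallyIntegrable x
      simpa using this.integrable_swap
    rw [convolution_eq_swap, real_inner_comm]
    simp only [ContinuousLinearMap.lsmul_apply]
    rw [← integral_inner hi, setIntegral_eq_integral_of_forall_compl_eq_zero]
    · refine integral_congr_ae (.of_forall fun y => ?_)
      by_cases hy : y ∈ K
      · simp [hy, inner_smul_right, real_inner_comm, hφ, mul_comm]
      · simp [hy, hz y hy]
    · intro y hy
      rw [hz y fun h => hy (hKΩ h)]; simp
  rw [lhs, rhs, key, neg_neg]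

/-- A sequence of bump functions with radii shrinking to zero. -/
theorem exists_seq_contDiffBump (G : Type*) [NormedAddCommGroup G] [NormedSpace ℝ G] {δ : ℝ}
    (hδ : 0 < δ) : ∃ ρ : ℕ → ContDiffBump (0 : G), (∀ n, (ρ n).rOut ≤ δ) ∧
      (∀ n, (ρ n).rOut ≤ 2 * (ρ n).rIn) ∧ Tendsto (fun n => (ρ n).rOut) atTop (𝓝 0) := by
  refine ⟨fun n => ⟨δ / (n + 1) / 2, δ / (n + 1), by positivity,
    half_lt_self (by positivity)⟩, fun n => ?_, fun n => ?_, ?_⟩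
  · exact div_le_self hδ.le (by linarith [n.cast_nonneg (α := ℝ)])
  · dsimp only; linarith
  · exact tendsto_const_div_atTop_nhds_zero_nat δ |>.comp (tendsto_add_atTop_nat 1) |>.congr
      fun n => by simp

/-- The chain rule for weak gradients, for a `C¹` function with bounded derivative. It is
transported from the mollifications of `u`. -/
theorem HasWeakGradient.comp (hΩ : IsOpen Ω) (h : HasWeakGradient Ω u g) {β β' : ℝ → ℝ}
    (hβ : ∀ s, HasDerivAt β (β' s) s) (hc : Continuous β') {M : ℝ} (hM : ∀ s, |β' s| ≤ M) :
    HasWeakGradient Ω (fun x => β (u x)) (fun x => β' (u x) • g x) := by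
  have hβc : Continuous β := continuous_iff_continuousAt.2 fun s => (hβ s).continuousAt
  have hlip : ∀ a b, |β a - β b| ≤ M * |a - b| := fun a b =>
    Convex.norm_image_sub_le_of_norm_hasDerivWithin_le (f' := β') (s := univ)
      (fun s _ => (hβ s).hasDerivWithinAt) (fun s _ => hM s) convex_univ (mem_univ b) (mem_univ a)
  have hM0 : 0 ≤ M := (abs_nonneg _).trans (hM 0)
  have hl1 : LocallyIntegrableOn (fun x => β (u x)) Ω := by
    have hcst : LocallyIntegrableOn (fun _ : EuclideanSpace ℝ (Fin d) => |β 0|) Ω :=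
      continuous_const.locallyIntegrable.locallyIntegrableOn _
    refine LocallyIntegrableOn.mono_norm (h := fun x => |β 0| + M * ‖u x‖)
      (hcst.add (h.1.norm.smul M)) (hβc.comp_aestronglyMeasurable h.1.aestronglyMeasurable)
      (.of_forall fun x => ?_)
    refine le_trans ?_ (le_abs_self _)
    have h1 := hlip (u x) 0
    have h2 := abs_add_le (β (u x) - β 0) (β 0)
    simp only [sub_add_cancel, sub_zero, Real.norm_eq_abs] at *
    linarith
  have hl2 : LocallyIntegrableOn (fun x => β' (u x) • g x) Ω := by
    refine LocallyIntegrableOn.mono_norm (h := fun x => M • g x) (h.2.smul M)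
      ((hc.comp_aestronglyMeasurable h.1.aestronglyMeasurable).smul h.2.aestronglyMeasurable)
      (.of_forall fun x => ?_)
    rw [norm_smul, norm_smul, Real.norm_of_nonneg hM0]
    gcongr
    exact hM _
  refine ⟨hl1, hl2, fun φ h1 h2 h3 e => ?_⟩
  -- `u` is truncated to a compact neighbourhood of the support of `φ`, and then mollified
  obtain ⟨δ, hδ, hδΩ⟩ := h2.isCompact.exists_cthickening_subset_open hΩ h3
  set K := Metric.cthickening δ (tsupport φ) with hKdef
  have hKc : IsCompact K := h2.isCompact.cthickening
  have hφK : ∀ x, x ∉ K → φ x = 0 := fun x hx =>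
    image_eq_zero_of_notMem_tsupport fun h => hx (Metric.self_subset_cthickening _ h)
  have hKm : MeasurableSet K := hKc.measurableSet
  have hu : Integrable (K.indicator u) := (integrable_indicator_iff hKm).2
    ((locallyIntegrableOn_iff hΩ.isLocallyClosed).1 h.1 K hδΩ hKc)
  have hg : Integrable (K.indicator g) := (integrable_indicator_iff hKm).2
    ((locallyIntegrableOn_iff hΩ.isLocallyClosed).1 h.2 K hδΩ hKc)
  obtain ⟨ρ, hρδ, hρ2, hρ⟩ := exists_seq_contDiffBump (EuclideanSpace ℝ (Fin d)) hδ
  set U : ℕ → EuclideanSpace ℝ (Fin d) → ℝ := fun n => convolution ((ρ n).normed volume)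
    (K.indicator u) (ContinuousLinearMap.lsmul ℝ ℝ) volume with hU
  set Γ : ℕ → EuclideanSpace ℝ (Fin d) → EuclideanSpace ℝ (Fin d) := fun n =>
    convolution ((ρ n).normed volume) (K.indicator g) (ContinuousLinearMap.lsmul ℝ ℝ) volume with hG
  have hUs : ∀ n, ContDiff ℝ ∞ (U n) := fun n =>
    (ρ n).hasCompactSupport_normed.contDiff_convolution_left _ (ρ n).contDiff_normed
      hu.locallyIntegrable
  have hΓc : ∀ n, Continuous (Γ n) := fun n =>
    (ρ n).hasCompactSupport_normed.continuous_convolution_left _ (ρ n).continuous_normed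
      hg.locallyIntegrable
  have hUL := tendsto_lintegral_convolution_sub hρ hu
  have hΓL := tendsto_lintegral_convolution_sub hρ hg
  have hUae : ∀ᵐ x, Tendsto (fun n => U n x) atTop (𝓝 (K.indicator u x)) :=
    ContDiffBump.ae_convolution_tendsto_right_of_locallyIntegrable hρ (.of_forall hρ2)
      hu.locallyIntegrable
  set ψ : EuclideanSpace ℝ (Fin d) → ℝ := fun x => fderiv ℝ φ x e with hψ
  have hψc : Continuous ψ := continuous_fderiv_apply_of_contDiff h1 e
  have hψs : HasCompactSupport ψ := hasCompactSupport_fderiv_apply h2 e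
  have hψK : ∀ x, x ∉ K → ψ x = 0 := fun x hx => image_eq_zero_of_notMem_tsupport fun h =>
    hx (Metric.self_subset_cthickening _ (tsupport_fderiv_apply_subset ℝ e h))
  obtain ⟨C, hC⟩ := h2.exists_bound_of_continuous h1.continuous
  obtain ⟨C', hC'⟩ := hψs.exists_bound_of_continuous hψc
  have hC0 : 0 ≤ C := (norm_nonneg _).trans (hC 0)
  have hC'0 : 0 ≤ C' := (norm_nonneg _).trans (hC' 0)
  -- integration by parts for the mollified functions
  have hn : ∀ n, ∫ x, β (U n x) * ψ x = - ∫ x, β' (U n x) * inner ℝ (Γ n x) e * φ x := by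
    intro n
    have hd : ∀ x, HasFDerivAt (fun x => β (U n x)) (β' (U n x) • fderiv ℝ (U n) x) x := fun x =>
      (hβ (U n x)).comp_hasFDerivAt x ((hUs n).differentiable (by simp) x).hasFDerivAt
    have hd' : ∀ x, fderiv ℝ (fun x => β (U n x)) x e = β' (U n x) * fderiv ℝ (U n) x e :=
      fun x => by rw [(hd x).fderiv]; simp
    have hcU := (hUs n).continuous
    have hcd : Continuous fun x => fderiv ℝ (U n) x e :=
      continuous_fderiv_apply_of_contDiff (hUs n) e
    rw [integral_mul_fderiv_eq_neg_fderiv_mul_of_integrable (f := fun x => β (U n x)) (g := φ)]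
    · congr 1
      refine integral_congr_ae (.of_forall fun x => ?_)
      by_cases hx : x ∈ tsupport φ
      · have := h.fderiv_convolution hδΩ hu hg (ρ n) x e
          ((Metric.closedBall_subset_closedBall (hρδ n)).trans
            (Metric.closedBall_subset_cthickening hx δ))
        simp only
        rw [hd', show fderiv ℝ (U n) x e = inner ℝ (Γ n x) e from this]
      · simp [image_eq_zero_of_notMem_tsupport hx]
    · simp only [hd']
      exact (((hc.comp hcU).mul hcd).mul h1.continuous).integrable_of_hasCompactSupport h2.mul_left
    · exact ((hβc.comp hcU).mul hψc).integrable_of_hasCompactSupport hψs.mul_left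
    · exact ((hβc.comp hcU).mul h1.continuous).integrable_of_hasCompactSupport h2.mul_left
    · exact fun x _ => (hd x).differentiableAt
    · exact fun x _ => h1.differentiable (by simp) x
  have lim1 : Tendsto (fun n => ∫ x, β (U n x) * ψ x) atTop
      (𝓝 (∫ x, β (K.indicator u x) * ψ x)) := by
    refine tendsto_integral_of_L1 _
      ((hβc.comp_aestronglyMeasurable hu.1).mul hψc.aestronglyMeasurable) (.of_forall fun n =>
        ((hβc.comp (hUs n).continuous).mul hψc).integrable_of_hasCompactSupport hψs.mul_left) ?_
    have := ENNReal.Tendsto.const_mul (a := ENNReal.ofReal (M * C')) hUL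
      (.inr ENNReal.ofReal_ne_top)
    rw [mul_zero] at this
    refine tendsto_of_tendsto_of_tendsto_of_le_of_le tendsto_const_nhds this
      (fun n => zero_le) fun n => ?_
    dsimp only
    rw [← lintegral_const_mul' _ _ ENNReal.ofReal_ne_top]
    refine lintegral_mono fun x => ?_
    simp only [Pi.mul_apply]
    rw [← ofReal_norm, ← ofReal_norm, ← ENNReal.ofReal_mul (by positivity), ← sub_mul, norm_mul]
    refine ENNReal.ofReal_le_ofReal ?_
    calc _ ≤ (M * ‖U n x - K.indicator u x‖) * C' :=
          mul_le_mul (hlip _ _) (hC' x) (norm_nonneg _) (by positivity)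
      _ = _ := by simp only [hU]; ring
  have lim2 : Tendsto (fun n => ∫ x, β' (U n x) * inner ℝ (Γ n x) e * φ x) atTop
      (𝓝 (∫ x, β' (K.indicator u x) * inner ℝ (K.indicator g x) e * φ x)) := by
    have hint : ∀ (F : EuclideanSpace ℝ (Fin d) → EuclideanSpace ℝ (Fin d)) (n : ℕ),
        LocallyIntegrable F → Integrable (fun x => β' (U n x) * inner ℝ (F x) e * φ x) := by
      intro F n hF
      have hF' : LocallyIntegrableOn (fun x => inner ℝ (F x) e) univ :=
        LocallyIntegrableOn.inner_const isOpen_univ (locallyIntegrableOn_univ.2 hF) e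
      have := integrableOn_mul_of_tsupport_subset isOpen_univ hF'
        ((hc.comp (hUs n).continuous).mul h1.continuous) h2.mul_left (subset_univ _)
      refine this.congr (.of_forall fun x => ?_)
      simp only [Pi.mul_apply, Function.comp_apply]
      ring
    -- the gradients converge in `L¹`, while `β' (U n)` is only bounded and converges pointwise
    have hA : Tendsto (fun n => ∫ x, β' (U n x) * inner ℝ (Γ n x - K.indicator g x) e * φ x) atTop
        (𝓝 (∫ _ : EuclideanSpace ℝ (Fin d), (0 : ℝ))) := by
      refine tendsto_integral_of_L1 _ aestronglyMeasurable_const (.of_forall fun n =>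
        hint (fun x => Γ n x - K.indicator g x) n
        ((hΓc n).locallyIntegrable.sub hg.locallyIntegrable)) ?_
      have := ENNReal.Tendsto.const_mul (a := ENNReal.ofReal (M * ‖e‖ * C)) hΓL
        (.inr ENNReal.ofReal_ne_top)
      rw [mul_zero] at this
      refine tendsto_of_tendsto_of_tendsto_of_le_of_le tendsto_const_nhds this
        (fun n => zero_le) fun n => ?_
      dsimp only
      rw [← lintegral_const_mul' _ _ ENNReal.ofReal_ne_top]
      refine lintegral_mono fun x => ?_
      rw [← ofReal_norm, ← ofReal_norm, ← ENNReal.ofReal_mul (by positivity), sub_zero, norm_mul,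
        norm_mul]
      refine ENNReal.ofReal_le_ofReal ?_
      calc _ ≤ M * (‖Γ n x - K.indicator g x‖ * ‖e‖) * C := by
            gcongr
            · exact hM _
            · exact norm_inner_le_norm _ _
            · exact hC x
        _ = _ := by simp only [hG]; ring
    have hB : Tendsto (fun n => ∫ x, β' (U n x) * inner ℝ (K.indicator g x) e * φ x) atTop
        (𝓝 (∫ x, β' (K.indicator u x) * inner ℝ (K.indicator g x) e * φ x)) := by
      refine tendsto_integral_of_dominated_convergence
        (fun x => M * (‖K.indicator g x‖ * ‖e‖) * C)
        (fun n => (hint _ n hg.locallyIntegrable).1)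
        (((hg.norm.mul_const _).const_mul _).mul_const _) (fun n => .of_forall fun x => ?_) ?_
      · rw [norm_mul, norm_mul]
        gcongr
        · exact hM _
        · exact norm_inner_le_norm _ _
        · exact hC x
      · filter_upwards [hUae] with x hx
        exact (((hc.tendsto _).comp hx).mul_const _).mul_const _
    have hAB := hA.add hB
    rw [integral_zero, zero_add] at hAB
    refine hAB.congr fun n => ?_
    rw [← integral_add (hint (fun x => Γ n x - K.indicator g x) n
        ((hΓc n).locallyIntegrable.sub hg.locallyIntegrable))
      (hint _ n hg.locallyIntegrable)]
    refine integral_congr_ae (.of_forall fun x => ?_)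
    simp only [inner_sub_left]
    ring
  have e1 : ∫ x in Ω, β (u x) * fderiv ℝ φ x e = ∫ x, β (K.indicator u x) * ψ x := by
    rw [setIntegral_eq_integral_of_forall_compl_eq_zero
      (fun x hx => by
        rw [show fderiv ℝ φ x e = 0 from hψK x fun h => hx (hδΩ h), mul_zero])]
    refine integral_congr_ae (.of_forall fun x => ?_)
    by_cases hx : x ∈ K
    · simp [hx, hψ]
    · simp only
      rw [hψK x hx, show fderiv ℝ φ x e = 0 from hψK x hx, mul_zero, mul_zero]
  have e2 : ∫ x in Ω, inner ℝ (β' (u x) • g x) e * φ x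
      = ∫ x, β' (K.indicator u x) * inner ℝ (K.indicator g x) e * φ x := by
    rw [setIntegral_eq_integral_of_forall_compl_eq_zero
      (fun x hx => by rw [hφK x fun h => hx (hδΩ h), mul_zero])]
    refine integral_congr_ae (.of_forall fun x => ?_)
    by_cases hx : x ∈ K
    · simp [hx, inner_smul_left]
    · simp [hφK x hx]
  rw [e1, e2]
  exact tendsto_nhds_unique (lim1.congr hn) lim2.neg

end

/-! ### Translation estimates -/

section

variable {d : ℕ} {Ω : Set (EuclideanSpace ℝ (Fin d))} {u : EuclideanSpace ℝ (Fin d) → ℝ}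
  {g : EuclideanSpace ℝ (Fin d) → EuclideanSpace ℝ (Fin d)}

theorem aestronglyMeasurable_comp_add_smul {F : Type*} [TopologicalSpace F]
    {f : EuclideanSpace ℝ (Fin d) → F} (ν : Measure ℝ) [SFinite ν]
    (hf : AEStronglyMeasurable f volume) (y : EuclideanSpace ℝ (Fin d)) :
    AEStronglyMeasurable (fun q : ℝ × EuclideanSpace ℝ (Fin d) => f (q.2 + q.1 • y))
      (ν.prod volume) := by
  have hm : Measurable fun q : ℝ × EuclideanSpace ℝ (Fin d) => q.2 + q.1 • y := by fun_prop
  refine hf.comp_quasiMeasurePreserving ⟨hm, ?_⟩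
  refine Measure.AbsolutelyContinuous.mk fun s hs h0 => ?_
  rw [Measure.map_apply hm hs, Measure.prod_apply (hm hs)]
  simp only [preimage_preimage, measure_preimage_add_right, h0, lintegral_zero]

/-- The difference of a Sobolev function and its translate is the integral of the weak gradient
along the connecting segment; this needs only the segments issuing from `A` to stay in `Ω`. -/
theorem HasWeakGradient.translate_sub_ae_eq (hΩ : IsOpen Ω) (h : HasWeakGradient Ω u g)
    {A : Set (EuclideanSpace ℝ (Fin d))} (hA : IsOpen A) {y : EuclideanSpace ℝ (Fin d)}
    (hAy : ∀ x ∈ A, ∀ t ∈ Icc (0 : ℝ) 1, x + t • y ∈ Ω)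
    (hu : Integrable (Ω.indicator u)) (hg : Integrable (Ω.indicator g)) :
    ∀ᵐ x, x ∈ A → u (x + y) - u x
      = ∫ t in (0 : ℝ)..1, inner ℝ (Ω.indicator g (x + t • y)) y := by
  have hG : Integrable (fun q : ℝ × EuclideanSpace ℝ (Fin d) =>
      inner ℝ (Ω.indicator g (q.2 + q.1 • y)) y)
      ((volume.restrict (Ioc 0 1)).prod volume) := by
    have hm := aestronglyMeasurable_comp_add_smul (volume.restrict (Ioc 0 1)) hg.1 y
    have : Integrable (fun q : ℝ × EuclideanSpace ℝ (Fin d) => Ω.indicator g (q.2 + q.1 • y))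
        ((volume.restrict (Ioc 0 1)).prod volume) := by
      rw [integrable_prod_iff hm]
      refine ⟨.of_forall fun t => hg.comp_add_right (t • y), ?_⟩
      have : ∀ t : ℝ, ∫ x, ‖Ω.indicator g (x + t • y)‖ = ∫ x, ‖Ω.indicator g x‖ := fun t =>
        integral_add_right_eq_self (fun x => ‖Ω.indicator g x‖) (t • y)
      simp only [this]
      exact integrable_const _
    exact this.inner_const y
  set Γ : EuclideanSpace ℝ (Fin d) → ℝ := fun x =>
    ∫ t in (0 : ℝ)..1, inner ℝ (Ω.indicator g (x + t • y)) y with hΓ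
  have hΓi : Integrable Γ := by
    have := hG.integral_prod_right
    simpa only [hΓ, intervalIntegral.integral_of_le zero_le_one] using this
  set D : EuclideanSpace ℝ (Fin d) → ℝ := fun x => Ω.indicator u (x + y) - Ω.indicator u x with hD
  have hDi : Integrable D := (hu.comp_add_right y).sub hu
  have key : ∀ᵐ x, x ∈ A → D x - Γ x = 0 := by
    refine hA.ae_eq_zero_of_integral_contDiff_smul_eq_zero
      ((hDi.sub hΓi).locallyIntegrable.locallyIntegrableOn _) fun φ h1 h2 h3 => ?_
    obtain ⟨C, hC⟩ := h2.exists_bound_of_continuous h1.continuous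
    have mulφ : ∀ {f : EuclideanSpace ℝ (Fin d) → ℝ} (a : EuclideanSpace ℝ (Fin d)),
        Integrable f → Integrable fun x => f x * φ (x + a) := fun a hf =>
      hf.mul_bdd (c := C) (by fun_prop) (.of_forall fun x => hC _)
    have hψc : Continuous fun x => fderiv ℝ φ x y := continuous_fderiv_apply_of_contDiff h1 y
    obtain ⟨C', hC'⟩ := (hasCompactSupport_fderiv_apply h2 y).exists_bound_of_continuous hψc
    -- the translated test function, and its derivative along the translation
    have hline : ∀ x, φ (x - y) - φ x = - ∫ t in (0 : ℝ)..1, fderiv ℝ φ (x - t • y) y := by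
      intro x
      have hd : ∀ t ∈ uIcc (0 : ℝ) 1, HasDerivAt (fun t : ℝ => φ (x - t • y))
          (- fderiv ℝ φ (x - t • y) y) t := by
        intro t _
        have h3 : HasDerivAt (fun t : ℝ => x - t • y) (-y) t := by
          simpa using ((hasDerivAt_id t).smul_const y).const_sub x
        have h4 := (h1.differentiable (by simp) (x - t • y)).hasFDerivAt.comp_hasDerivAt t h3
        rw [map_neg] at h4
        exact h4
      have := intervalIntegral.integral_eq_sub_of_hasDerivAt hd
        (Continuous.intervalIntegrable (by fun_prop) _ _)
      simp only [intervalIntegral.integral_neg, one_smul, zero_smul, sub_zero] at this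
      exact this.symm
    -- the test function translated by `t • y` is still supported in `Ω`
    have hlow : ∀ t ∈ Ioc (0 : ℝ) 1, ∫ x, Ω.indicator u x * fderiv ℝ φ (x - t • y) y
        = - ∫ x, inner ℝ (Ω.indicator g (x + t • y)) y * φ x := by
      intro t ht
      have hts : tsupport (fun x => φ (x - t • y)) ⊆ Ω := by
        have : tsupport (fun x => φ (x - t • y)) = (fun x => x - t • y) ⁻¹' tsupport φ :=
          tsupport_comp_eq_preimage φ (Homeomorph.subRight (t • y))
        rw [this]
        intro x hx
        have := hAy _ (h3 hx) t ⟨ht.1.le, ht.2⟩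
        simpa using this
      have hdt : ∀ x, fderiv ℝ (fun x => φ (x - t • y)) x = fderiv ℝ φ (x - t • y) := fun x => by
        simp only [sub_eq_add_neg, fderiv_comp_add_right]
      have := h.3 (fun x => φ (x - t • y)) (h1.comp (contDiff_id.sub contDiff_const))
        (h2.comp_homeomorph (Homeomorph.subRight (t • y))) hts y
      rw [← integral_indicator hΩ.measurableSet, ← integral_indicator hΩ.measurableSet] at this
      have e1 : ∀ x, Ω.indicator (fun x => u x * fderiv ℝ (fun x => φ (x - t • y)) x y) x
          = Ω.indicator u x * fderiv ℝ φ (x - t • y) y := fun x => by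
        by_cases hx : x ∈ Ω <;> simp [hx, hdt]
      have e2 : ∀ x, Ω.indicator (fun x => inner ℝ (g x) y * φ (x - t • y)) x
          = inner ℝ (Ω.indicator g x) y * φ (x - t • y) := fun x => by
        by_cases hx : x ∈ Ω <;> simp [hx]
      simp only [e1, e2] at this
      rw [this, ← integral_add_right_eq_self (fun x => inner ℝ (Ω.indicator g x) y * φ (x - t • y))
        (t • y)]
      simp only [add_sub_cancel_right]
    have i1 : Integrable (fun x => Ω.indicator u (x + y) * φ x) := by
      simpa using mulφ 0 (hu.comp_add_right y)
    have i2 : Integrable (fun x => Ω.indicator u x * φ x) := by simpa using mulφ 0 hu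
    have i3 : Integrable (fun x => Γ x * φ x) := by simpa using mulφ 0 hΓi
    have i4 : Integrable (fun x => Ω.indicator u x * φ (x - y)) := by
      simpa [sub_eq_add_neg] using mulφ (-y) hu
    have f1 : Integrable (fun q : ℝ × EuclideanSpace ℝ (Fin d) =>
        Ω.indicator u q.2 * fderiv ℝ φ (q.2 - q.1 • y) y)
        ((volume.restrict (Ioc 0 1)).prod volume) :=
      (hu.comp_snd _).mul_bdd (c := C') (Continuous.aestronglyMeasurable (by fun_prop))
        (.of_forall fun q => hC' _)
    have f2 : Integrable (fun q : ℝ × EuclideanSpace ℝ (Fin d) =>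
        inner ℝ (Ω.indicator g (q.2 + q.1 • y)) y * φ q.2)
        ((volume.restrict (Ioc 0 1)).prod volume) :=
      hG.mul_bdd (c := C) (h1.continuous.comp continuous_snd).aestronglyMeasurable
        (.of_forall fun q => hC _)
    have hDφ : ∫ x, D x * φ x = ∫ x, Γ x * φ x := by
      calc ∫ x, D x * φ x = ∫ x, Ω.indicator u x * (φ (x - y) - φ x) := by
            simp only [hD, sub_mul, mul_sub]
            rw [integral_sub i1 i2, integral_sub i4 i2,
              ← integral_add_right_eq_self (fun x => Ω.indicator u x * φ (x - y)) y]
            simp only [add_sub_cancel_right]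
        _ = - ∫ x, ∫ t in Ioc (0 : ℝ) 1, Ω.indicator u x * fderiv ℝ φ (x - t • y) y := by
            rw [← integral_neg]
            refine integral_congr_ae (.of_forall fun x => ?_)
            simp only
            rw [hline, integral_const_mul, intervalIntegral.integral_of_le zero_le_one, mul_neg]
        _ = - ∫ t in Ioc (0 : ℝ) 1, ∫ x, Ω.indicator u x * fderiv ℝ φ (x - t • y) y := by
            rw [← integral_integral_swap f1]
        _ = ∫ t in Ioc (0 : ℝ) 1, ∫ x, inner ℝ (Ω.indicator g (x + t • y)) y * φ x := by
            rw [← integral_neg]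
            refine setIntegral_congr_fun measurableSet_Ioc fun t ht => ?_
            rw [hlow t ht, neg_neg]
        _ = ∫ x, ∫ t in Ioc (0 : ℝ) 1, inner ℝ (Ω.indicator g (x + t • y)) y * φ x :=
            integral_integral_swap f2
        _ = ∫ x, Γ x * φ x := by
            refine integral_congr_ae (.of_forall fun x => ?_)
            simp only [hΓ, intervalIntegral.integral_of_le zero_le_one, integral_mul_const]
    have i5 : Integrable (fun x => D x * φ x) := by simpa using mulφ 0 hDi
    calc ∫ x, φ x • (D x - Γ x) = ∫ x, (D x * φ x - Γ x * φ x) :=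
          integral_congr_ae (.of_forall fun x => by simp only [smul_eq_mul]; ring)
      _ = 0 := by rw [integral_sub i5 i3, hDφ, sub_self]
  filter_upwards [key] with x hx hxA
  have h0 := hAy x hxA 0 (by simp)
  have h1 := hAy x hxA 1 (by simp)
  simp only [zero_smul, one_smul, add_zero] at h0 h1
  have := hx hxA
  simp only [hD, indicator_of_mem h0, indicator_of_mem h1] at this
  linarith

theorem sq_lintegral_le_measure_mul_lintegral_sq {α : Type*} [MeasurableSpace α] {μ : Measure α}
    {f : α → ENNReal} (hf : AEMeasurable f μ) :
    (∫⁻ a, f a ∂μ) ^ 2 ≤ μ univ * ∫⁻ a, f a ^ 2 ∂μ := by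
  have h := ENNReal.lintegral_mul_le_Lp_mul_Lq μ Real.HolderConjugate.two_two hf
    (aemeasurable_const (b := (1 : ENNReal)))
  simp only [Pi.mul_apply, mul_one, ENNReal.rpow_ofNat] at h
  simp only [one_pow, lintegral_one] at h
  calc (∫⁻ a, f a ∂μ) ^ 2
      ≤ ((∫⁻ a, f a ^ 2 ∂μ) ^ (1 / 2 : ℝ) * μ univ ^ (1 / 2 : ℝ)) ^ 2 := by gcongr
    _ = μ univ * ∫⁻ a, f a ^ 2 ∂μ := by
        rw [mul_pow, ← ENNReal.rpow_mul_natCast, ← ENNReal.rpow_mul_natCast, mul_comm]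
        norm_num

/-- Translation estimate in `L²` for functions with square integrable weak gradient. -/
theorem HasWeakGradient.lintegral_translate_sub_sq_le (hΩ : IsOpen Ω) (h : HasWeakGradient Ω u g)
    {A : Set (EuclideanSpace ℝ (Fin d))} (hA : IsOpen A) {y : EuclideanSpace ℝ (Fin d)}
    (hAy : ∀ x ∈ A, ∀ t ∈ Icc (0 : ℝ) 1, x + t • y ∈ Ω)
    (hu : Integrable (Ω.indicator u)) (hg : Integrable (Ω.indicator g)) :
    ∫⁻ x in A, ‖u (x + y) - u x‖ₑ ^ 2 ≤ ‖y‖ₑ ^ 2 * ∫⁻ x in Ω, ‖g x‖ₑ ^ 2 := by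
  have hm := aestronglyMeasurable_comp_add_smul (volume.restrict (Ioc 0 1)) hg.1 y
  have hm' : ∀ᵐ x, AEStronglyMeasurable (fun t : ℝ => Ω.indicator g (x + t • y))
      (volume.restrict (Ioc 0 1)) := hm.prod_swap.prodMk_left
  have hE : AEMeasurable (fun q : ℝ × EuclideanSpace ℝ (Fin d) =>
      ‖y‖ₑ ^ 2 * ‖Ω.indicator g (q.2 + q.1 • y)‖ₑ ^ 2)
      ((volume.restrict (Ioc 0 1)).prod volume) := (hm.enorm.pow_const 2).const_mul _
  calc ∫⁻ x in A, ‖u (x + y) - u x‖ₑ ^ 2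
      ≤ ∫⁻ x in A, ∫⁻ t in Ioc (0 : ℝ) 1, ‖y‖ₑ ^ 2 * ‖Ω.indicator g (x + t • y)‖ₑ ^ 2 := by
        refine setLIntegral_mono_ae' hA.measurableSet ?_
        filter_upwards [h.translate_sub_ae_eq hΩ hA hAy hu hg, hm'] with x hx hmx hxA
        rw [hx hxA, intervalIntegral.integral_of_le zero_le_one]
        calc _ ≤ (∫⁻ t in Ioc (0 : ℝ) 1, ‖inner ℝ (Ω.indicator g (x + t • y)) y‖ₑ) ^ 2 := by
              gcongr
              exact enorm_integral_le_lintegral_enorm _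
          _ ≤ volume.restrict (Ioc (0 : ℝ) 1) univ *
              ∫⁻ t in Ioc (0 : ℝ) 1, ‖inner ℝ (Ω.indicator g (x + t • y)) y‖ₑ ^ 2 :=
              sq_lintegral_le_measure_mul_lintegral_sq (hmx.inner_const).enorm
          _ ≤ _ := by
              simp only [Measure.restrict_apply_univ, Real.volume_Ioc, sub_zero,
                ENNReal.ofReal_one, one_mul]
              refine lintegral_mono fun t => ?_
              rw [← mul_pow, mul_comm]
              gcongr
              rw [← ofReal_norm, ← ofReal_norm, ← ofReal_norm, ← ENNReal.ofReal_mul (norm_nonneg _)]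
              exact ENNReal.ofReal_le_ofReal (norm_inner_le_norm _ _)
    _ ≤ ∫⁻ x, ∫⁻ t in Ioc (0 : ℝ) 1, ‖y‖ₑ ^ 2 * ‖Ω.indicator g (x + t • y)‖ₑ ^ 2 :=
        setLIntegral_le_lintegral _ _
    _ = ∫⁻ t in Ioc (0 : ℝ) 1, ∫⁻ x, ‖y‖ₑ ^ 2 * ‖Ω.indicator g (x + t • y)‖ₑ ^ 2 :=
        (lintegral_lintegral_swap hE).symm
    _ = ∫⁻ t in Ioc (0 : ℝ) 1, ‖y‖ₑ ^ 2 * ∫⁻ x, ‖Ω.indicator g x‖ₑ ^ 2 := by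
        refine lintegral_congr fun t => ?_
        rw [lintegral_const_mul' _ _ (by simp),
          lintegral_add_right_eq_self (fun x => ‖Ω.indicator g x‖ₑ ^ 2) (t • y)]
    _ = ‖y‖ₑ ^ 2 * ∫⁻ x in Ω, ‖g x‖ₑ ^ 2 := by
        rw [← lintegral_indicator hΩ.measurableSet]
        simp only [lintegral_const, Measure.restrict_apply_univ, Real.volume_Ioc, sub_zero,
          ENNReal.ofReal_one, mul_one]
        congr 2
        ext x
        by_cases hx : x ∈ Ω <;> simp [hx]

end

/-! ### The cone property and approximation by averages -/

section

variable {d : ℕ} {Ω : Set (EuclideanSpace ℝ (Fin d))} {u : EuclideanSpace ℝ (Fin d) → ℝ}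
  {g : EuclideanSpace ℝ (Fin d) → EuclideanSpace ℝ (Fin d)}

/-- The local cone property: near each point of its closure, a Lipschitz domain contains, together
with each of its points, a truncated cone with vertex at that point, whose shape does not depend on
the point. -/
theorem IsBoundedLipschitzDomain.exists_cone (hΩ : IsBoundedLipschitzDomain Ω)
    {p : EuclideanSpace ℝ (Fin d)} (hp : p ∈ closure Ω) :
    ∃ r > 0, ∃ e : EuclideanSpace ℝ (Fin d), ∃ ρ > 0, ∃ h₀ > 0, ∀ x ∈ Ω ∩ Metric.ball p r,
      ∀ s ∈ Metric.ball e ρ, ∀ t ∈ Icc (0 : ℝ) h₀, x + t • s ∈ Ω := by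
  by_cases hpΩ : p ∈ Ω
  · obtain ⟨R, hR, hRΩ⟩ := Metric.isOpen_iff.1 hΩ.isOpen p hpΩ
    refine ⟨R / 2, by positivity, 0, 1, one_pos, R / 2, by positivity, fun x hx s hs t ht => hRΩ ?_⟩
    have h1 : ‖x - p‖ < R / 2 := by simpa [dist_eq_norm] using hx.2
    have h2 : ‖s‖ < 1 := by simpa using hs
    rw [Metric.mem_ball, dist_eq_norm]
    calc ‖x + t • s - p‖ = ‖(x - p) + t • s‖ := by congr 1; abel
      _ ≤ ‖x - p‖ + t * ‖s‖ := (norm_add_le _ _).trans (by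
          rw [norm_smul, Real.norm_of_nonneg ht.1])
      _ < R := by nlinarith [norm_nonneg s, ht.1, ht.2]
  · obtain ⟨e, r, K, f, he, hr, hf, hx⟩ := hΩ.lipschitz_boundary p
      (by rw [hΩ.isOpen.frontier_eq]; exact ⟨hp, hpΩ⟩)
    have hee : inner ℝ e e = (1 : ℝ) := by rw [real_inner_self_eq_norm_sq, he, one_pow]
    -- with this radius, `t • s` rises by more than the graph can along its horizontal part
    set ρ : ℝ := 1 / (1 + 2 * K) with hρ
    have hK : (0 : ℝ) ≤ K := K.2
    have hρ0 : 0 < ρ := by positivity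
    have hρ1 : ρ ≤ 1 := by rw [hρ, div_le_one (by positivity)]; linarith
    have hρK : 2 * K * ρ + ρ = 1 := by rw [hρ]; field_simp; ring
    refine ⟨r / 2, by positivity, e, ρ, hρ0, r / 4, by positivity, fun x hxx s hs t ht => ?_⟩
    have h1 : ‖x - p‖ < r / 2 := by simpa [dist_eq_norm] using hxx.2
    have h2 : ‖s - e‖ < ρ := by simpa [dist_eq_norm] using hs
    have hsn : ‖s‖ ≤ 2 := by
      calc ‖s‖ = ‖(s - e) + e‖ := by simp
        _ ≤ ‖s - e‖ + ‖e‖ := norm_add_le _ _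
        _ ≤ 2 := by rw [he]; linarith
    have hxb : x ∈ Metric.ball p r := by
      rw [Metric.mem_ball, dist_eq_norm]; linarith
    have hxs : x + t • s ∈ Metric.ball p r := by
      rw [Metric.mem_ball, dist_eq_norm]
      calc ‖x + t • s - p‖ = ‖(x - p) + t • s‖ := by congr 1; abel
        _ ≤ ‖x - p‖ + t * ‖s‖ := (norm_add_le _ _).trans (by
            rw [norm_smul, Real.norm_of_nonneg ht.1])
        _ < r := by nlinarith [norm_nonneg s, ht.1, ht.2]
    rcases ht.1.eq_or_lt with h0 | h0
    · rw [← h0, zero_smul, add_zero]; exact hxx.1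
    rw [hx _ hxs]
    have hx1 := (hx x hxb).1 hxx.1
    have hse : 1 - ‖s - e‖ ≤ inner ℝ e s := by
      have h3 := abs_real_inner_le_norm e (s - e)
      rw [inner_sub_right, hee, he, one_mul] at h3
      linarith [(abs_le.1 h3).1]
    have hlip := hf.dist_le_mul (x + t • s - inner ℝ e (x + t • s) • e) (x - inner ℝ e x • e)
    rw [Real.dist_eq, dist_eq_norm] at hlip
    have hdiff : x + t • s - inner ℝ e (x + t • s) • e - (x - inner ℝ e x • e)
        = t • ((s - e) - inner ℝ e (s - e) • e) := by
      simp only [inner_add_right, inner_smul_right, inner_sub_right, hee]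
      module
    have hproj : ‖(s - e) - inner ℝ e (s - e) • e‖ ≤ 2 * ‖s - e‖ := by
      refine (norm_sub_le _ _).trans ?_
      rw [norm_smul, he, mul_one, Real.norm_eq_abs]
      have := abs_real_inner_le_norm e (s - e)
      rw [he] at this
      linarith
    rw [hdiff, norm_smul, Real.norm_of_nonneg ht.1] at hlip
    have h5 : (K : ℝ) * (t * ‖(s - e) - inner ℝ e (s - e) • e‖) ≤ K * (t * (2 * ‖s - e‖)) := by
      gcongr
    have h6 := (abs_le.1 (hlip.trans h5)).2
    rw [inner_add_right, inner_smul_right] at h6 ⊢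
    have h7 : t * (2 * K * ‖s - e‖ + ‖s - e‖) < t * 1 := by
      apply mul_lt_mul_of_pos_left _ h0
      nlinarith
    nlinarith

theorem enorm_sq_eq_ofReal_sq (a : ℝ) : ‖a‖ₑ ^ 2 = ENNReal.ofReal (a ^ 2) := by
  rw [← ofReal_norm, ← ENNReal.ofReal_pow (norm_nonneg _), Real.norm_eq_abs, sq_abs]

theorem aestronglyMeasurable_comp_add {F : Type*} [TopologicalSpace F]
    {f : EuclideanSpace ℝ (Fin d) → F} (ν : Measure (EuclideanSpace ℝ (Fin d))) [SFinite ν]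
    (hf : AEStronglyMeasurable f volume) :
    AEStronglyMeasurable (fun q : EuclideanSpace ℝ (Fin d) × EuclideanSpace ℝ (Fin d) =>
      f (q.1 + q.2)) (volume.prod ν) := by
  have hm : Measurable fun q : EuclideanSpace ℝ (Fin d) × EuclideanSpace ℝ (Fin d) =>
    q.1 + q.2 := by fun_prop
  refine hf.comp_quasiMeasurePreserving ⟨hm, ?_⟩
  refine Measure.AbsolutelyContinuous.mk fun s hs h0 => ?_
  rw [Measure.map_apply hm hs, Measure.prod_apply_symm (hm hs)]
  simp only [preimage_preimage, measure_preimage_add_right, h0, lintegral_zero]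

theorem integrable_comp_add {f : EuclideanSpace ℝ (Fin d) → ℝ}
    (ν : Measure (EuclideanSpace ℝ (Fin d))) [IsFiniteMeasure ν] (hf : Integrable f) :
    Integrable (fun q : EuclideanSpace ℝ (Fin d) × EuclideanSpace ℝ (Fin d) => f (q.1 + q.2))
      (volume.prod ν) := by
  rw [integrable_prod_iff' (aestronglyMeasurable_comp_add ν hf.1)]
  refine ⟨.of_forall fun y => hf.comp_add_right y, ?_⟩
  have : ∀ y, ∫ x, ‖f (x + y)‖ = ∫ x, ‖f x‖ := fun y =>
    integral_add_right_eq_self (fun x => ‖f x‖) y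
  simp only [this]
  exact integrable_const _

/-- A Sobolev function is close in `L²` to its averages over small translations, provided these
stay inside `Ω`. -/
theorem HasWeakGradient.lintegral_sub_average_sq_le (hΩ : IsOpen Ω) (h : HasWeakGradient Ω u g)
    {A : Set (EuclideanSpace ℝ (Fin d))} (hA : IsOpen A)
    (hu : Integrable (Ω.indicator u)) (hg : Integrable (Ω.indicator g))
    {ν : Measure (EuclideanSpace ℝ (Fin d))} [IsProbabilityMeasure ν] {δ : ENNReal}
    (hν : ∀ᵐ y ∂ν, ‖y‖ₑ ≤ δ ∧ ∀ x ∈ A, ∀ t ∈ Icc (0 : ℝ) 1, x + t • y ∈ Ω) :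
    ∫⁻ x in A, ‖u x - ∫ y, Ω.indicator u (x + y) ∂ν‖ₑ ^ 2
      ≤ δ ^ 2 * ∫⁻ x in Ω, ‖g x‖ₑ ^ 2 := by
  have hi := integrable_comp_add ν hu
  have hm : AEStronglyMeasurable (fun q : EuclideanSpace ℝ (Fin d) × EuclideanSpace ℝ (Fin d) =>
      Ω.indicator u (q.1 + q.2) - Ω.indicator u q.1) (volume.prod ν) :=
    hi.1.sub hu.1.comp_fst
  have hE : AEMeasurable (fun q : EuclideanSpace ℝ (Fin d) × EuclideanSpace ℝ (Fin d) =>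
      ‖Ω.indicator u (q.1 + q.2) - Ω.indicator u q.1‖ₑ ^ 2) ((volume.restrict A).prod ν) := by
    refine (hm.enorm.pow_const 2).mono_ac (Measure.AbsolutelyContinuous.prod ?_ .rfl)
    exact Measure.absolutelyContinuous_of_le Measure.restrict_le_self
  calc ∫⁻ x in A, ‖u x - ∫ y, Ω.indicator u (x + y) ∂ν‖ₑ ^ 2
      ≤ ∫⁻ x in A, ∫⁻ y, ‖Ω.indicator u (x + y) - Ω.indicator u x‖ₑ ^ 2 ∂ν := by
        refine setLIntegral_mono_ae' hA.measurableSet ?_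
        filter_upwards [hi.prod_right_ae, hm.prodMk_left] with x hx hmx hxA
        obtain ⟨y, hy⟩ := hν.exists
        have hxΩ : x ∈ Ω := by simpa using hy.2 x hxA 0 (by simp)
        have e1 : u x - ∫ y, Ω.indicator u (x + y) ∂ν
            = - ∫ y, (Ω.indicator u (x + y) - Ω.indicator u x) ∂ν := by
          rw [integral_sub hx (integrable_const _)]
          simp [hxΩ]
        rw [e1, enorm_neg]
        calc _ ≤ (∫⁻ y, ‖Ω.indicator u (x + y) - Ω.indicator u x‖ₑ ∂ν) ^ 2 := by
              gcongr
              exact enorm_integral_le_lintegral_enorm _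
          _ ≤ ν univ * ∫⁻ y, ‖Ω.indicator u (x + y) - Ω.indicator u x‖ₑ ^ 2 ∂ν :=
              sq_lintegral_le_measure_mul_lintegral_sq hmx.enorm
          _ = _ := by rw [measure_univ, one_mul]
    _ = ∫⁻ y, (∫⁻ x in A, ‖Ω.indicator u (x + y) - Ω.indicator u x‖ₑ ^ 2) ∂ν :=
        lintegral_lintegral_swap hE
    _ ≤ ∫⁻ _, (δ ^ 2 * ∫⁻ x in Ω, ‖g x‖ₑ ^ 2) ∂ν := by
        refine lintegral_mono_ae ?_
        filter_upwards [hν] with y hy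
        refine le_trans (le_of_eq ?_) ((h.lintegral_translate_sub_sq_le hΩ hA hy.2 hu hg).trans ?_)
        · refine setLIntegral_congr_fun hA.measurableSet fun x hx => ?_
          have h0 := hy.2 x hx 0 (by simp)
          have h1 := hy.2 x hx 1 (by simp)
          simp only [zero_smul, one_smul, add_zero] at h0 h1
          simp only [indicator_of_mem h0, indicator_of_mem h1]
        · gcongr
          exact hy.1
    _ = δ ^ 2 * ∫⁻ x in Ω, ‖g x‖ₑ ^ 2 := by simp

/-- The local step of the Rellich compactness theorem: under a uniform cone condition on `A`, a
weakly convergent sequence with bounded gradients is Cauchy in `L²(A)`, because its averages over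
small balls inside the cones converge pointwise. -/
theorem lintegral_sub_sq_small_of_cone (hΩ : IsOpen Ω)
    {u : ℕ → EuclideanSpace ℝ (Fin d) → ℝ}
    {g : ℕ → EuclideanSpace ℝ (Fin d) → EuclideanSpace ℝ (Fin d)}
    (h : ∀ n, HasWeakGradient Ω (u n) (g n))
    (hu : ∀ n, Integrable (Ω.indicator (u n))) (hg : ∀ n, Integrable (Ω.indicator (g n)))
    {C : ℝ} (hC : ∀ n, ∫ x, ‖Ω.indicator (u n) x‖ ≤ C)
    {M : ENNReal} (hMt : M ≠ ⊤) (hM : ∀ n, ∫⁻ x in Ω, ‖g n x‖ₑ ^ 2 ≤ M)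
    (hw : ∀ S, MeasurableSet S → ∃ l, Tendsto (fun n => ∫ x in S, Ω.indicator (u n) x) atTop (𝓝 l))
    {A : Set (EuclideanSpace ℝ (Fin d))} (hA : IsOpen A) (hAv : volume A ≠ ⊤)
    {e : EuclideanSpace ℝ (Fin d)} {ρ h₀ : ℝ} (hρ : 0 < ρ) (hh₀ : 0 < h₀)
    (hcone : ∀ x ∈ A, ∀ s ∈ Metric.ball e ρ, ∀ t ∈ Icc (0 : ℝ) h₀, x + t • s ∈ Ω)
    {ε : ENNReal} (hε : ε ≠ 0) :
    ∃ N, ∀ n ≥ N, ∀ m ≥ N, ∫⁻ x in A, ‖u n x - u m x‖ₑ ^ 2 ≤ ε := by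
  -- the length `τ` of the cones; the constants match the splitting of `u n - u m` into four terms
  obtain ⟨τ, hτ0, hτh, hτε⟩ : ∃ τ : ℝ, 0 < τ ∧ τ ≤ h₀ ∧
      8 * (ENNReal.ofReal (τ * (‖e‖ + ρ)) ^ 2 * M) ≤ ε / 2 := by
    have hlim : Tendsto (fun τ : ℝ => 8 * (ENNReal.ofReal (τ * (‖e‖ + ρ)) ^ 2 * M)) (𝓝[>] 0)
        (𝓝 0) := by
      have h1 : Tendsto (fun τ : ℝ => ENNReal.ofReal (τ * (‖e‖ + ρ))) (𝓝[>] 0) (𝓝 0) := by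
        have : Continuous fun τ : ℝ => ENNReal.ofReal (τ * (‖e‖ + ρ)) :=
          ENNReal.continuous_ofReal.comp (by fun_prop)
        simpa using (this.tendsto 0).mono_left nhdsWithin_le_nhds
      have h2 := ENNReal.Tendsto.const_mul (a := 8)
        (ENNReal.Tendsto.mul_const (b := M) (ENNReal.Tendsto.pow (n := 2) h1) (.inr hMt))
        (.inr (by norm_num))
      simpa using h2
    have h1 := hlim.eventually (ge_mem_nhds (ENNReal.half_pos hε))
    have h2 : ∀ᶠ τ : ℝ in 𝓝[>] 0, τ ∈ Ioc 0 h₀ := Ioc_mem_nhdsGT hh₀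
    obtain ⟨τ, h3, h4⟩ := (h1.and h2).exists
    exact ⟨τ, h4.1, h4.2, h3⟩
  set B := Metric.ball (τ • e) (τ * ρ) with hB
  have hB0 : volume B ≠ 0 := (Metric.measure_ball_pos _ _ (by positivity)).ne'
  have hBt : volume B ≠ ⊤ := measure_ball_lt_top.ne
  set ν : Measure (EuclideanSpace ℝ (Fin d)) := (volume B)⁻¹ • volume.restrict B with hν
  have : IsProbabilityMeasure ν := ⟨by simp [hν, ENNReal.inv_mul_cancel hB0 hBt]⟩
  have hνB : ∀ᵐ y ∂ν, ‖y‖ₑ ≤ ENNReal.ofReal (τ * (‖e‖ + ρ)) ∧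
      ∀ x ∈ A, ∀ t ∈ Icc (0 : ℝ) 1, x + t • y ∈ Ω := by
    refine Measure.ae_smul_measure ?_ _
    filter_upwards [ae_restrict_mem Metric.isOpen_ball.measurableSet] with y hy
    rw [hB, Metric.mem_ball, dist_eq_norm] at hy
    constructor
    · rw [← ofReal_norm]
      refine ENNReal.ofReal_le_ofReal ?_
      have h1 := norm_add_le (y - τ • e) (τ • e)
      rw [sub_add_cancel, norm_smul, Real.norm_of_nonneg hτ0.le] at h1
      linarith
    · intro x hx t ht
      have h1 : τ⁻¹ • y ∈ Metric.ball e ρ := by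
        rw [Metric.mem_ball, dist_eq_norm]
        have : τ⁻¹ • y - e = τ⁻¹ • (y - τ • e) := by
          rw [smul_sub, inv_smul_smul₀ hτ0.ne']
        rw [this, norm_smul, Real.norm_of_nonneg (by positivity), inv_mul_lt_iff₀ hτ0]
        exact hy
      have h2 := hcone x hx _ h1 (t * τ) ⟨by have := ht.1; positivity, by
        have := mul_le_mul_of_nonneg_right ht.2 hτ0.le; linarith⟩
      rwa [smul_smul, mul_assoc, mul_inv_cancel₀ hτ0.ne', mul_one] at h2
  -- the averages of `u n` over the balls `x + B` inside the cones with vertex `x`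
  set T : ℕ → EuclideanSpace ℝ (Fin d) → ℝ := fun n x => ∫ y, Ω.indicator (u n) (x + y) ∂ν with hT
  have hTeq : ∀ n x, T n x = (volume B)⁻¹.toReal * ∫ z in (fun z => z - x) ⁻¹' B,
      Ω.indicator (u n) z := by
    intro n x
    simp only [hT, hν]
    rw [integral_smul_measure, smul_eq_mul]
    congr 1
    have hmp : MeasurePreserving (fun z : EuclideanSpace ℝ (Fin d) => z - x) volume volume :=
      measurePreserving_sub_right volume x
    rw [← hmp.setIntegral_preimage_emb (MeasurableEquiv.subRight x).measurableEmbedding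
      (fun y => Ω.indicator (u n) (x + y)) B]
    simp
  have hTlim : ∀ x, ∃ l, Tendsto (fun n => T n x) atTop (𝓝 l) := by
    intro x
    obtain ⟨l, hl⟩ := hw ((fun z => z - x) ⁻¹' B)
      ((measurable_sub_const x) Metric.isOpen_ball.measurableSet)
    exact ⟨_, (hl.const_mul (volume B)⁻¹.toReal).congr fun n => (hTeq n x).symm⟩
  choose L hL using hTlim
  have hTm : ∀ n, AEMeasurable (T n) (volume.restrict A) := fun n =>
    ((integrable_comp_add ν (hu n)).1.integral_prod_right').aemeasurable.restrict
  have hLm : AEMeasurable L (volume.restrict A) :=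
    aemeasurable_of_tendsto_metrizable_ae atTop hTm (.of_forall fun x => hL x)
  set K : ℝ := (volume B)⁻¹.toReal * C with hK
  have hTb : ∀ n x, ‖T n x‖ ≤ K := by
    intro n x
    rw [hTeq, norm_mul, Real.norm_of_nonneg ENNReal.toReal_nonneg]
    refine mul_le_mul_of_nonneg_left ?_ ENNReal.toReal_nonneg
    exact (norm_integral_le_integral_norm _).trans ((setIntegral_le_integral (hu n).norm
      (.of_forall fun _ => norm_nonneg _)).trans (hC n))
  have hLb : ∀ x, ‖L x‖ ≤ K := fun x =>
    le_of_tendsto (hL x).norm (.of_forall fun n => hTb n x)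
  have ht : Tendsto (fun n => ∫⁻ x in A, ‖T n x - L x‖ₑ ^ 2) atTop (𝓝 0) := by
    have h1 := tendsto_lintegral_of_dominated_convergence' (μ := volume.restrict A)
      (F := fun n x => ‖T n x - L x‖ₑ ^ 2) (f := fun _ => 0)
      (fun _ => ENNReal.ofReal ((2 * K) ^ 2))
      (fun n => ((hTm n).sub hLm).enorm.pow_const 2) (fun n => .of_forall fun x => ?_) ?_
      (.of_forall fun x => ?_)
    · simpa using h1
    · simp only
      rw [enorm_sq_eq_ofReal_sq]
      refine ENNReal.ofReal_le_ofReal ?_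
      rw [← sq_abs]
      have h2 := norm_sub_le (T n x) (L x)
      rw [Real.norm_eq_abs] at h2
      gcongr
      linarith [hTb n x, hLb x]
    · simpa using ENNReal.mul_ne_top ENNReal.ofReal_ne_top hAv
    · have := ENNReal.Tendsto.pow (n := 2) (((hL x).sub_const (L x)).enorm)
      simpa using this
  have h8 : ε / 2 / 8 ≠ 0 := (ENNReal.div_pos (ENNReal.half_pos hε).ne' (by norm_num)).ne'
  obtain ⟨N, hN⟩ := eventually_atTop.1 (ht.eventually (ge_mem_nhds (pos_iff_ne_zero.2 h8)))
  refine ⟨N, fun n hn m hm => ?_⟩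
  have hAu : ∀ n, AEMeasurable (u n) (volume.restrict A) := by
    intro n
    have hAΩ : A ⊆ Ω := fun x hx => by
      simpa using hcone x hx e (Metric.mem_ball_self hρ) 0 ⟨le_rfl, hh₀.le⟩
    exact (((aemeasurable_indicator_iff hΩ.measurableSet).1 (hu n).1.aemeasurable)).mono_measure
      (Measure.restrict_mono hAΩ le_rfl)
  have hav : ∀ n, ∫⁻ x in A, ‖u n x - T n x‖ₑ ^ 2 ≤ ENNReal.ofReal (τ * (‖e‖ + ρ)) ^ 2 * M :=
    fun n => ((h n).lintegral_sub_average_sq_le hΩ hA (hu n) (hg n) hνB).trans (by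
      gcongr; exact hM n)
  calc ∫⁻ x in A, ‖u n x - u m x‖ₑ ^ 2
      ≤ ∫⁻ x in A, 4 * ((‖u n x - T n x‖ₑ ^ 2 + ‖u m x - T m x‖ₑ ^ 2) +
          (‖T n x - L x‖ₑ ^ 2 + ‖T m x - L x‖ₑ ^ 2)) := by
        refine lintegral_mono fun x => ?_
        simp only [enorm_sq_eq_ofReal_sq]
        rw [← ENNReal.ofReal_add (by positivity) (by positivity),
          ← ENNReal.ofReal_add (by positivity) (by positivity),
          ← ENNReal.ofReal_add (by positivity) (by positivity),
          show (4 : ENNReal) = ENNReal.ofReal 4 by norm_num, ← ENNReal.ofReal_mul (by norm_num)]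
        refine ENNReal.ofReal_le_ofReal ?_
        set a := u n x - T n x
        set b := u m x - T m x
        set c := T n x - L x
        set e := T m x - L x
        rw [show u n x - u m x = a - b + c - e by simp only [a, b, c, e]; ring]
        nlinarith [sq_nonneg (a + b), sq_nonneg (a - c), sq_nonneg (a + e), sq_nonneg (b + c),
          sq_nonneg (b - e), sq_nonneg (c + e)]
    _ = 4 * ((∫⁻ x in A, ‖u n x - T n x‖ₑ ^ 2) + (∫⁻ x in A, ‖u m x - T m x‖ₑ ^ 2) +
          ((∫⁻ x in A, ‖T n x - L x‖ₑ ^ 2) + ∫⁻ x in A, ‖T m x - L x‖ₑ ^ 2)) := by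
        have m1 : ∀ n, AEMeasurable (fun x => ‖u n x - T n x‖ₑ ^ 2) (volume.restrict A) :=
          fun n => ((hAu n).sub (hTm n)).enorm.pow_const 2
        have m2 : ∀ n, AEMeasurable (fun x => ‖T n x - L x‖ₑ ^ 2) (volume.restrict A) :=
          fun n => ((hTm n).sub hLm).enorm.pow_const 2
        rw [lintegral_const_mul' _ _ (by norm_num), lintegral_add_left'
            (f := fun x => ‖u n x - T n x‖ₑ ^ 2 + ‖u m x - T m x‖ₑ ^ 2) ((m1 n).add (m1 m)),
          lintegral_add_left' (m1 n), lintegral_add_left' (m2 n)]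
    _ ≤ 4 * ((ENNReal.ofReal (τ * (‖e‖ + ρ)) ^ 2 * M + ENNReal.ofReal (τ * (‖e‖ + ρ)) ^ 2 * M) +
          (ε / 2 / 8 + ε / 2 / 8)) := by
        gcongr
        · exact hav n
        · exact hav m
        · exact hN n hn
        · exact hN m hm
    _ = 8 * (ENNReal.ofReal (τ * (‖e‖ + ρ)) ^ 2 * M) + ε / 2 := by
        have : (4 : ENNReal) * (ε / 2 / 8 + ε / 2 / 8) = ε / 2 := by
          rw [← two_mul, ← mul_assoc, show (4 : ENNReal) * 2 = 8 by norm_num,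
            ENNReal.mul_div_cancel (by norm_num) (by norm_num)]
        rw [mul_add, this, ← two_mul, ← mul_assoc]
        norm_num
    _ ≤ ε / 2 + ε / 2 := by gcongr
    _ = ε := ENNReal.add_halves ε

end

/-! ### Rellich's compactness theorem -/

section

variable {d : ℕ} {Ω : Set (EuclideanSpace ℝ (Fin d))}

theorem enorm_sq_eq_lintegral_enorm_sq {α F : Type*} [MeasurableSpace α] {μ : Measure α}
    [NormedAddCommGroup F] (f : Lp F 2 μ) : ‖f‖ₑ ^ 2 = ∫⁻ x, ‖f x‖ₑ ^ 2 ∂μ := by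
  rw [Lp.enorm_def, eLpNorm_eq_lintegral_rpow_enorm_toReal (by norm_num) (by norm_num),
    ← ENNReal.rpow_mul_natCast]
  norm_num

theorem IsBoundedLipschitzDomain.volume_ne_top (hΩ : IsBoundedLipschitzDomain Ω) :
    volume Ω ≠ ⊤ := hΩ.isBounded.measure_lt_top.ne

/-- The **Rellich compactness theorem** on a bounded Lipschitz domain: a sequence bounded in
`H¹(Ω)` has a subsequence that is Cauchy in `L²(Ω)`. -/
theorem IsBoundedLipschitzDomain.exists_subseq_cauchySeq (hΩ : IsBoundedLipschitzDomain Ω)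
    {U : ℕ → Lp ℝ 2 (volume.restrict Ω)}
    {Γ : ℕ → Lp (EuclideanSpace ℝ (Fin d)) 2 (volume.restrict Ω)}
    (h : ∀ n, HasWeakGradient Ω (U n) (Γ n)) {C : ℝ} (hU : ∀ n, ‖U n‖ ≤ C)
    (hΓ : ∀ n, ‖Γ n‖ ≤ C) : ∃ φ : ℕ → ℕ, StrictMono φ ∧ CauchySeq (U ∘ φ) := by
  have : Fact ((2 : ENNReal) ≠ ⊤) := ⟨by norm_num⟩
  have : IsFiniteMeasure (volume.restrict Ω) :=
    ⟨by simpa using hΩ.volume_ne_top.lt_top⟩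
  have hΩm := hΩ.isOpen.measurableSet
  -- a weakly convergent subsequence
  obtain ⟨a, -, φ, hφ, ha⟩ := WeakDual.isSeqCompact_closedBall ℝ (Lp ℝ 2 (volume.restrict Ω)) 0 C
    (x := fun n => StrongDual.toWeakDual (innerSL ℝ (U n))) (fun n => by simpa using hU n)
  have hw0 : ∀ F : Lp ℝ 2 (volume.restrict Ω),
      Tendsto (fun n => inner ℝ (U (φ n)) F) atTop (𝓝 (a F)) := by
    intro F
    exact ((WeakDual.eval_continuous F).tendsto a).comp ha
  have hint : ∀ n, Integrable (Ω.indicator (U n)) := fun n =>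
    (integrable_indicator_iff hΩm).2 ((Lp.memLp (U n)).integrable (by norm_num))
  have hintg : ∀ n, Integrable (Ω.indicator (Γ n)) := fun n =>
    (integrable_indicator_iff hΩm).2 ((Lp.memLp (Γ n)).integrable (by norm_num))
  have hw : ∀ S, MeasurableSet S →
      ∃ l, Tendsto (fun n => ∫ x in S, Ω.indicator (U (φ n)) x) atTop (𝓝 l) := by
    intro S hS
    refine ⟨_, (hw0 (indicatorConstLp 2 hS (measure_ne_top _ _) 1)).congr fun n => ?_⟩
    rw [real_inner_comm, L2.inner_indicatorConstLp_one, setIntegral_indicator hΩm,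
      Measure.restrict_restrict hS]
  have hMg : ∀ n, ∫⁻ x in Ω, ‖Γ n x‖ₑ ^ 2 ≤ ENNReal.ofReal C ^ 2 := fun n => by
    rw [← enorm_sq_eq_lintegral_enorm_sq, ← ofReal_norm]
    gcongr
    exact hΓ n
  obtain ⟨C', hC'⟩ : ∃ C' : ℝ, ∀ n, ∫ x, ‖Ω.indicator (U n) x‖ ≤ C' := by
    have hsq : ∀ n, (∫⁻ x in Ω, ‖U n x‖ₑ) ^ 2 ≤ volume Ω * ENNReal.ofReal C ^ 2 := fun n => by
      refine (sq_lintegral_le_measure_mul_lintegral_sq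
        (Lp.aestronglyMeasurable (U n)).enorm).trans ?_
      rw [Measure.restrict_apply_univ, ← enorm_sq_eq_lintegral_enorm_sq, ← ofReal_norm]
      gcongr
      exact hU n
    refine ⟨Real.sqrt (volume Ω * ENNReal.ofReal C ^ 2).toReal, fun n => ?_⟩
    have e1 : ∫ x, ‖Ω.indicator (U n) x‖ = (∫⁻ x in Ω, ‖U n x‖ₑ).toReal := by
      rw [integral_norm_eq_lintegral_enorm (hint n).1, ← lintegral_indicator hΩm]
      congr 2
      ext x
      by_cases hx : x ∈ Ω <;> simp [hx]
    rw [e1]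
    refine Real.le_sqrt_of_sq_le ?_
    rw [← ENNReal.toReal_pow]
    exact ENNReal.toReal_mono (ENNReal.mul_ne_top hΩ.volume_ne_top (by simp)) (hsq n)
  -- a finite cover of the closure by balls with the cone property
  have hcone := fun p (hp : p ∈ closure Ω) => hΩ.exists_cone hp
  choose! r hr e ρ hρ h₀ hh₀ hc using hcone
  obtain ⟨t, htc, htΩ⟩ := (hΩ.isBounded.isCompact_closure).elim_nhds_subcover
    (fun p => Metric.ball p (r p)) (fun p hp => Metric.ball_mem_nhds p (hr p hp))
  have hΩt : Ω ⊆ ⋃ p : t, Ω ∩ Metric.ball (p : EuclideanSpace ℝ (Fin d)) (r p) := by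
    intro x hx
    obtain ⟨p, hp, hxp⟩ := mem_iUnion₂.1 (htΩ (subset_closure hx))
    exact mem_iUnion.2 ⟨⟨p, hp⟩, hx, hxp⟩
  refine ⟨φ, hφ, EMetric.cauchySeq_iff.2 fun ε hε => ?_⟩
  set ε' : ENNReal := (min ε 1 / 2) ^ 2 / (t.card + 1) with hε'
  have hε0 : min ε 1 ≠ 0 := by simp [hε.ne']
  have hmt : min ε 1 ≠ ⊤ := by simp
  have hε'0 : ε' ≠ 0 := by
    refine (ENNReal.div_pos (pow_ne_zero _ (ENNReal.half_pos hε0).ne') (by finiteness)).ne'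
  have hloc : ∀ p : t, ∃ N, ∀ n ≥ N, ∀ m ≥ N,
      ∫⁻ x in Ω ∩ Metric.ball (p : EuclideanSpace ℝ (Fin d)) (r p),
        ‖U (φ n) x - U (φ m) x‖ₑ ^ 2 ≤ ε' := fun p =>
    lintegral_sub_sq_small_of_cone hΩ.isOpen (fun n => h (φ n)) (fun n => hint (φ n))
      (fun n => hintg (φ n)) (fun n => hC' (φ n)) (by simp) (fun n => hMg (φ n)) hw
      (hΩ.isOpen.inter Metric.isOpen_ball)
      ((measure_mono inter_subset_left).trans_lt hΩ.volume_ne_top.lt_top).ne (hρ p (htc p p.2))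
      (hh₀ p (htc p p.2)) (hc p (htc p p.2)) hε'0
  choose N hN using hloc
  refine ⟨Finset.univ.sup N, fun n hn m hm => ?_⟩
  have hsq : edist (U (φ n)) (U (φ m)) ^ 2 ≤ (min ε 1 / 2) ^ 2 := by
    rw [edist_eq_enorm_sub, enorm_sq_eq_lintegral_enorm_sq]
    calc ∫⁻ x in Ω, ‖(U (φ n) - U (φ m)) x‖ₑ ^ 2
        = ∫⁻ x in Ω, ‖U (φ n) x - U (φ m) x‖ₑ ^ 2 := by
          refine lintegral_congr_ae ?_
          filter_upwards [Lp.coeFn_sub (U (φ n)) (U (φ m))] with x hx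
          rw [hx]; rfl
      _ ≤ ∫⁻ x in ⋃ p : t, Ω ∩ Metric.ball (p : EuclideanSpace ℝ (Fin d)) (r p),
            ‖U (φ n) x - U (φ m) x‖ₑ ^ 2 := lintegral_mono_set hΩt
      _ ≤ ∑' p : t, ∫⁻ x in Ω ∩ Metric.ball (p : EuclideanSpace ℝ (Fin d)) (r p),
            ‖U (φ n) x - U (φ m) x‖ₑ ^ 2 := lintegral_iUnion_le _ _
      _ ≤ ∑' _ : t, ε' := by
          refine ENNReal.tsum_le_tsum fun p => hN p n ?_ m ?_
          · exact (Finset.le_sup (Finset.mem_univ p)).trans hn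
          · exact (Finset.le_sup (Finset.mem_univ p)).trans hm
      _ = t.card * ε' := by simp [tsum_fintype]
      _ ≤ (t.card + 1) * ε' := by gcongr; exact le_self_add
      _ = (min ε 1 / 2) ^ 2 := ENNReal.mul_div_cancel (by simp) (by finiteness)
  have hle : edist (U (φ n)) (U (φ m)) ≤ min ε 1 / 2 :=
    (ENNReal.pow_le_pow_left_iff two_ne_zero).1 hsq
  exact hle.trans_lt ((ENNReal.half_lt_self hε0 hmt).trans_le (min_le_left _ _))

end

/-! ### Minimization of an abstract Rayleigh quotient -/

/-- Minimization of the Rayleigh quotient `‖x.2‖² / ‖x.1‖²` on a closed subspace of a product of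
Hilbert spaces, under compactness of the first projection: the minimum is attained, and a minimizer
solves the eigenvalue equation. -/
theorem exists_isMinOn_rayleigh {H K : Type*} [NormedAddCommGroup H] [InnerProductSpace ℝ H]
    [CompleteSpace H] [NormedAddCommGroup K] [InnerProductSpace ℝ K] [CompleteSpace K]
    (X : Submodule ℝ (H × K)) (hX : IsClosed (X : Set (H × K)))
    (hcomp : ∀ U : ℕ → H × K, (∀ n, U n ∈ X) → ∀ C : ℝ, (∀ n, ‖(U n).1‖ ≤ C) →
      (∀ n, ‖(U n).2‖ ≤ C) → ∃ φ : ℕ → ℕ, StrictMono φ ∧ CauchySeq fun n => (U (φ n)).1)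
    (hne : ∃ x ∈ X, x.1 ≠ 0) :
    ∃ x ∈ X, ‖x.1‖ = 1 ∧ (∀ y ∈ X, ‖x.2‖ ^ 2 * ‖y.1‖ ^ 2 ≤ ‖y.2‖ ^ 2) ∧
      ∀ y ∈ X, inner ℝ x.2 y.2 = ‖x.2‖ ^ 2 * inner ℝ x.1 y.1 := by
  set S : Set ℝ := (fun x : H × K => ‖x.2‖ ^ 2) '' {x | x ∈ X ∧ ‖x.1‖ = 1} with hS
  have hnorm : ∀ y ∈ X, y.1 ≠ 0 → ‖y.2‖ ^ 2 / ‖y.1‖ ^ 2 ∈ S := by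
    intro y hy hy0
    refine ⟨‖y.1‖⁻¹ • y, ⟨X.smul_mem _ hy, ?_⟩, ?_⟩
    · simp [norm_smul, hy0]
    · simp [norm_smul, mul_pow, div_eq_inv_mul]
  have hSne : S.Nonempty := by
    obtain ⟨x, hx, hx0⟩ := hne
    exact ⟨_, hnorm x hx hx0⟩
  have hSb : BddBelow S := ⟨0, by rintro _ ⟨x, -, rfl⟩; positivity⟩
  set l := sInf S with hl
  have hl0 : 0 ≤ l := le_csInf hSne (by rintro _ ⟨x, -, rfl⟩; positivity)
  have hmin : ∀ y ∈ X, l * ‖y.1‖ ^ 2 ≤ ‖y.2‖ ^ 2 := by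
    intro y hy
    by_cases hy0 : y.1 = 0
    · simp only [hy0, norm_zero, ne_eq, OfNat.ofNat_ne_zero, not_false_eq_true, zero_pow, mul_zero]
      positivity
    · have := csInf_le hSb (hnorm y hy hy0)
      rwa [le_div_iff₀ (by positivity)] at this
  obtain ⟨s, -, hs, hsS⟩ := exists_seq_tendsto_sInf hSne hSb
  choose U hU hUs using hsS
  simp only at hUs
  obtain ⟨B, hB⟩ : ∃ B, ∀ n, s n ≤ B := by
    obtain ⟨B, hB⟩ := hs.bddAbove_range
    exact ⟨B, fun n => hB ⟨n, rfl⟩⟩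
  have hB0 : 0 ≤ B := (by rw [← hUs]; positivity : 0 ≤ s 0).trans (hB 0)
  obtain ⟨φ, hφ, hc1⟩ := hcomp U (fun n => (hU n).1) (1 + B)
    (fun n => by rw [(hU n).2]; linarith) (fun n => by
      have := hB n; rw [← hUs] at this; nlinarith [norm_nonneg (U n).2])
  -- the parallelogram identity turns minimality into the Cauchy property of the second components
  have hpar : ∀ n m, ‖(U n).2 - (U m).2‖ ^ 2 ≤
      2 * (s n - l) + 2 * (s m - l) + l * ‖(U n).1 - (U m).1‖ ^ 2 := by
    intro n m
    have h1 := parallelogram_law_with_norm ℝ (U n).2 (U m).2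
    have h2 := parallelogram_law_with_norm ℝ (U n).1 (U m).1
    have h3 := hmin _ (X.add_mem (hU n).1 (hU m).1)
    rw [(hU n).2, (hU m).2] at h2
    simp only [Prod.fst_add, Prod.snd_add] at h3
    have h4 := hUs n
    have h5 := hUs m
    have h6 : ‖(U n).1 + (U m).1‖ ^ 2 = 4 - ‖(U n).1 - (U m).1‖ ^ 2 := by nlinarith
    rw [h6] at h3
    nlinarith
  have hc2 : CauchySeq fun n => (U (φ n)).2 := by
    rw [Metric.cauchySeq_iff] at hc1 ⊢
    intro ε hε
    obtain ⟨N₁, hN₁⟩ := hc1 (ε / (2 * (l + 1))) (by positivity)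
    have hsl := (hs.comp hφ.tendsto_atTop).eventually (gt_mem_nhds
      (show l < l + ε ^ 2 / 8 by have : 0 < ε ^ 2 := by positivity
                                 linarith))
    obtain ⟨N₂, hN₂⟩ := eventually_atTop.1 hsl
    refine ⟨max N₁ N₂, fun n hn m hm => ?_⟩
    have h1 := hN₁ n (le_of_max_le_left hn) m (le_of_max_le_left hm)
    have h2 := hN₂ n (le_of_max_le_right hn)
    have h3 := hN₂ m (le_of_max_le_right hm)
    have h4 := hpar (φ n) (φ m)
    rw [dist_eq_norm] at h1 ⊢
    simp only [Function.comp_apply] at h2 h3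
    refine lt_of_pow_lt_pow_left₀ 2 hε.le ?_
    have h5 : l * ‖(U (φ n)).1 - (U (φ m)).1‖ ^ 2 ≤ ε ^ 2 / 4 := by
      calc _ ≤ l * (ε / (2 * (l + 1))) ^ 2 := by gcongr
        _ = ε ^ 2 / 4 * (l / (l + 1) ^ 2) := by field_simp; ring
        _ ≤ ε ^ 2 / 4 * 1 := by
          gcongr
          rw [div_le_one (by positivity)]
          nlinarith
        _ = _ := mul_one _
    linarith [sq_nonneg ε]
  obtain ⟨x₁, hx₁⟩ := cauchySeq_tendsto_of_complete hc1
  obtain ⟨x₂, hx₂⟩ := cauchySeq_tendsto_of_complete hc2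
  have hxX : (x₁, x₂) ∈ X := hX.mem_of_tendsto (hx₁.prodMk_nhds hx₂)
    (.of_forall fun n => (hU (φ n)).1)
  have hn1 : ‖x₁‖ = 1 := tendsto_nhds_unique hx₁.norm
    (tendsto_const_nhds.congr fun n => ((hU (φ n)).2).symm)
  have hn2 : ‖x₂‖ ^ 2 = l := tendsto_nhds_unique (hx₂.norm.pow 2)
    ((hs.comp hφ.tendsto_atTop).congr fun n => (hUs (φ n)).symm)
  refine ⟨(x₁, x₂), hxX, hn1, fun y hy => by simpa only [hn2] using hmin y hy, fun y hy => ?_⟩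
  simp only [hn2]
  -- the first variation of the Rayleigh quotient in the direction `y`
  have hq : ∀ t : ℝ, 0 ≤ 2 * t * (inner ℝ x₂ y.2 - l * inner ℝ x₁ y.1)
      + t ^ 2 * (‖y.2‖ ^ 2 - l * ‖y.1‖ ^ 2) := by
    intro t
    have h1 := hmin _ (X.add_mem hxX (X.smul_mem t hy))
    simp only [Prod.fst_add, Prod.snd_add, Prod.smul_fst, Prod.smul_snd] at h1
    rw [norm_add_sq_real, norm_add_sq_real, inner_smul_right, inner_smul_right, norm_smul,
      norm_smul, hn1, hn2, mul_pow, mul_pow, Real.norm_eq_abs, sq_abs] at h1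
    nlinarith
  have hc := hmin y hy
  set b := inner ℝ x₂ y.2 - l * inner ℝ x₁ y.1
  set c := ‖y.2‖ ^ 2 - l * ‖y.1‖ ^ 2
  have hc0 : 0 ≤ c := by simp only [c]; linarith
  -- `c + 1` in place of `c`, which may vanish
  have h1 := hq (-b / (c + 1))
  have h2 : 2 * (-b / (c + 1)) * b + (-b / (c + 1)) ^ 2 * c
      = - (b ^ 2 * (c + 2) / (c + 1) ^ 2) := by
    field_simp; ring
  rw [h2] at h1
  have h3 : b ^ 2 * (c + 2) / (c + 1) ^ 2 ≤ 0 := by linarith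
  have h4 : b = 0 := by
    by_contra hb
    have : 0 < b ^ 2 * (c + 2) / (c + 1) ^ 2 := by positivity
    linarith
  simp only [b] at h4
  linarith

/-! ### Mean-zero Sobolev functions -/

section

variable {d : ℕ} {Ω : Set (EuclideanSpace ℝ (Fin d))}
  {u u' : EuclideanSpace ℝ (Fin d) → ℝ}
  {g g' : EuclideanSpace ℝ (Fin d) → EuclideanSpace ℝ (Fin d)}

theorem MemSobolevH1.add (hΩ : IsOpen Ω) (h : MemSobolevH1 Ω u g) (h' : MemSobolevH1 Ω u' g') :
    MemSobolevH1 Ω (u + u') (g + g') :=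
  ⟨h.1.add h'.1, h.2.add h'.2, h.3.add h'.3 hΩ⟩

theorem MemSobolevH1.const_smul (h : MemSobolevH1 Ω u g) (c : ℝ) :
    MemSobolevH1 Ω (c • u) (c • g) :=
  ⟨h.1.const_smul c, h.2.const_smul c, h.3.const_smul c⟩

theorem memSobolevH1_const (hΩ : volume Ω ≠ ⊤) (c : ℝ) :
    MemSobolevH1 Ω (fun _ => c) (fun _ => 0) := by
  have : IsFiniteMeasure (volume.restrict Ω) := ⟨by simpa using hΩ.lt_top⟩
  refine ⟨memLp_const _, memLp_const _, ?_⟩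
  have := hasWeakGradient_of_contDiff (Ω := Ω) (u := fun _ => c) contDiff_const
  simpa [gradient] using this

/-- The closed subspace of `L²(Ω) × L²(Ω; ℝᵈ)` formed by the pairs of an `H¹` function of vanishing
mean and its weak gradient. -/
def meanZeroSobolev (hΩ : IsOpen Ω) (hv : volume Ω ≠ ⊤) : Submodule ℝ (Lp ℝ 2 (volume.restrict Ω) ×
    Lp (EuclideanSpace ℝ (Fin d)) 2 (volume.restrict Ω)) where
  carrier := {x | HasWeakGradient Ω x.1 x.2 ∧ ∫ y in Ω, x.1 y = 0}
  add_mem' := by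
    rintro x y ⟨hx, hx0⟩ ⟨hy, hy0⟩
    have e1 := Lp.coeFn_add x.1 y.1
    refine ⟨(hx.add hy hΩ).congr e1.symm (Lp.coeFn_add x.2 y.2).symm, ?_⟩
    have : IsFiniteMeasure (volume.restrict Ω) := ⟨by simpa using hv.lt_top⟩
    have hi : ∀ z : Lp ℝ 2 (volume.restrict Ω), Integrable z (volume.restrict Ω) := fun z =>
      (Lp.memLp z).integrable (by norm_num)
    rw [Prod.fst_add, integral_congr_ae e1]
    simp only [Pi.add_apply]
    rw [integral_add (hi x.1) (hi y.1), hx0, hy0, add_zero]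
  zero_mem' := by
    refine ⟨?_, ?_⟩
    · have := hasWeakGradient_of_contDiff (Ω := Ω) (u := fun _ => 0) contDiff_const
      refine this.congr (Lp.coeFn_zero ℝ 2 _).symm ?_
      filter_upwards [Lp.coeFn_zero (EuclideanSpace ℝ (Fin d)) 2 (volume.restrict Ω)] with x hx
      rw [show (0 : Lp ℝ 2 (volume.restrict Ω) × Lp (EuclideanSpace ℝ (Fin d)) 2
        (volume.restrict Ω)).2 = 0 from rfl, hx]
      simp [gradient]
    · rw [Prod.fst_zero, integral_congr_ae (Lp.coeFn_zero ℝ 2 _)]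
      simp
  smul_mem' := by
    rintro c x ⟨hx, hx0⟩
    have e1 := Lp.coeFn_smul c x.1
    refine ⟨(hx.const_smul c).congr e1.symm (Lp.coeFn_smul c x.2).symm, ?_⟩
    rw [Prod.smul_fst, integral_congr_ae e1]
    simp only [Pi.smul_apply, smul_eq_mul, integral_const_mul, hx0, mul_zero]

theorem mem_meanZeroSobolev {hΩ : IsOpen Ω} {hv : volume Ω ≠ ⊤} {x} :
    x ∈ meanZeroSobolev hΩ hv ↔ HasWeakGradient Ω x.1 x.2 ∧ ∫ y in Ω, x.1 y = 0 := Iff.rfl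

theorem isClosed_meanZeroSobolev (hΩ : IsOpen Ω) (hv : volume Ω ≠ ⊤) :
    IsClosed (meanZeroSobolev hΩ hv : Set (Lp ℝ 2 (volume.restrict Ω) ×
      Lp (EuclideanSpace ℝ (Fin d)) 2 (volume.restrict Ω))) := by
  have : IsFiniteMeasure (volume.restrict Ω) := ⟨by simpa using hv.lt_top⟩
  have hcont : ∀ (ψ : EuclideanSpace ℝ (Fin d) → ℝ), MemLp ψ 2 (volume.restrict Ω) →
      Continuous fun U : Lp ℝ 2 (volume.restrict Ω) => ∫ x in Ω, U x * ψ x := by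
    intro ψ hψ
    have : (fun U : Lp ℝ 2 (volume.restrict Ω) => ∫ x in Ω, U x * ψ x)
        = fun U => inner ℝ hψ.toLp U := by
      ext U
      rw [L2.inner_def]
      refine integral_congr_ae ?_
      filter_upwards [hψ.coeFn_toLp] with x hx
      rw [hx]; rfl
    rw [this]
    fun_prop
  have hcont2 : ∀ (ψ : EuclideanSpace ℝ (Fin d) → ℝ) (e : EuclideanSpace ℝ (Fin d)),
      MemLp ψ 2 (volume.restrict Ω) →
      Continuous fun U : Lp (EuclideanSpace ℝ (Fin d)) 2 (volume.restrict Ω) =>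
        ∫ x in Ω, inner ℝ (U x) e * ψ x := by
    intro ψ e hψ
    have hψe : MemLp (fun x => ψ x • e) 2 (volume.restrict Ω) :=
      (ContinuousLinearMap.toSpanSingleton ℝ e).comp_memLp' hψ
    have : (fun U : Lp (EuclideanSpace ℝ (Fin d)) 2 (volume.restrict Ω) =>
        ∫ x in Ω, inner ℝ (U x) e * ψ x) = fun U => inner ℝ U hψe.toLp := by
      ext U
      rw [L2.inner_def]
      refine integral_congr_ae ?_
      filter_upwards [hψe.coeFn_toLp] with x hx
      rw [hx, inner_smul_right, mul_comm]
    rw [this]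
    fun_prop
  have htest : ∀ ψ : EuclideanSpace ℝ (Fin d) → ℝ, Continuous ψ → HasCompactSupport ψ →
      MemLp ψ 2 (volume.restrict Ω) := fun ψ h1 h2 => (h1.memLp_of_hasCompactSupport h2).restrict Ω
  have hset : (meanZeroSobolev hΩ hv : Set (Lp ℝ 2 (volume.restrict Ω) ×
      Lp (EuclideanSpace ℝ (Fin d)) 2 (volume.restrict Ω))) =
      {x | ∫ y in Ω, x.1 y * 1 = 0} ∩ ⋂ (φ : EuclideanSpace ℝ (Fin d) → ℝ) (_ : ContDiff ℝ ∞ φ)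
        (_ : HasCompactSupport φ) (_ : tsupport φ ⊆ Ω) (e : EuclideanSpace ℝ (Fin d)),
        {x | ∫ y in Ω, x.1 y * fderiv ℝ φ y e = - ∫ y in Ω, inner ℝ (x.2 y) e * φ y} := by
    ext x
    simp only [SetLike.mem_coe, mem_meanZeroSobolev, mem_inter_iff, mem_ofPred_eq, mul_one,
      mem_iInter]
    refine ⟨fun h => ⟨h.2, h.1.3⟩, fun h => ⟨⟨?_, ?_, h.2⟩, h.1⟩⟩
    · exact locallyIntegrableOn_of_memLp hΩ (by norm_num) (Lp.memLp x.1)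
    · exact locallyIntegrableOn_of_memLp hΩ (by norm_num) (Lp.memLp x.2)
  rw [hset]
  refine IsClosed.inter (isClosed_eq ((hcont (fun _ => 1) (memLp_const _)).comp continuous_fst)
    continuous_const) ?_
  refine isClosed_iInter fun φ => isClosed_iInter fun h1 => isClosed_iInter fun h2 =>
    isClosed_iInter fun _ => isClosed_iInter fun e => isClosed_eq ?_ ?_
  · exact (hcont _ (htest (fun x => fderiv ℝ φ x e) (continuous_fderiv_apply_of_contDiff h1 e)
      (hasCompactSupport_fderiv_apply h2 e))).comp continuous_fst
  · exact ((hcont2 _ e (htest φ h1.continuous h2)).comp continuous_snd).neg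

/-- On a connected open set, a function with vanishing weak gradient is constant: by the translation
estimate it is invariant under small translations, hence locally constant. -/
theorem HasWeakGradient.ae_eq_const_of_zero (hΩ : IsOpen Ω) (hc : IsConnected Ω)
    (h : HasWeakGradient Ω u 0) (hu : Integrable (Ω.indicator u)) :
    ∃ c, ∀ᵐ x, x ∈ Ω → u x = c := by
  have hloc : ∀ p ∈ Ω, ∃ r > 0, ∃ c, ∀ᵐ x, x ∈ Metric.ball p r → u x = c := by
    intro p hp
    obtain ⟨R, hR, hRΩ⟩ := Metric.isOpen_iff.1 hΩ p hp
    set A := Metric.ball p (R / 2)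
    set B := Metric.ball (0 : EuclideanSpace ℝ (Fin d)) (R / 2)
    have hAB : ∀ y ∈ B, ∀ x ∈ A, ∀ t ∈ Icc (0 : ℝ) 1, x + t • y ∈ Ω := by
      intro y hy x hx t ht
      apply hRΩ
      rw [mem_ball_zero_iff] at hy
      rw [Metric.mem_ball, dist_eq_norm] at hx ⊢
      calc ‖x + t • y - p‖ = ‖(x - p) + t • y‖ := by congr 1; abel
        _ ≤ ‖x - p‖ + t * ‖y‖ := (norm_add_le _ _).trans (by
            rw [norm_smul, Real.norm_of_nonneg ht.1])
        _ < R := by nlinarith [norm_nonneg y, ht.1, ht.2]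
    have hm : AEStronglyMeasurable (fun q : EuclideanSpace ℝ (Fin d) × EuclideanSpace ℝ (Fin d) =>
        Ω.indicator u (q.1 + q.2) - Ω.indicator u q.1) (volume.prod (volume.restrict B)) :=
      (aestronglyMeasurable_comp_add _ hu.1).sub hu.1.comp_fst
    have hE : AEMeasurable (fun q : EuclideanSpace ℝ (Fin d) × EuclideanSpace ℝ (Fin d) =>
        ‖Ω.indicator u (q.1 + q.2) - Ω.indicator u q.1‖ₑ ^ 2)
        ((volume.restrict A).prod (volume.restrict B)) := by
      refine (hm.enorm.pow_const 2).mono_ac (Measure.AbsolutelyContinuous.prod ?_ .rfl)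
      exact Measure.absolutelyContinuous_of_le Measure.restrict_le_self
    have hzero : ∫⁻ x in A, ∫⁻ y in B, ‖Ω.indicator u (x + y) - Ω.indicator u x‖ₑ ^ 2 = 0 := by
      rw [lintegral_lintegral_swap hE]
      refine (lintegral_eq_zero_of_ae_eq_zero ?_)
      filter_upwards [ae_restrict_mem Metric.isOpen_ball.measurableSet] with y hy
      have h1 := h.lintegral_translate_sub_sq_le hΩ Metric.isOpen_ball (hAB y hy) hu (by simp)
      simp only [Pi.zero_apply, enorm_zero, ne_eq, OfNat.ofNat_ne_zero, not_false_eq_true,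
        zero_pow, lintegral_zero, mul_zero, nonpos_iff_eq_zero] at h1
      rw [Pi.zero_apply, ← h1]
      refine setLIntegral_congr_fun Metric.isOpen_ball.measurableSet fun x hx => ?_
      have h0 := hAB y hy x hx 0 (by simp)
      have h1 := hAB y hy x hx 1 (by simp)
      simp only [zero_smul, one_smul, add_zero] at h0 h1
      simp only [indicator_of_mem h0, indicator_of_mem h1]
    rw [lintegral_eq_zero_iff' hE.lintegral_prod_right'] at hzero
    -- a good centre, close to `p`
    obtain ⟨x, hx, hxy⟩ : ∃ x ∈ Metric.ball p (R / 4), ∀ᵐ y ∂(volume.restrict B),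
        Ω.indicator u (x + y) = Ω.indicator u x := by
      have hzero' := (ae_restrict_iff' Metric.isOpen_ball.measurableSet).1 hzero
      have hae : ∀ᵐ x, x ∈ A → ∀ᵐ y ∂(volume.restrict B),
          Ω.indicator u (x + y) = Ω.indicator u x := by
        filter_upwards [hzero', hm.prodMk_left] with x hx hmx hxA
        have h1 := hx hxA
        rw [Pi.zero_apply, lintegral_eq_zero_iff' (hmx.enorm.pow_const 2)] at h1
        filter_upwards [h1] with y hy
        simpa [sub_eq_zero] using hy
      obtain ⟨x, hx1, hx2⟩ := (Measure.dense_of_ae hae).inter_open_nonempty (Metric.ball p (R / 4))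
        Metric.isOpen_ball ⟨p, Metric.mem_ball_self (by positivity)⟩
      exact ⟨x, hx1, hx2 (Metric.ball_subset_ball (by linarith) hx1)⟩
    refine ⟨R / 4, by positivity, Ω.indicator u x, ?_⟩
    have hxy' := (ae_restrict_iff' Metric.isOpen_ball.measurableSet).1 hxy
    filter_upwards [(measurePreserving_sub_right volume x).quasiMeasurePreserving.ae hxy']
      with z hz hzp
    rw [Metric.mem_ball, dist_eq_norm] at hx hzp
    have h1 : z - x ∈ B := by
      rw [mem_ball_zero_iff]
      calc ‖z - x‖ = ‖(z - p) - (x - p)‖ := by congr 1; abel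
        _ ≤ ‖z - p‖ + ‖x - p‖ := norm_sub_le _ _
        _ < R / 2 := by linarith
    have h2 := hz h1
    rw [add_sub_cancel] at h2
    rw [← h2, indicator_of_mem]
    apply hRΩ
    rw [Metric.mem_ball, dist_eq_norm]
    linarith
  choose! r hr c hrc using hloc
  obtain ⟨p₀, hp₀⟩ := hc.nonempty
  have hcc : ∀ p ∈ Ω, c p = c p₀ := by
    have : PreconnectedSpace Ω := isPreconnected_iff_preconnectedSpace.1 hc.isPreconnected
    have hlc : IsLocallyConstant fun p : Ω => c p := by
      rw [IsLocallyConstant.iff_eventually_eq]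
      intro p
      have : ∀ᶠ q : Ω in 𝓝 p, (q : EuclideanSpace ℝ (Fin d)) ∈
          Metric.ball (p : EuclideanSpace ℝ (Fin d)) (r p) :=
        continuous_subtype_val.continuousAt.eventually (Metric.ball_mem_nhds _ (hr p p.2))
      filter_upwards [this] with q hq
      obtain ⟨x, hx1, hx2⟩ := (Measure.dense_of_ae
        ((hrc p p.2).and (hrc q q.2))).inter_open_nonempty
        (Metric.ball (p : EuclideanSpace ℝ (Fin d)) (r p) ∩
          Metric.ball (q : EuclideanSpace ℝ (Fin d)) (r q))
        (Metric.isOpen_ball.inter Metric.isOpen_ball) ⟨q, hq, Metric.mem_ball_self (hr q q.2)⟩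
      rw [← hx2.1 hx1.1, ← hx2.2 hx1.2]
    exact fun p hp => hlc.apply_eq_of_preconnectedSpace ⟨p, hp⟩ ⟨p₀, hp₀⟩
  refine ⟨c p₀, ?_⟩
  have hnull : volume {x | x ∈ Ω ∧ u x ≠ c p₀} = 0 := by
    refine measure_null_of_locally_null _ fun p hp => ?_
    refine ⟨_, inter_mem_nhdsWithin _ (Metric.ball_mem_nhds p (hr p hp.1)), ?_⟩
    refine measure_mono_null (fun x hx => ?_) (ae_iff.1 (hrc p hp.1))
    have h1 := hx.1.2
    rw [← hcc p hp.1] at h1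
    exact fun h => h1 (h hx.2)
  refine (ae_iff.2 (measure_mono_null (fun x hx => ?_) hnull))
  simpa using hx

end

/-! ### The first nontrivial Neumann eigenvalue -/

section

variable {d : ℕ} {Ω : Set (EuclideanSpace ℝ (Fin d))} {u : EuclideanSpace ℝ (Fin d) → ℝ}
  {g : EuclideanSpace ℝ (Fin d) → EuclideanSpace ℝ (Fin d)}

theorem inner_toLp_toLp {α F : Type*} [MeasurableSpace α] {μ : Measure α} [NormedAddCommGroup F]
    [InnerProductSpace ℝ F] {f h : α → F} (hf : MemLp f 2 μ) (hh : MemLp h 2 μ) :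
    inner ℝ hf.toLp hh.toLp = ∫ x, inner ℝ (f x) (h x) ∂μ := by
  rw [L2.inner_def]
  refine integral_congr_ae ?_
  filter_upwards [hf.coeFn_toLp, hh.coeFn_toLp] with x h1 h2
  rw [h1, h2]

theorem norm_toLp_sq {α F : Type*} [MeasurableSpace α] {μ : Measure α} [NormedAddCommGroup F]
    [InnerProductSpace ℝ F] {f : α → F} (hf : MemLp f 2 μ) :
    ‖hf.toLp‖ ^ 2 = ∫ x, ‖f x‖ ^ 2 ∂μ := by
  rw [← real_inner_self_eq_norm_sq, inner_toLp_toLp]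
  simp

theorem MemSobolevH1.toLp_mem_meanZeroSobolev (hΩ : IsOpen Ω) (hv : volume Ω ≠ ⊤)
    (h : MemSobolevH1 Ω u g) (h0 : ∫ x in Ω, u x = 0) :
    (h.memLp.toLp, h.memLp_grad.toLp) ∈ meanZeroSobolev hΩ hv :=
  ⟨h.3.congr h.1.coeFn_toLp.symm h.2.coeFn_toLp.symm, by
    rw [integral_congr_ae h.1.coeFn_toLp, h0]⟩

/-- Subtraction of the mean value. -/
theorem MemSobolevH1.sub_mean (hΩ : IsOpen Ω) (hv : volume Ω ≠ ⊤) (hv0 : volume Ω ≠ 0)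
    (h : MemSobolevH1 Ω u g) :
    MemSobolevH1 Ω (fun x => u x - (∫ y in Ω, u y) / volume.real Ω) g ∧
      ∫ x in Ω, (u x - (∫ y in Ω, u y) / volume.real Ω) = 0 := by
  have : IsFiniteMeasure (volume.restrict Ω) := ⟨by simpa using hv.lt_top⟩
  constructor
  · have := h.add hΩ (memSobolevH1_const hv (-((∫ y in Ω, u y) / volume.real Ω)))
    have e1 : g + (fun _ => 0) = g := by ext1; simp
    rw [e1] at this
    exact this
  · have hr : volume.real Ω ≠ 0 := (ENNReal.toReal_pos hv0 hv).ne'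
    rw [integral_sub (h.1.integrable (by norm_num)) (integrable_const _)]
    simp only [integral_const, measureReal_restrict_apply_univ, smul_eq_mul]
    field_simp
    simp

/-- A coordinate function minus its mean value is a nonzero mean-zero Sobolev function. -/
theorem exists_meanZeroSobolev_ne_zero (hd : 0 < d) (hΩ : IsOpen Ω) (hb : Bornology.IsBounded Ω)
    (hne : Ω.Nonempty) (hv : volume Ω ≠ ⊤) : ∃ x ∈ meanZeroSobolev hΩ hv, x.1 ≠ 0 := by
  have : IsFiniteMeasure (volume.restrict Ω) := ⟨by simpa using hv.lt_top⟩
  set i : Fin d := ⟨0, hd⟩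
  set L : EuclideanSpace ℝ (Fin d) →L[ℝ] ℝ := EuclideanSpace.proj i with hL
  obtain ⟨C, hC⟩ := hb.exists_norm_le
  have hg : gradient (fun x => L x) = fun _ => (InnerProductSpace.toDual ℝ _).symm L := by
    ext1 x
    simp [gradient]
  have hH : MemSobolevH1 Ω (fun x => L x) (fun _ => (InnerProductSpace.toDual ℝ _).symm L) := by
    refine ⟨?_, memLp_const _, ?_⟩
    · refine MemLp.of_bound (C := ‖L‖ * C) L.continuous.aestronglyMeasurable ?_
      filter_upwards [ae_restrict_mem hΩ.measurableSet] with x hx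
      exact (L.le_opNorm x).trans (by gcongr; exact hC x hx)
    · rw [← hg]
      exact hasWeakGradient_of_contDiff L.contDiff
  obtain ⟨hm, hm0⟩ := hH.sub_mean hΩ hv (hΩ.measure_pos _ hne).ne'
  refine ⟨_, hm.toLp_mem_meanZeroSobolev hΩ hv hm0, fun h0 => ?_⟩
  set m := (∫ y in Ω, L y) / volume.real Ω
  have hae : ∀ᵐ x, x ∈ Ω → L x = m := by
    rw [← ae_restrict_iff' hΩ.measurableSet]
    have h1 := hm.memLp.coeFn_toLp
    simp only at h0
    rw [h0] at h1
    filter_upwards [h1, Lp.coeFn_zero ℝ 2 (volume.restrict Ω)] with x h2 h3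
    rw [h3, Pi.zero_apply] at h2
    linarith
  obtain ⟨p, hp⟩ := hne
  obtain ⟨R, hR, hRΩ⟩ := Metric.isOpen_iff.1 hΩ p hp
  have hopen : IsOpen (Ω ∩ {x | L x ≠ m}) :=
    hΩ.inter (isOpen_ne_fun L.continuous continuous_const)
  have hnon : (Ω ∩ {x | L x ≠ m}).Nonempty := by
    by_cases hpm : L p = m
    · refine ⟨p + (R / 2) • EuclideanSpace.single i 1, hRΩ ?_, ?_⟩
      · simp [norm_smul, abs_of_pos hR, hR]
      · simp only [mem_ofPred_eq, map_add, map_smul, hpm]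
        simp [hL, hR.ne']
    · exact ⟨p, hp, hpm⟩
  obtain ⟨x, hx1, hx2⟩ := (Measure.dense_of_ae hae).inter_open_nonempty _ hopen hnon
  exact hx1.2 (hx2 hx1.1)

/-- The first nontrivial Neumann eigenvalue of a bounded Lipschitz domain exists, is positive, and
is the best constant of the Poincaré inequality. -/
theorem IsBoundedLipschitzDomain.exists_firstNeumannEigenvalue (hd : 0 < d)
    (hΩ : IsBoundedLipschitzDomain Ω) :
    ∃ l, 0 < l ∧ IsLeast (positiveNeumannEigenvalues Ω) l ∧
      ∀ u g, MemSobolevH1 Ω u g → ∫ x in Ω, u x = 0 →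
        l * ∫ x in Ω, u x ^ 2 ≤ ∫ x in Ω, ‖g x‖ ^ 2 := by
  have hv := hΩ.volume_ne_top
  have hv0 : volume Ω ≠ 0 := (hΩ.isOpen.measure_pos _ hΩ.isConnected.nonempty).ne'
  have : IsFiniteMeasure (volume.restrict Ω) := ⟨by simpa using hv.lt_top⟩
  obtain ⟨x, hx, hx1, hmin, heq⟩ := exists_isMinOn_rayleigh (meanZeroSobolev hΩ.isOpen hv)
    (isClosed_meanZeroSobolev hΩ.isOpen hv)
    (fun U hU C h1 h2 => hΩ.exists_subseq_cauchySeq (fun n => (hU n).1) h1 h2)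
    (exists_meanZeroSobolev_ne_zero hd hΩ.isOpen hΩ.isBounded hΩ.isConnected.nonempty hv)
  have hxH : MemSobolevH1 Ω x.1 x.2 := ⟨Lp.memLp _, Lp.memLp _, hx.1⟩
  have hpoin : ∀ u g, MemSobolevH1 Ω u g → ∫ y in Ω, u y = 0 →
      ‖x.2‖ ^ 2 * ∫ y in Ω, u y ^ 2 ≤ ∫ y in Ω, ‖g y‖ ^ 2 := by
    intro u g h h0
    have := hmin _ (h.toLp_mem_meanZeroSobolev hΩ.isOpen hv h0)
    simp only [norm_toLp_sq, Real.norm_eq_abs, sq_abs] at this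
    exact this
  have hpos : 0 < ‖x.2‖ ^ 2 := by
    by_contra hcon
    have h2 : x.2 = 0 := by
      have : ‖x.2‖ ^ 2 = 0 := le_antisymm (not_lt.1 hcon) (by positivity)
      simpa using this
    have hw : HasWeakGradient Ω x.1 0 := by
      refine hx.1.congr .rfl ?_
      rw [h2]
      exact Lp.coeFn_zero _ _ _
    obtain ⟨c, hc⟩ := hw.ae_eq_const_of_zero hΩ.isOpen hΩ.isConnected
      ((integrable_indicator_iff hΩ.isOpen.measurableSet).2
        ((Lp.memLp x.1).integrable (by norm_num)))
    have hc' : x.1 =ᵐ[volume.restrict Ω] fun _ => c :=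
      (ae_restrict_iff' hΩ.isOpen.measurableSet).2 hc
    have hc0 := hx.2
    rw [integral_congr_ae hc'] at hc0
    simp only [integral_const, measureReal_restrict_apply_univ, smul_eq_mul, mul_eq_zero] at hc0
    rcases hc0 with h3 | h3
    · exact (ENNReal.toReal_pos hv0 hv).ne' h3
    · have : x.1 = 0 := by
        ext1
        filter_upwards [hc', Lp.coeFn_zero ℝ 2 (volume.restrict Ω)] with y h4 h5
        rw [h4, h5, h3]; rfl
      rw [this, norm_zero] at hx1
      exact zero_ne_one hx1
  refine ⟨‖x.2‖ ^ 2, hpos, ⟨⟨hpos, x.1, x.2, hxH, ?_, ?_⟩, ?_⟩, hpoin⟩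
  · intro h0
    have : x.1 = 0 := by
      ext1
      exact h0.trans (Lp.coeFn_zero _ _ _).symm
    rw [this, norm_zero] at hx1
    exact zero_ne_one hx1
  -- the minimizer satisfies the equation against mean-zero functions, and hence, having mean zero
  -- itself, against all functions
  · intro φ gφ hφ
    obtain ⟨hm, hm0⟩ := hφ.sub_mean hΩ.isOpen hv hv0
    have h1 := heq _ (hm.toLp_mem_meanZeroSobolev hΩ.isOpen hv hm0)
    have e1 : x.1 = hxH.memLp.toLp := (Lp.toLp_coeFn _ _).symm
    have e2 : x.2 = hxH.memLp_grad.toLp := (Lp.toLp_coeFn _ _).symm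
    have h2 : inner ℝ x.2 hm.memLp_grad.toLp = ∫ y in Ω, inner ℝ (x.2 y) (gφ y) := by
      conv_lhs => rw [e2]
      rw [inner_toLp_toLp]
    have h3 : inner ℝ x.1 hm.memLp.toLp = ∫ y in Ω, x.1 y * φ y := by
      conv_lhs => rw [e1]
      rw [inner_toLp_toLp]
      simp only [RCLike.inner_apply, conj_trivial, sub_mul]
      rw [integral_sub, integral_const_mul, hx.2, mul_zero, sub_zero]
      · simp only [mul_comm]
      · exact hφ.1.integrable_mul hxH.1
      · exact (hxH.1.integrable (by norm_num)).const_mul _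
    simp only at h1
    rw [h2, h3] at h1
    exact h1
  -- testing with `1`, an eigenfunction of a positive eigenvalue has mean zero
  · rintro l ⟨hl, u, g, hu, hu0, hug⟩
    have h1 := hug _ _ (memSobolevH1_const hv 1)
    simp only [inner_zero_right, integral_zero, mul_one] at h1
    have h2 : ∫ y in Ω, u y = 0 := by
      rcases mul_eq_zero.1 h1.symm with h | h
      · exact absurd h hl.ne'
      · exact h
    have h3 := hug u g hu
    have h4 := hpoin u g hu h2
    simp only [real_inner_self_eq_norm_sq, ← pow_two] at h3
    rw [h3] at h4
    have h5 : 0 < ∫ y in Ω, u y ^ 2 := by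
      rw [integral_pos_iff_support_of_nonneg (fun y => sq_nonneg _) hu.1.integrable_sq]
      refine pos_iff_ne_zero.2 fun h => hu0 ?_
      rw [Filter.EventuallyEq, ae_iff]
      refine measure_mono_null (fun y hy => ?_) h
      simpa using hy
    exact le_of_mul_le_mul_right h4 h5

end

/-! ### Time averages of the evolution equation -/

theorem MemLp.comp_add_right' {Y F : Type*} [AddGroup Y] [MeasurableSpace Y] [MeasurableAdd Y]
    {μ : Measure Y} [μ.IsAddRightInvariant] [NormedAddCommGroup F] {p : ENNReal} {f : Y → F}
    (hf : MemLp f p μ) (y : Y) : MemLp (fun x => f (x + y)) p μ :=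
  hf.comp_measurePreserving (measurePreserving_add_right μ y)

/-- Fubini for an integral over `[0, h] × (ℝ × X)`, with `h` of either sign. -/
theorem integral_intervalIntegral_eq {X : Type*} [MeasurableSpace X] {m : Measure X} [SFinite m]
    {Φ : ℝ → ℝ × X → ℝ} {h : ℝ}
    (hΦ : Integrable (Function.uncurry Φ) ((volume.restrict (uIoc 0 h)).prod (volume.prod m))) :
    Integrable (fun s => ∫ r in (0 : ℝ)..h, ∫ x, Φ r (s, x) ∂m) ∧
      ∫ s, ∫ r in (0 : ℝ)..h, ∫ x, Φ r (s, x) ∂m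
        = ∫ r in (0 : ℝ)..h, ∫ z, Φ r z ∂(volume.prod m) := by
  have h1 : Integrable (fun z : (ℝ × ℝ) × X => Φ z.1.1 (z.1.2, z.2))
      (((volume.restrict (uIoc 0 h)).prod volume).prod m) :=
    (measurePreserving_prodAssoc (volume.restrict (uIoc 0 h)) volume
      m).integrable_comp_of_integrable hΦ
  have h2 : Integrable (fun z : ℝ × ℝ => ∫ x, Φ z.1 (z.2, x) ∂m)
      ((volume.restrict (uIoc 0 h)).prod volume) := h1.integral_prod_left
  simp only [intervalIntegral.intervalIntegral_eq_integral_uIoc]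
  refine ⟨(h2.integral_prod_right).smul (if 0 ≤ h then (1 : ℝ) else -1), ?_⟩
  rw [integral_smul, ← integral_integral_swap h2]
  congr 1
  refine integral_congr_ae ?_
  filter_upwards [hΦ.prod_right_ae] with r hr
  exact (integral_prod _ hr).symm

/-- The mechanism of the chain rule in time. Increments of `k`, averaged over `[a, b]`, dominate
quantities whose rate of change at step `0` is `∫ Φ 0`; since both sides vanish at step `0` and the
step may have either sign, the rates coincide. -/
theorem sub_eq_of_integral_increment_le {X : Type*} [MeasurableSpace X] {m : Measure X}
    [SFinite m] {Φ : ℝ → ℝ × X → ℝ}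
    (hΦ : ∀ h, Integrable (Function.uncurry Φ)
      ((volume.restrict (uIoc 0 h)).prod (volume.prod m)))
    (hc : Continuous fun r => ∫ z, Φ r z ∂(volume.prod m)) {k : ℝ → ℝ} {a b δ : ℝ} (hab : a ≤ b)
    (hδ : 0 < δ) (hk : ContinuousOn k (Ioo (a - δ) (b + δ)))
    (hsupp : ∀ r, ∀ s ∉ Ioc a b, ∀ x, Φ r (s, x) = 0)
    (hle : ∀ᵐ s ∂(volume.restrict (Ioc a b)), ∀ h, |h| < δ →
      ∫ r in (0 : ℝ)..h, ∫ x, Φ r (s, x) ∂m ≤ k (s + h) - k s) :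
    k b - k a = ∫ z, Φ 0 z ∂(volume.prod m) := by
  set c : ℝ → ℝ := fun r => ∫ z, Φ r z ∂(volume.prod m) with hcdef
  set J : ℝ → ℝ := fun h => ∫ r in (0 : ℝ)..h, c r with hJ
  have hJd : HasDerivAt J (c 0) 0 := intervalIntegral.integral_hasDerivAt_right
    (hc.intervalIntegrable _ _) (hc.stronglyMeasurableAtFilter _ _) hc.continuousAt
  have hii : ∀ x ∈ Ioo (a - δ) (b + δ), ∀ y ∈ Ioo (a - δ) (b + δ),
      IntervalIntegrable k volume x y :=
    fun x hx y hy => (hk.mono (ordConnected_Ioo.uIcc_subset hx hy)).intervalIntegrable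
  have ha : a ∈ Ioo (a - δ) (b + δ) := ⟨by linarith, by linarith⟩
  have hb : b ∈ Ioo (a - δ) (b + δ) := ⟨by linarith, by linarith⟩
  have hsh : ∀ x ∈ Icc a b, ∀ h, |h| < δ → x + h ∈ Ioo (a - δ) (b + δ) := fun x hx h hh =>
    ⟨by linarith [(abs_lt.1 hh).1, hx.1], by linarith [(abs_lt.1 hh).2, hx.2]⟩
  set P : ℝ → ℝ := fun h => (∫ s in a..b + h, k s) - (∫ s in a..a + h, k s)
    - ∫ s in a..b, k s with hP
  have hPd : HasDerivAt P (k b - k a) 0 := by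
    have hca : ∀ x ∈ Icc a b, HasDerivAt (fun h => ∫ s in a..x + h, k s) (k x) 0 := by
      intro x hx
      have hx' : x ∈ Ioo (a - δ) (b + δ) := ⟨by linarith [hx.1], by linarith [hx.2]⟩
      have h1 : HasDerivAt (fun y => ∫ s in a..y, k s) (k x) (x + 0) := by
        rw [add_zero]
        exact intervalIntegral.integral_hasDerivAt_right (hii _ ha _ hx')
          (hk.stronglyMeasurableAtFilter isOpen_Ioo _ hx')
          (hk.continuousAt (isOpen_Ioo.mem_nhds hx'))
      exact h1.comp_const_add x 0
    exact ((hca b ⟨hab, le_rfl⟩).sub (hca a ⟨le_rfl, hab⟩)).sub_const _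
  have hPeq : ∀ h, |h| < δ → P h = ∫ s in Ioc a b, (k (s + h) - k s) := by
    intro h hh
    have h1 : IntervalIntegrable (fun s => k (s + h)) volume a b := by
      simpa using (hii _ (hsh a ⟨le_rfl, hab⟩ h hh) _ (hsh b ⟨hab, le_rfl⟩ h hh)).comp_add_right h
    rw [← intervalIntegral.integral_of_le hab, intervalIntegral.integral_sub h1 (hii _ ha _ hb),
      intervalIntegral.integral_comp_add_right]
    simp only [hP]
    rw [intervalIntegral.integral_interval_sub_left (hii _ ha _ (hsh b ⟨hab, le_rfl⟩ h hh))
      (hii _ ha _ (hsh a ⟨le_rfl, hab⟩ h hh))]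
  have hJle : ∀ h, |h| < δ → J h ≤ P h := by
    intro h hh
    obtain ⟨hi, he⟩ := integral_intervalIntegral_eq (hΦ h)
    rw [hPeq h hh, show J h = _ from he.symm,
      ← setIntegral_eq_integral_of_forall_compl_eq_zero (s := Ioc a b)]
    · refine integral_mono_ae hi.restrict ?_ ?_
      · have h1 : IntervalIntegrable (fun s => k (s + h)) volume a b := by
          simpa using
            (hii _ (hsh a ⟨le_rfl, hab⟩ h hh) _ (hsh b ⟨hab, le_rfl⟩ h hh)).comp_add_right h
        exact (intervalIntegrable_iff_integrableOn_Ioc_of_le hab).1 (h1.sub (hii _ ha _ hb))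
      · filter_upwards [hle] with s hs using hs h hh
    · intro s hs
      simp [hsupp _ s hs]
  have hmin : IsLocalMin (fun h => P h - J h) 0 := by
    have : ∀ᶠ h : ℝ in 𝓝 0, |h| < δ := by
      have h1 : Tendsto (fun h : ℝ => |h|) (𝓝 0) (𝓝 0) := by
        simpa using continuous_abs.tendsto (0 : ℝ)
      exact h1.eventually (gt_mem_nhds hδ)
    filter_upwards [this] with h hh
    have h0 : P 0 - J 0 = 0 := by simp [hP, hJ]
    rw [h0]
    linarith [hJle h hh]
  have := hmin.hasDerivAt_eq_zero (hPd.sub hJd)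
  linarith

section Pairing

variable {Y F : Type*} [NormedAddCommGroup Y] [NormedSpace ℝ Y] [FiniteDimensional ℝ Y]
  [MeasurableSpace Y] [BorelSpace Y] {μ : Measure Y} [μ.IsAddHaarMeasure]
  [NormedAddCommGroup F] [InnerProductSpace ℝ F] {p q : ENNReal}

theorem eLpNorm_inner_le {α : Type*} [MeasurableSpace α] {μ : Measure α} [p.HolderTriple q 1]
    {f h : α → F} (hf : AEStronglyMeasurable f μ) (hh : AEStronglyMeasurable h μ) :
    eLpNorm (fun x => inner ℝ (f x) (h x)) 1 μ ≤ eLpNorm f p μ * eLpNorm h q μ := by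
  have := eLpNorm_le_eLpNorm_mul_eLpNorm_of_nnnorm (p := p) (q := q) (r := 1) hf hh
    (fun a b => inner ℝ a b) 1 (.of_forall fun x => by simpa using nnnorm_inner_le_nnnorm _ _)
  simpa using this

theorem integrable_inner_of_memLp {α : Type*} [MeasurableSpace α] {μ : Measure α}
    [p.HolderTriple q 1] {f h : α → F} (hf : MemLp f p μ) (hh : MemLp h q μ) :
    Integrable (fun x => inner ℝ (f x) (h x)) μ := by
  rw [← memLp_one_iff_integrable]
  exact ⟨hf.1.inner hh.1, (eLpNorm_inner_le hf.1 hh.1).trans_lt (ENNReal.mul_lt_top hf.2 hh.2)⟩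

/-- The pairing of a translate of an `L^p` function with an `L^q` function depends continuously on
the translation. -/
theorem continuous_integral_inner_translate [Fact (1 ≤ p)] (hp : p ≠ ⊤) [p.HolderTriple q 1]
    {f h : Y → F} (hf : MemLp f p μ) (hh : MemLp h q μ) :
    Continuous fun y : Y => ∫ x, inner ℝ (f (x + y)) (h x) ∂μ := by
  rw [continuous_iff_continuousAt]
  intro y₀
  have hi : ∀ y, Integrable (fun x => inner ℝ (f (x + y)) (h x)) μ := fun y =>
    integrable_inner_of_memLp (MemLp.comp_add_right' hf y) hh
  refine tendsto_integral_of_L1 _ (hi y₀).1 (.of_forall hi) ?_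
  have h0 : Tendsto (fun y => eLpNorm (fun x => f (x + (y - y₀)) - f x) p μ) (𝓝 y₀) (𝓝 0) := by
    refine (tendsto_eLpNorm_translate_sub hp hf).comp ?_
    have : Continuous fun y : Y => y - y₀ := by fun_prop
    simpa using this.tendsto y₀
  have h1 := ENNReal.Tendsto.mul_const (b := eLpNorm h q μ) h0 (.inr hh.2.ne)
  rw [zero_mul] at h1
  refine tendsto_of_tendsto_of_tendsto_of_le_of_le tendsto_const_nhds h1 (fun _ => zero_le)
    fun y => ?_
  have e1 : ∫⁻ x, ‖inner ℝ (f (x + y)) (h x) - inner ℝ (f (x + y₀)) (h x)‖ₑ ∂μ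
      = eLpNorm (fun x => inner ℝ (f (x + y) - f (x + y₀)) (h x)) 1 μ := by
    simp only [eLpNorm_one_eq_lintegral_enorm, inner_sub_left]
  dsimp only
  rw [e1]
  refine (eLpNorm_inner_le (p := p) (q := q) ((MemLp.comp_add_right' hf y).sub
    (MemLp.comp_add_right' hf y₀)).1 hh.1).trans ?_
  gcongr
  have := eLpNorm_comp_measurePreserving (p := p)
    (((MemLp.comp_add_right' hf (y - y₀)).sub hf).1) (measurePreserving_add_right μ y₀)
  refine le_of_eq (Eq.trans ?_ this)
  congr 1
  ext x
  simp [add_assoc]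

variable {X : Type*} [NormedAddCommGroup X] [NormedSpace ℝ X] [FiniteDimensional ℝ X]
  [MeasurableSpace X] [BorelSpace X] {m : Measure X} [m.IsAddHaarMeasure]

/-- Translations in the first variable only, jointly integrable with the translation parameter. -/
theorem integrable_inner_translate_fst [p.HolderTriple q 1] {f h : ℝ × X → F}
    (hf : MemLp f p (volume.prod m)) (hh : MemLp h q (volume.prod m)) (ν : Measure ℝ)
    [IsFiniteMeasure ν] :
    Integrable (fun z : ℝ × ℝ × X => inner ℝ (f (z.2.1 + z.1, z.2.2)) (h z.2))
      (ν.prod (volume.prod m)) := by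
  have hm : AEStronglyMeasurable (fun z : ℝ × ℝ × X => inner ℝ (f (z.2.1 + z.1, z.2.2)) (h z.2))
      (ν.prod (volume.prod m)) := by
    refine AEStronglyMeasurable.inner ?_ hh.1.comp_snd
    have hmm : Measurable fun z : ℝ × ℝ × X => (z.2.1 + z.1, z.2.2) := by fun_prop
    refine hf.1.comp_quasiMeasurePreserving ⟨hmm, ?_⟩
    refine Measure.AbsolutelyContinuous.mk fun s hs h0 => ?_
    rw [Measure.map_apply hmm hs, Measure.prod_apply (hmm hs)]
    refine lintegral_eq_zero_of_ae_eq_zero (.of_forall fun r => ?_)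
    have := measure_preimage_add_right (volume.prod m) ((r, 0) : ℝ × X) s
    rw [h0, show (fun x : ℝ × X => x + (r, 0)) = fun x => (x.1 + r, x.2) by
      ext x <;> simp] at this
    exact this
  have hb : ∀ r : ℝ, eLpNorm (fun z : ℝ × X => inner ℝ (f (z.1 + r, z.2)) (h z)) 1 (volume.prod m)
      ≤ eLpNorm f p (volume.prod m) * eLpNorm h q (volume.prod m) := by
    intro r
    have h1 := MemLp.comp_add_right' hf ((r, 0) : ℝ × X)
    have h2 := eLpNorm_comp_measurePreserving (p := p) hf.1
      (measurePreserving_add_right (volume.prod m) ((r, 0) : ℝ × X))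
    have h3 := eLpNorm_inner_le (p := p) (q := q) h1.1 hh.1
    have e : ∀ z : ℝ × X, z + (r, 0) = (z.1 + r, z.2) := fun z => by ext <;> simp
    simp only [Function.comp_def, e] at h1 h2 h3
    rwa [h2] at h3
  rw [← memLp_one_iff_integrable]
  refine ⟨hm, ?_⟩
  rw [eLpNorm_one_eq_lintegral_enorm, lintegral_prod _ hm.enorm]
  calc _ ≤ ∫⁻ _, (eLpNorm f p (volume.prod m) * eLpNorm h q (volume.prod m)) ∂ν :=
        lintegral_mono fun r => by
          have := hb r
          rwa [eLpNorm_one_eq_lintegral_enorm] at this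
    _ < ⊤ := by
        rw [lintegral_const]
        exact ENNReal.mul_lt_top (ENNReal.mul_lt_top hf.2 hh.2) (measure_lt_top _ _)

/-- The chain rule in time for a quantity `k` whose increments dominate the time integrals of the
weak form of an evolution equation, tested with a function of the starting time. -/
theorem sub_eq_setIntegral_of_increment_le {Ω : Set X} (hΩ : MeasurableSet Ω) {T a b M : ℝ}
    (ha : 0 < a) (hab : a ≤ b) (hbT : b < T) {A Q : ℝ × X → F} {S ψ : ℝ × X → ℝ}
    (hA : MemLp A 2 ((volume.restrict (Ioc 0 T)).prod (m.restrict Ω)))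
    (hQ : MemLp Q 2 ((volume.restrict (Ioc 0 T)).prod (m.restrict Ω)))
    (hS : Integrable S ((volume.restrict (Ioc 0 T)).prod (m.restrict Ω)))
    (hψ : AEStronglyMeasurable ψ ((volume.restrict (Ioc 0 T)).prod (m.restrict Ω)))
    (hψM : ∀ᵐ z ∂((volume.restrict (Ioc 0 T)).prod (m.restrict Ω)), |ψ z| ≤ M)
    {k : ℝ → ℝ} (hk : ContinuousOn k (Ioi 0))
    (hle : ∀ᵐ s ∂(volume.restrict (Ioc 0 T)), ∀ r ∈ Ioo 0 T,
      ∫ τ in s..r, ∫ x in Ω, (inner ℝ (A (τ, x)) (Q (s, x)) + S (τ, x) * ψ (s, x)) ∂m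
        ≤ k r - k s) :
    k b - k a = ∫ z in Ioc a b ×ˢ Ω, (inner ℝ (A z) (Q z) + S z * ψ z) ∂(volume.prod m) := by
  have hBm : MeasurableSet (Ioc 0 T ×ˢ Ω) := measurableSet_Ioc.prod hΩ
  have hCm : MeasurableSet (Ioc a b ×ˢ Ω) := measurableSet_Ioc.prod hΩ
  have hCB : Ioc a b ×ˢ Ω ⊆ Ioc 0 T ×ˢ Ω :=
    prod_mono (Ioc_subset_Ioc ha.le hbT.le) subset_rfl
  rw [Measure.prod_restrict] at hA hQ hS hψ hψM
  -- the test functions are cut off to `[a, b]`, the fluxes only to `[0, T]`, so that small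
  -- shifts in time do not leave the support of the latter
  set A' := (Ioc 0 T ×ˢ Ω).indicator A
  set S' := (Ioc 0 T ×ˢ Ω).indicator S
  set Q' := (Ioc a b ×ˢ Ω).indicator Q
  set ψ' := (Ioc a b ×ˢ Ω).indicator ψ
  have hA' : MemLp A' 2 (volume.prod m) := (memLp_indicator_iff_restrict hBm).2 hA
  have hS' : MemLp S' 1 (volume.prod m) :=
    (memLp_indicator_iff_restrict hBm).2 (memLp_one_iff_integrable.2 hS)
  have hQ' : MemLp Q' 2 (volume.prod m) := (memLp_indicator_iff_restrict hCm).2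
    (hQ.mono_measure (Measure.restrict_mono hCB le_rfl))
  have hψ' : MemLp ψ' ⊤ (volume.prod m) := (memLp_indicator_iff_restrict hCm).2
    ((memLp_top_of_bound hψ M hψM).mono_measure (Measure.restrict_mono hCB le_rfl))
  set Φ : ℝ → ℝ × X → ℝ := fun r z =>
    inner ℝ (A' (z.1 + r, z.2)) (Q' z) + inner ℝ (S' (z.1 + r, z.2)) (ψ' z) with hΦdef
  have hΦ : ∀ h, Integrable (Function.uncurry Φ)
      ((volume.restrict (uIoc 0 h)).prod (volume.prod m)) := fun h => by
    have : IsFiniteMeasure (volume.restrict (uIoc 0 h)) := ⟨by simp [uIoc]⟩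
    exact (integrable_inner_translate_fst hA' hQ' _).add (integrable_inner_translate_fst hS' hψ' _)
  have htr : ∀ r (z : ℝ × X), z + (r, 0) = (z.1 + r, z.2) := fun r z => by ext <;> simp
  have hc : Continuous fun r => ∫ z, Φ r z ∂(volume.prod m) := by
    have c1 := (continuous_integral_inner_translate (by norm_num) hA' hQ').comp
      (show Continuous fun r : ℝ => ((r, 0) : ℝ × X) by fun_prop)
    have c2 := (continuous_integral_inner_translate (by norm_num) hS' hψ').comp
      (show Continuous fun r : ℝ => ((r, 0) : ℝ × X) by fun_prop)
    refine (c1.add c2).congr fun r => ?_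
    have i1 := integrable_inner_of_memLp (MemLp.comp_add_right' hA' ((r, 0) : ℝ × X)) hQ'
    have i2 := integrable_inner_of_memLp (MemLp.comp_add_right' hS' ((r, 0) : ℝ × X)) hψ'
    simp only [Pi.add_apply, Function.comp_def, htr] at i1 i2 ⊢
    rw [← integral_add i1 i2]
  have hval : ∀ s ∈ Ioc a b, ∀ r, s + r ∈ Ioc 0 T → ∫ x, Φ r (s, x) ∂m
      = ∫ x in Ω, (inner ℝ (A (s + r, x)) (Q (s, x)) + S (s + r, x) * ψ (s, x)) ∂m := by
    intro s hs r hr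
    rw [← integral_indicator hΩ]
    refine integral_congr_ae (.of_forall fun x => ?_)
    by_cases hx : x ∈ Ω
    · have e1 : (s, x) ∈ Ioc a b ×ˢ Ω := ⟨hs, hx⟩
      have e2 : (s + r, x) ∈ Ioc 0 T ×ˢ Ω := ⟨hr, hx⟩
      simp only [hΦdef, A', Q', S', ψ', indicator_of_mem e1, indicator_of_mem e2,
        indicator_of_mem hx, RCLike.inner_apply, conj_trivial, mul_comm]
    · simp [hΦdef, Q', ψ', hx]
  have main := sub_eq_of_integral_increment_le (m := m) hΦ hc (k := k) (δ := min a (T - b)) hab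
    (lt_min ha (by linarith)) (hk.mono fun x hx => by
      have := hx.1
      have h1 := min_le_left a (T - b)
      exact mem_Ioi.2 (by linarith)) ?_ ?_
  · rw [main, ← integral_indicator hCm]
    refine integral_congr_ae (.of_forall fun z => ?_)
    by_cases hz : z ∈ Ioc a b ×ˢ Ω
    · simp only [hΦdef, A', Q', S', ψ', indicator_of_mem hz, add_zero, Prod.mk.eta,
        indicator_of_mem (hCB hz), RCLike.inner_apply, conj_trivial, mul_comm]
    · simp [hΦdef, Q', ψ', indicator_of_notMem hz]
  · intro r s hs x
    have e1 : (s, x) ∉ Ioc a b ×ˢ Ω := fun h => hs h.1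
    simp [hΦdef, Q', ψ', indicator_of_notMem e1]
  · have hsub : Ioc a b ⊆ Ioc 0 T := Ioc_subset_Ioc ha.le hbT.le
    filter_upwards [ae_mono (Measure.restrict_mono hsub le_rfl) hle,
      ae_restrict_mem measurableSet_Ioc] with s hs hsab h hh
    have hsh : s + h ∈ Ioo 0 T := by
      have h1 := min_le_left a (T - b)
      have h2 := min_le_right a (T - b)
      exact ⟨by linarith [(abs_lt.1 hh).1, hsab.1], by linarith [(abs_lt.1 hh).2, hsab.2]⟩
    refine le_trans (le_of_eq ?_) (hs (s + h) hsh)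
    have e := intervalIntegral.integral_comp_add_left (a := 0) (b := h)
      (fun τ => ∫ x in Ω, (inner ℝ (A (τ, x)) (Q (s, x)) + S (τ, x) * ψ (s, x)) ∂m) s
    rw [add_zero] at e
    rw [← e]
    refine intervalIntegral.integral_congr fun r hr => hval s hsab r ?_
    have hs0 : s ∈ Ioo 0 T := ⟨by linarith [hsab.1], by linarith [hsab.2]⟩
    have h3 : s + r ∈ uIcc s (s + h) := by
      have := image_const_add_uIcc s 0 h
      rw [add_zero] at this
      rw [← this]
      exact mem_image_of_mem _ hr
    exact Ioo_subset_Ioc_self (ordConnected_Ioo.uIcc_subset hs0 hsh h3)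

end Pairing

/-! ### Functions of the internal energy -/

section

variable {d : ℕ} {Ω : Set (EuclideanSpace ℝ (Fin d))} {u : EuclideanSpace ℝ (Fin d) → ℝ}
  {g : EuclideanSpace ℝ (Fin d) → EuclideanSpace ℝ (Fin d)}

/-- Continuous extension of a function on a half line, constant to the left of it. -/
theorem continuous_comp_max_of_continuousOn {f : ℝ → ℝ} {c : ℝ} (hf : ContinuousOn f (Ici c)) :
    Continuous fun y => f (max y c) :=
  hf.comp_continuous (by fun_prop) fun y => le_max_right y c

theorem hasDerivAt_integral_of_continuous {f : ℝ → ℝ} (hf : Continuous f) (c y : ℝ) :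
    HasDerivAt (fun y => ∫ s in c..y, f s) (f y) y :=
  intervalIntegral.integral_hasDerivAt_right (hf.intervalIntegrable _ _)
    (hf.stronglyMeasurableAtFilter _ _) hf.continuousAt

/-- A `C¹` function whose derivative is bounded below by a positive constant has a `C¹` inverse. -/
theorem exists_hasDerivAt_inverse {p p' : ℝ → ℝ} (hp : ∀ y, HasDerivAt p (p' y) y) {k : ℝ}
    (hk : 0 < k) (hp' : ∀ y, k ≤ p' y) :
    ∃ W : ℝ → ℝ, (∀ y, W (p y) = y) ∧ Continuous W ∧ ∀ z, HasDerivAt W (p' (W z))⁻¹ z := by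
  have hpc : Continuous p := continuous_iff_continuousAt.2 fun y => (hp y).continuousAt
  have hmono : StrictMono p := strictMono_of_deriv_pos fun y => by
    rw [(hp y).deriv]; exact hk.trans_le (hp' y)
  have hgrow : ∀ x y, x ≤ y → k * (y - x) ≤ p y - p x := fun x y hxy =>
    mul_sub_le_image_sub_of_le_deriv (fun y => (hp y).differentiableAt)
      (fun y => by rw [(hp y).deriv]; exact hp' y) hxy
  have hsurj : Function.Surjective p := by
    refine hpc.surjective ?_ ?_
    · refine tendsto_atTop_mono' _ (f₁ := fun y => p 0 + k * y) ?_ ?_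
      · filter_upwards [eventually_ge_atTop 0] with y hy
        linarith [hgrow 0 y hy]
      · exact tendsto_atTop_add_const_left _ _ (tendsto_id.const_mul_atTop hk)
    · refine tendsto_atBot_mono' _ (f₁ := fun y => p 0 + k * y) ?_ ?_
      · filter_upwards [eventually_le_atBot 0] with y hy
        linarith [hgrow y 0 hy]
      · exact tendsto_atBot_add_const_left _ _ (tendsto_id.const_mul_atBot hk)
  set e := hmono.orderIsoOfSurjective p hsurj
  have he : ∀ z, p (e.symm z) = z := fun z => e.apply_symm_apply z
  refine ⟨e.symm, fun y => e.symm_apply_apply y, e.symm.continuous, fun z => ?_⟩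
  exact HasDerivAt.of_local_left_inverse e.symm.continuous.continuousAt (hp _)
    (hk.trans_le (hp' _)).ne' (.of_forall he)

theorem pressure_eq_of_le {κ : ℝ → ℝ} (hκ : ContinuousOn κ (Ici 0)) {c y : ℝ} (hc : 0 ≤ c)
    (hy : c ≤ y) : pressure κ y = pressure κ c + ∫ s in c..y, κ (max s c) := by
  have h1 : ∀ a b, 0 ≤ a → 0 ≤ b → IntervalIntegrable κ volume a b := fun a b ha hb =>
    (hκ.mono fun x hx => (le_min ha hb).trans hx.1).intervalIntegrable
  have h2 : ∫ s in c..y, κ (max s c) = ∫ s in c..y, κ s := by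
    refine intervalIntegral.integral_congr fun s hs => ?_
    rw [uIcc_of_le hy] at hs
    simp only [max_eq_left hs.1]
  rw [h2, pressure, pressure, intervalIntegral.integral_add_adjacent_intervals
    (h1 _ _ le_rfl hc) (h1 _ _ hc (hc.trans hy))]

/-- If the pressure `Π(u)` has a weak gradient and `u` stays above a positive constant, where `Π`
is invertible, then smooth functions of `u` have the weak gradient given by formal calculus. -/
theorem HasWeakGradient.comp_of_pressure (hΩ : IsOpen Ω) {κ : ℝ → ℝ} (hκ : ContinuousOn κ (Ici 0))
    {c k : ℝ} (hc : 0 ≤ c) (hk : 0 < k) (hκk : ∀ y, c ≤ y → k ≤ κ y)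
    (h : HasWeakGradient Ω (fun x => pressure κ (u x)) g)
    (hu : ∀ᵐ x ∂(volume.restrict Ω), c ≤ u x) {G G' : ℝ → ℝ}
    (hG : ∀ y, c ≤ y → HasDerivAt G (G' y) y) (hG' : ContinuousOn G' (Ici c)) {M : ℝ}
    (hM : ∀ y, c ≤ y → |G' y| ≤ M) :
    HasWeakGradient Ω (fun x => G (u x)) (fun x => (G' (u x) / κ (u x)) • g x) := by
  have hκc : Continuous fun y => κ (max y c) :=
    continuous_comp_max_of_continuousOn (hκ.mono (Ici_subset_Ici.2 hc))
  have hGc : Continuous fun y => G' (max y c) := continuous_comp_max_of_continuousOn hG'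
  set P : ℝ → ℝ := fun y => pressure κ c + ∫ s in c..y, κ (max s c) with hP
  obtain ⟨W, hW, hWc, hWd⟩ := exists_hasDerivAt_inverse (p := P) (p' := fun y => κ (max y c))
    (fun y => (hasDerivAt_integral_of_continuous hκc c y).const_add _) hk
    (fun y => hκk _ (le_max_right _ _))
  set L : ℝ → ℝ := fun y => G c + ∫ s in c..y, G' (max s c) with hL
  have hLd : ∀ y, HasDerivAt L (G' (max y c)) y := fun y =>
    (hasDerivAt_integral_of_continuous hGc c y).const_add _
  have hLG : ∀ y, c ≤ y → L y = G y := by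
    intro y hy
    have : ∫ s in c..y, G' (max s c) = G y - G c := by
      have h1 : ∫ s in c..y, G' (max s c) = ∫ s in c..y, G' s := by
        refine intervalIntegral.integral_congr fun s hs => ?_
        rw [uIcc_of_le hy] at hs
        simp only [max_eq_left hs.1]
      rw [h1]
      refine intervalIntegral.integral_eq_sub_of_hasDerivAt (fun s hs => ?_) ?_
      · rw [uIcc_of_le hy] at hs
        exact hG s hs.1
      · refine (hG'.mono ?_).intervalIntegrable
        rw [uIcc_of_le hy]
        exact Icc_subset_Ici_self
    rw [hL]
    simp only
    rw [this]
    ring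
  have hM0 : 0 ≤ M := (abs_nonneg _).trans (hM c le_rfl)
  have key := h.comp hΩ (β := fun z => L (W z))
    (β' := fun z => G' (max (W z) c) * (κ (max (W z) c))⁻¹) (M := M * k⁻¹)
    (fun z => (hLd (W z)).comp z (hWd z))
    ((hGc.comp hWc).mul ((hκc.comp hWc).inv₀ fun z => (hk.trans_le (hκk _ (le_max_right _ _))).ne'))
    (fun z => by
      have h1 := hκk (max (W z) c) (le_max_right _ _)
      rw [abs_mul, abs_inv, abs_of_pos (hk.trans_le h1)]
      gcongr
      · exact inv_nonneg.2 (hk.trans_le h1).le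
      · exact hM _ (le_max_right _ _))
  have hWu : ∀ᵐ x ∂(volume.restrict Ω), W (pressure κ (u x)) = u x := by
    filter_upwards [hu] with x hx
    rw [pressure_eq_of_le hκ hc hx]
    exact hW _
  refine key.congr ?_ ?_
  · filter_upwards [hWu, hu] with x h1 h2
    rw [h1, hLG _ h2]
  · filter_upwards [hWu, hu] with x h1 h2
    rw [h1, max_eq_left h2, div_eq_mul_inv]

theorem ae_le_prod_of_ae_ae {α β : Type*} [MeasurableSpace α] [MeasurableSpace β] {μ : Measure α}
    {ν : Measure β} [SFinite ν] {f : α × β → ℝ} (hf : AEStronglyMeasurable f (μ.prod ν)) {c : ℝ}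
    (h : ∀ᵐ a ∂μ, ∀ᵐ b ∂ν, c ≤ f (a, b)) : ∀ᵐ z ∂(μ.prod ν), c ≤ f z := by
  have h1 := Measure.ae_ae_of_ae_prod hf.ae_eq_mk
  have h2 : ∀ᵐ z ∂(μ.prod ν), c ≤ hf.mk f z := by
    rw [Measure.ae_prod_iff_ae_ae (measurableSet_le measurable_const
      hf.stronglyMeasurable_mk.measurable)]
    filter_upwards [h, h1] with a ha ha'
    filter_upwards [ha, ha'] with b hb hb'
    rwa [← hb']
  filter_upwards [h2, hf.ae_eq_mk] with z hz hz'
  rwa [hz']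

/-- If `w` is continuous in time with values in `L¹` and `f` is Lipschitz, then `∫ f(w)` is
continuous in time. -/
theorem continuousOn_integral_comp_of_lipschitz {α : Type*} [MeasurableSpace α] {μ : Measure α}
    [IsFiniteMeasure μ] {w : ℝ → α → ℝ} {S : Set ℝ} (hw : ∀ t ∈ S, Integrable (w t) μ)
    (hwc : ∀ s ∈ S, Tendsto (fun t => eLpNorm (w t - w s) 1 μ) (𝓝[S] s) (𝓝 0))
    {f : ℝ → ℝ} (hf : Continuous f) {M : ℝ} (hM : ∀ x y, |f x - f y| ≤ M * |x - y|) :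
    (∀ t ∈ S, Integrable (fun x => f (w t x)) μ) ∧
      ContinuousOn (fun t => ∫ x, f (w t x) ∂μ) S := by
  have hM0 : 0 ≤ M := by
    have := (abs_nonneg _).trans (hM 1 0)
    simpa using this
  have hi : ∀ t ∈ S, Integrable (fun x => f (w t x)) μ := by
    intro t ht
    refine Integrable.mono' (g := fun x => |f 0| + M * ‖w t x‖)
      ((integrable_const _).add ((hw t ht).norm.const_mul M))
      (hf.comp_aestronglyMeasurable (hw t ht).1) (.of_forall fun x => ?_)
    have h1 := hM (w t x) 0
    have h2 := abs_add_le (f (w t x) - f 0) (f 0)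
    simp only [sub_add_cancel, sub_zero, Real.norm_eq_abs] at *
    linarith
  refine ⟨hi, fun s hs => ?_⟩
  refine tendsto_integral_of_L1 _ (hi s hs).1 ?_ ?_
  · filter_upwards [self_mem_nhdsWithin] with t ht using hi t ht
  · have h1 := ENNReal.Tendsto.const_mul (a := ENNReal.ofReal M) (hwc s hs)
      (.inr ENNReal.ofReal_ne_top)
    rw [mul_zero] at h1
    refine tendsto_of_tendsto_of_tendsto_of_le_of_le tendsto_const_nhds h1 (fun _ => zero_le)
      fun t => ?_
    dsimp only
    rw [eLpNorm_one_eq_lintegral_enorm, ← lintegral_const_mul' _ _ ENNReal.ofReal_ne_top]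
    refine lintegral_mono fun x => ?_
    rw [← ofReal_norm, ← ofReal_norm, ← ENNReal.ofReal_mul hM0]
    exact ENNReal.ofReal_le_ofReal (hM _ _)

theorem continuousOn_integral_sq {α : Type*} [MeasurableSpace α] {μ : Measure α}
    {v : ℝ → α → ℝ} {S : Set ℝ} (hv : ∀ t ∈ S, MemLp (v t) 2 μ)
    (hvc : ∀ s ∈ S, Tendsto (fun t => eLpNorm (v t - v s) 2 μ) (𝓝[S] s) (𝓝 0)) :
    ContinuousOn (fun t => ∫ x, v t x ^ 2 ∂μ) S := by
  have hN : ContinuousOn (fun t => (eLpNorm (v t) 2 μ).toReal) S := by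
    intro s hs
    have h1 := (ENNReal.tendsto_toReal ENNReal.zero_ne_top).comp (hvc s hs)
    rw [ENNReal.toReal_zero] at h1
    refine tendsto_iff_dist_tendsto_zero.2 (squeeze_zero' (.of_forall fun _ => dist_nonneg) ?_ h1)
    filter_upwards [self_mem_nhdsWithin] with t ht
    have h2 : ∀ r (hr : r ∈ S), (eLpNorm (v r) 2 μ).toReal = ‖(hv r hr).toLp‖ := fun r hr => by
      rw [Lp.norm_toLp]
    rw [h2 t ht, h2 s hs, Real.dist_eq, Function.comp_apply,
      ← Lp.norm_toLp _ ((hv t ht).sub (hv s hs)), MemLp.toLp_sub]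
    exact abs_norm_sub_norm_le _ _
  refine (hN.pow 2).congr fun t ht => ?_
  have := norm_toLp_sq (hv t ht)
  rw [Lp.norm_toLp] at this
  simp only [Real.norm_eq_abs, sq_abs] at this
  exact this.symm

end

/-! ### Testing the equations with functions of the solution -/

section

variable {d : ℕ} {Ω : Set (EuclideanSpace ℝ (Fin d))}

/-- Additivity over time intervals of the weak form of the equations, for a test function which
does not depend on time. -/
theorem intervalIntegral_sub_eq_of_flux {X F : Type*} [MeasurableSpace X] [NormedAddCommGroup F]
    [InnerProductSpace ℝ F] {ν : Measure X} [SFinite ν] {T M : ℝ} {A : ℝ × X → F} {S : ℝ × X → ℝ}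
    (hA : MemLp A 2 ((volume.restrict (Ioc 0 T)).prod ν))
    (hS : Integrable S ((volume.restrict (Ioc 0 T)).prod ν)) {q : X → F} {φ : X → ℝ}
    (hq : MemLp q 2 ν) (hφ : AEStronglyMeasurable φ ν) (hφM : ∀ᵐ x ∂ν, |φ x| ≤ M) {r s : ℝ}
    (hr : r ∈ Icc 0 T) (hs : s ∈ Icc 0 T) :
    (∫ τ in (0 : ℝ)..r, ∫ x, (inner ℝ (A (τ, x)) (q x) + S (τ, x) * φ x) ∂ν)
      - ∫ τ in (0 : ℝ)..s, ∫ x, (inner ℝ (A (τ, x)) (q x) + S (τ, x) * φ x) ∂ν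
      = ∫ τ in s..r, ∫ x, (inner ℝ (A (τ, x)) (q x) + S (τ, x) * φ x) ∂ν := by
  have h1 : Integrable (fun z : ℝ × X => inner ℝ (A z) (q z.2) + S z * φ z.2)
      ((volume.restrict (Ioc 0 T)).prod ν) := by
    refine (integrable_inner_of_memLp (p := 2) (q := 2) hA (hq.comp_snd _)).add ?_
    exact hS.mul_bdd hφ.comp_snd (Measure.quasiMeasurePreserving_snd.ae hφM)
  have h2 : IntegrableOn (fun τ => ∫ x, (inner ℝ (A (τ, x)) (q x) + S (τ, x) * φ x) ∂ν)
      (Ioc 0 T) := h1.integral_prod_left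
  have h3 : ∀ t ∈ Icc 0 T, IntervalIntegrable
      (fun τ => ∫ x, (inner ℝ (A (τ, x)) (q x) + S (τ, x) * φ x) ∂ν) volume 0 t := fun t ht =>
    (intervalIntegrable_iff_integrableOn_Ioc_of_le ht.1).2
      (h2.mono_set (Ioc_subset_Ioc_right ht.2))
  exact intervalIntegral.integral_interval_sub_left (h3 r hr) (h3 s hs)

theorem abs_integral_sub_integral_le {θ : ℝ → ℝ} (hθ : Continuous θ) {M : ℝ}
    (hM : ∀ y, |θ y| ≤ M) (x y : ℝ) :
    |(∫ s in (0 : ℝ)..x, θ s) - ∫ s in (0 : ℝ)..y, θ s| ≤ M * |x - y| := by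
  rw [intervalIntegral.integral_interval_sub_left (hθ.intervalIntegrable _ _)
    (hθ.intervalIntegrable _ _)]
  exact intervalIntegral.norm_integral_le_of_norm_le_const (f := θ) fun s _ => hM s

/-- The primitive of a monotone function lies above its tangents. -/
theorem Monotone.mul_sub_le_integral_sub {θ : ℝ → ℝ} (hθ : Continuous θ) (hm : Monotone θ)
    (x y : ℝ) : θ x * (y - x) ≤ (∫ s in (0 : ℝ)..y, θ s) - ∫ s in (0 : ℝ)..x, θ s := by
  rw [intervalIntegral.integral_interval_sub_left (hθ.intervalIntegrable _ _)
    (hθ.intervalIntegrable _ _)]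
  have hc : ∫ _ in x..y, θ x = θ x * (y - x) := by
    rw [intervalIntegral.integral_const, smul_eq_mul, mul_comm]
  rw [← hc]
  rcases le_total x y with h | h
  · exact intervalIntegral.integral_mono_on h (by simp) (hθ.intervalIntegrable _ _)
      fun s hs => hm hs.1
  · rw [intervalIntegral.integral_symm y x, intervalIntegral.integral_symm y x, neg_le_neg_iff]
    exact intervalIntegral.integral_mono_on h (hθ.intervalIntegrable _ _) (by simp)
      fun s hs => hm hs.2

variable {η κ : ℝ → ℝ} {v w : ℝ → EuclideanSpace ℝ (Fin d) → ℝ}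
  {Gv Gp : ℝ → EuclideanSpace ℝ (Fin d) → EuclideanSpace ℝ (Fin d)}

namespace IsWeakSolutionWith

theorem aestronglyMeasurable_w (sol : IsWeakSolutionWith Ω η κ v w Gv Gp) (T : ℝ) :
    AEStronglyMeasurable (fun p : ℝ × EuclideanSpace ℝ (Fin d) => w p.1 p.2)
      ((volume.restrict (Ioc 0 T)).prod (volume.restrict Ω)) :=
  sol.w_measurable.mono_measure
    (Measure.prod_mono (Measure.restrict_mono Ioc_subset_Ioi_self le_rfl) le_rfl)

theorem aestronglyMeasurable_Gv (sol : IsWeakSolutionWith Ω η κ v w Gv Gp) (T : ℝ) :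
    AEStronglyMeasurable (fun p : ℝ × EuclideanSpace ℝ (Fin d) => Gv p.1 p.2)
      ((volume.restrict (Ioc 0 T)).prod (volume.restrict Ω)) :=
  sol.Gv_measurable.mono_measure
    (Measure.prod_mono (Measure.restrict_mono Ioc_subset_Ioi_self le_rfl) le_rfl)

/-- The equation for `w` may be tested with bounded monotone functions `θ(w)` of `w` itself,
provided these are weakly differentiable. -/
theorem integral_comp_w_sub (sol : IsWeakSolutionWith Ω η κ v w Gv Gp) (hΩ : MeasurableSet Ω)
    (hv : volume Ω ≠ ⊤) {θ : ℝ → ℝ} (hθ : Continuous θ) (hm : Monotone θ) {M : ℝ}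
    (hM : ∀ y, |θ y| ≤ M) {a b T : ℝ} (ha : 0 < a) (hab : a ≤ b) (hbT : b < T)
    {Q : ℝ × EuclideanSpace ℝ (Fin d) → EuclideanSpace ℝ (Fin d)}
    (hQ : MemLp Q 2 ((volume.restrict (Ioc 0 T)).prod (volume.restrict Ω)))
    (hwQ : ∀ᵐ s ∂(volume.restrict (Ioc 0 T)),
      MemSobolevH1 Ω (fun x => θ (w s x)) (fun x => Q (s, x))) :
    (∫ x in Ω, ∫ y in (0 : ℝ)..w b x, θ y) - ∫ x in Ω, ∫ y in (0 : ℝ)..w a x, θ y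
      = ∫ z in Ioc a b ×ˢ Ω, (- inner ℝ (Gp z.1 z.2) (Q z)
          + η (w z.1 z.2) * ‖Gv z.1 z.2‖ ^ 2 * θ (w z.1 z.2)) := by
  have : IsFiniteMeasure (volume.restrict Ω) := ⟨by simpa using hv.lt_top⟩
  have hT : 0 < T := by linarith
  have hΘc : Continuous fun y => ∫ s in (0 : ℝ)..y, θ s :=
    continuous_iff_continuousAt.2 fun y => (hasDerivAt_integral_of_continuous hθ 0 y).continuousAt
  obtain ⟨hΘi, hΘ⟩ := continuousOn_integral_comp_of_lipschitz (S := Ici 0)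
    (fun t ht => sol.w_integrable t ht) (fun s hs => sol.w_continuous s hs)
    hΘc (abs_integral_sub_integral_le hθ hM)
  have key := sub_eq_setIntegral_of_increment_le (m := volume) (T := T) (M := M) hΩ ha hab hbT
    (sol.flux_w T hT).neg hQ (sol.source T hT)
    (ψ := fun z => θ (w z.1 z.2)) (hθ.comp_aestronglyMeasurable (sol.aestronglyMeasurable_w T))
    (.of_forall fun _ => hM _)
    (k := fun t => ∫ x in Ω, ∫ y in (0 : ℝ)..w t x, θ y) (hΘ.mono Ioi_subset_Ici_self) ?_
  · rw [key, ← Measure.volume_eq_prod]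
    simp only [Pi.neg_apply, inner_neg_left]
  · filter_upwards [hwQ, ae_restrict_mem measurableSet_Ioc] with s hs hsT r hr
    have hφ : ∃ M : ℝ, ∀ᵐ x ∂(volume.restrict Ω), |θ (w s x)| ≤ M := ⟨M, .of_forall fun _ => hM _⟩
    have e1 := sol.eq_w _ _ hs hφ r hr.1.le
    have e2 := sol.eq_w _ _ hs hφ s hsT.1.le
    have e3 := intervalIntegral_sub_eq_of_flux (sol.flux_w T hT).neg (sol.source T hT)
      hs.memLp_grad hs.memLp.1 (.of_forall fun _ => hM _) ⟨hr.1.le, hr.2.le⟩ ⟨hsT.1.le, hsT.2⟩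
    rw [← e3]
    simp only [Pi.neg_apply, inner_neg_left]
    rw [← e1, ← e2, sub_sub_sub_cancel_right]
    have hi : ∀ t, 0 ≤ t → Integrable (fun x => w t x * θ (w s x)) (volume.restrict Ω) :=
      fun t ht => (sol.w_integrable t ht).mul_bdd hs.memLp.1 (.of_forall fun _ => hM _)
    rw [← integral_sub (hi r hr.1.le) (hi s hsT.1.le),
      ← integral_sub (hΘi r hr.1.le) (hΘi s hsT.1.le)]
    refine integral_mono ((hi r hr.1.le).sub (hi s hsT.1.le))
      ((hΘi r hr.1.le).sub (hΘi s hsT.1.le)) fun x => ?_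
    have := hm.mul_sub_le_integral_sub hθ (w s x) (w r x)
    dsimp only [Pi.sub_apply]
    linarith

/-- The energy identity: the equation for `v` may be tested with `v` itself. -/
theorem integral_sq_v_sub (sol : IsWeakSolutionWith Ω η κ v w Gv Gp) (hΩ : MeasurableSet Ω)
    {a b T : ℝ} (ha : 0 < a) (hab : a ≤ b) (hbT : b < T)
    (hG : MemLp (fun p : ℝ × EuclideanSpace ℝ (Fin d) => Gv p.1 p.2) 2
      ((volume.restrict (Ioc 0 T)).prod (volume.restrict Ω)))
    (hvG : ∀ᵐ s ∂(volume.restrict (Ioc 0 T)), MemSobolevH1 Ω (v s) (Gv s)) :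
    (∫ x in Ω, v b x ^ 2) - ∫ x in Ω, v a x ^ 2
      = -(2 * ∫ z in Ioc a b ×ˢ Ω, η (w z.1 z.2) * ‖Gv z.1 z.2‖ ^ 2) := by
  have hT : 0 < T := by linarith
  have hk := continuousOn_integral_sq (S := Ici 0) (fun t ht => sol.v_memLp t ht)
    (fun s hs => sol.v_continuous s hs)
  have key := sub_eq_setIntegral_of_increment_le (m := volume) (T := T) (M := 0) hΩ ha hab hbT
    (sol.flux_v T hT).neg hG (integrable_zero _ _ _) (ψ := fun _ => 0)
    aestronglyMeasurable_const (.of_forall fun _ => by simp)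
    (k := fun t => (1 / 2) * ∫ x in Ω, v t x ^ 2)
    ((hk.mono Ioi_subset_Ici_self).const_smul (1 / 2 : ℝ)) ?_
  · simp only [Pi.neg_apply, inner_neg_left, real_inner_smul_left, real_inner_self_eq_norm_sq,
      mul_zero, add_zero, ← Measure.volume_eq_prod, integral_neg] at key
    linarith
  · filter_upwards [hvG, ae_restrict_mem measurableSet_Ioc] with s hs hsT r hr
    have e1 := sol.eq_v _ _ hs r hr.1.le
    have e2 := sol.eq_v _ _ hs s hsT.1.le
    have e3 := intervalIntegral_sub_eq_of_flux (M := 0) (sol.flux_v T hT).neg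
      (integrable_zero _ _ _) hs.memLp_grad (φ := fun _ => 0) aestronglyMeasurable_const
      (.of_forall fun _ => by simp) ⟨hr.1.le, hr.2.le⟩ ⟨hsT.1.le, hsT.2⟩
    rw [← e3]
    simp only [Pi.neg_apply, inner_neg_left, real_inner_smul_left, mul_zero, add_zero,
      integral_neg, intervalIntegral.integral_neg]
    rw [← e1, ← e2, sub_sub_sub_cancel_right]
    have hi : ∀ t, 0 ≤ t → Integrable (fun x => v t x * v s x) (volume.restrict Ω) :=
      fun t ht => (sol.v_memLp t ht).integrable_mul (sol.v_memLp s hsT.1.le)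
    have hi2 : ∀ t, 0 ≤ t → Integrable (fun x => 1 / 2 * v t x ^ 2) (volume.restrict Ω) :=
      fun t ht => (sol.v_memLp t ht).integrable_sq.const_mul _
    rw [← integral_sub (hi r hr.1.le) (hi s hsT.1.le), ← integral_const_mul, ← integral_const_mul,
      ← integral_sub (hi2 r hr.1.le) (hi2 s hsT.1.le)]
    refine integral_mono ((hi r hr.1.le).sub (hi s hsT.1.le))
      ((hi2 r hr.1.le).sub (hi2 s hsT.1.le)) fun x => ?_
    dsimp only [Pi.sub_apply]
    nlinarith [sq_nonneg (v r x - v s x)]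

end IsWeakSolutionWith

end

/-! ### The minimum principle and the conservation laws -/

section

variable {d : ℕ} {Ω : Set (EuclideanSpace ℝ (Fin d))}

theorem pressure_zero (κ : ℝ → ℝ) : pressure κ 0 = 0 := by simp [pressure]

theorem pressure_lt_pressure {κ : ℝ → ℝ} (hκ : ContinuousOn κ (Ici 0)) (hpos : ∀ s, 0 < s → 0 < κ s)
    {x y : ℝ} (hx : 0 ≤ x) (hxy : x < y) : pressure κ x < pressure κ y := by
  rw [pressure_eq_of_le hκ hx hxy.le]
  have := intervalIntegral.intervalIntegral_pos_of_pos_on (f := fun s => κ (max s x))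
    ((continuous_comp_max_of_continuousOn (hκ.mono (Ici_subset_Ici.2 hx))).intervalIntegrable _ _)
    (fun s hs => hpos _ (hx.trans_lt (lt_max_of_lt_left hs.1))) hxy
  linarith

theorem continuous_pressure_max {κ : ℝ → ℝ} (hκ : ContinuousOn κ (Ici 0)) :
    Continuous fun y => pressure κ (max y 0) := by
  have h : (fun y => pressure κ (max y 0)) = fun y => ∫ s in (0 : ℝ)..max y 0, κ (max s 0) := by
    funext y
    rw [pressure_eq_of_le hκ le_rfl (le_max_right y 0), pressure_zero, zero_add]
  rw [h]
  have h1 : Continuous fun y => ∫ s in (0 : ℝ)..y, κ (max s 0) :=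
    continuous_iff_continuousAt.2 fun y => (hasDerivAt_integral_of_continuous
      (continuous_comp_max_of_continuousOn hκ) 0 y).continuousAt
  exact h1.comp (by fun_prop : Continuous fun y : ℝ => max y 0)

/-- A `C¹` Lipschitz monotone function which is negative to the left of `p₀` and vanishes to the
right of it. -/
theorem exists_hasDerivAt_truncation (p₀ : ℝ) : ∃ β β' : ℝ → ℝ,
    (∀ s, HasDerivAt β (β' s) s) ∧ Continuous β' ∧ (∀ s, 0 ≤ β' s) ∧ (∀ s, β' s ≤ 1) ∧
      (∀ s, p₀ ≤ s → β s = 0) ∧ ∀ s, s < p₀ → β s < 0 := by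
  have hc : Continuous fun s : ℝ => min 1 (max (p₀ - s) 0) := by fun_prop
  refine ⟨fun p => ∫ s in p₀..p, min 1 (max (p₀ - s) 0), fun s => min 1 (max (p₀ - s) 0),
    fun s => hasDerivAt_integral_of_continuous hc p₀ s, hc,
    fun s => le_min zero_le_one (le_max_right _ _), fun s => min_le_left _ _, fun s hs => ?_,
    fun s hs => ?_⟩
  · have : ∫ t in p₀..s, min 1 (max (p₀ - t) 0) = ∫ t in p₀..s, (0 : ℝ) := by
      refine intervalIntegral.integral_congr fun t ht => ?_
      rw [uIcc_of_le hs] at ht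
      rw [max_eq_right (by linarith [ht.1]), min_eq_right zero_le_one]
    simp only [this, intervalIntegral.integral_zero]
  · have := intervalIntegral.intervalIntegral_pos_of_pos_on (f := fun s => min 1 (max (p₀ - s) 0))
      (hc.intervalIntegrable _ _)
      (fun t ht => lt_min one_pos (lt_max_of_lt_left (by linarith [ht.2]))) hs
    simp only
    rw [intervalIntegral.integral_symm]
    linarith

theorem MemLp.ae_slice {α β F : Type*} [MeasurableSpace α] [MeasurableSpace β]
    [NormedAddCommGroup F] {μ : Measure α} {ν : Measure β} [SFinite μ] [SFinite ν] {f : α × β → F}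
    (hf : MemLp f 2 (μ.prod ν)) : ∀ᵐ a ∂μ, MemLp (fun b => f (a, b)) 2 ν := by
  have h1 := ((memLp_two_iff_integrable_sq_norm hf.1).1 hf).prod_right_ae
  filter_upwards [h1, hf.1.prodMk_left] with a ha hb
  exact (memLp_two_iff_integrable_sq_norm hb).2 ha

theorem restrict_Ioc_prod_le {X : Type*} [MeasureSpace X] [SFinite (volume : Measure X)]
    (Ω : Set X) {a b T : ℝ}
    (ha : 0 ≤ a) (hbT : b ≤ T) : (volume : Measure (ℝ × X)).restrict (Ioc a b ×ˢ Ω)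
      ≤ (volume.restrict (Ioc 0 T)).prod (volume.restrict Ω) := by
  rw [Measure.volume_eq_prod, ← Measure.prod_restrict]
  exact Measure.prod_mono (Measure.restrict_mono (Ioc_subset_Ioc ha hbT) le_rfl) le_rfl

variable {η κ : ℝ → ℝ} {v w : ℝ → EuclideanSpace ℝ (Fin d) → ℝ}
  {Gv Gp : ℝ → EuclideanSpace ℝ (Fin d) → EuclideanSpace ℝ (Fin d)}

theorem le_of_continuousOn_of_forall_pos_le {f : ℝ → ℝ} (hf : ContinuousOn f (Ici 0)) {b C : ℝ}
    (hb : 0 < b) (h : ∀ a, 0 < a → a ≤ b → C ≤ f a) : C ≤ f 0 := by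
  have h1 : Tendsto f (𝓝[>] 0) (𝓝 (f 0)) :=
    (hf 0 self_mem_Ici).mono_left (nhdsWithin_mono _ Ioi_subset_Ici_self)
  refine ge_of_tendsto h1 ?_
  filter_upwards [Ioc_mem_nhdsGT hb] with a ha using h a ha.1 ha.2

namespace IsWeakSolutionWith

theorem ae_le_w_prod (sol : IsWeakSolutionWith Ω η κ v w Gv Gp) {c : ℝ}
    (h : ∀ t, 0 ≤ t → ∀ᵐ x ∂(volume.restrict Ω), c ≤ w t x) (T : ℝ) :
    ∀ᵐ z ∂((volume.restrict (Ioc 0 T)).prod (volume.restrict Ω)), c ≤ w z.1 z.2 := by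
  refine ae_le_prod_of_ae_ae (sol.aestronglyMeasurable_w T) ?_
  filter_upwards [ae_restrict_mem measurableSet_Ioc] with s hs using h s hs.1.le

/-- The minimum principle: the heat source is nonnegative, so `w` stays above its initial lower
bound. The equation is tested with a truncation of the pressure. -/
theorem le_w (sol : IsWeakSolutionWith Ω η κ v w Gv Gp) (hΩ : IsOpen Ω) (hv : volume Ω ≠ ⊤)
    (hη : ∀ s, 0 ≤ s → 0 ≤ η s) (hκ : ContinuousOn κ (Ici 0)) (hpos : ∀ s, 0 < s → 0 < κ s)
    {c : ℝ} (hc : 0 < c) (h0 : ∀ᵐ x ∂(volume.restrict Ω), c ≤ w 0 x) {t : ℝ} (ht : 0 ≤ t) :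
    ∀ᵐ x ∂(volume.restrict Ω), c ≤ w t x := by
  have : IsFiniteMeasure (volume.restrict Ω) := ⟨by simpa using hv.lt_top⟩
  rcases ht.eq_or_lt with rfl | ht
  · exact h0
  have hsm : ∀ x y, 0 ≤ x → x ≤ y → pressure κ x ≤ pressure κ y := fun x y hx hxy => by
    rcases hxy.eq_or_lt with rfl | h
    · rfl
    · exact (pressure_lt_pressure hκ hpos hx h).le
  obtain ⟨β, β', hβ, hβc, hβ0, hβ1, hβr, hβl⟩ := exists_hasDerivAt_truncation (pressure κ c)
  have hβm : Monotone β := monotone_of_hasDerivAt_nonneg hβ hβ0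
  have hβn : ∀ s, β s ≤ 0 := fun s => by
    rcases le_or_gt (pressure κ c) s with h | h
    · exact (hβr s h).le
    · exact (hβl s h).le
  have hβcont : Continuous β := continuous_iff_continuousAt.2 fun s => (hβ s).continuousAt
  set θ : ℝ → ℝ := fun y => β (pressure κ (max y 0)) with hθ
  have hθc : Continuous θ := hβcont.comp (continuous_pressure_max hκ)
  have hθm : Monotone θ := fun x y hxy =>
    hβm (hsm _ _ (le_max_right _ _) (max_le_max hxy le_rfl))
  have hθn : ∀ y, θ y ≤ 0 := fun y => hβn _
  have hθM : ∀ y, |θ y| ≤ -β 0 := fun y => by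
    rw [abs_of_nonpos (hθn y), neg_le_neg_iff]
    refine hβm ?_
    exact (pressure_zero κ).symm.trans_le (hsm _ _ le_rfl (le_max_right _ _))
  have hθr : ∀ y, c ≤ y → θ y = 0 := fun y hy => hβr _ (hsm _ _ hc.le (le_max_of_le_left hy))
  have hθl : ∀ y, y < c → θ y < 0 := fun y hy =>
    hβl _ (pressure_lt_pressure hκ hpos (le_max_right _ _) (max_lt hy hc))
  set Θ : ℝ → ℝ := fun y => ∫ s in (0 : ℝ)..y, θ s with hΘ
  have hΘc : Continuous Θ :=
    continuous_iff_continuousAt.2 fun y => (hasDerivAt_integral_of_continuous hθc 0 y).continuousAt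
  have hΘsub : ∀ x y, Θ y - Θ x = ∫ s in x..y, θ s := fun x y =>
    intervalIntegral.integral_interval_sub_left (hθc.intervalIntegrable _ _)
      (hθc.intervalIntegrable _ _)
  have hΘr : ∀ y, c ≤ y → Θ y = Θ c := fun y hy => by
    rw [← sub_eq_zero, hΘsub]
    rw [intervalIntegral.integral_congr (g := fun _ => 0) fun s hs => ?_,
      intervalIntegral.integral_zero]
    rw [uIcc_of_le hy] at hs
    exact hθr s hs.1
  have hΘl : ∀ y, y < c → Θ c < Θ y := fun y hy => by
    have := intervalIntegral.intervalIntegral_pos_of_pos_on (f := fun s => -θ s)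
      (hθc.neg.intervalIntegrable _ _) (fun s hs => neg_pos.2 (hθl s hs.2)) hy
    rw [intervalIntegral.integral_neg, ← hΘsub] at this
    linarith
  have hΘge : ∀ y, Θ c ≤ Θ y := fun y => by
    rcases le_or_gt c y with h | h
    · exact (hΘr y h).ge
    · exact (hΘl y h).le
  obtain ⟨hi, hcont⟩ := continuousOn_integral_comp_of_lipschitz (S := Ici 0)
    (fun t ht => sol.w_integrable t ht) (fun s hs => sol.w_continuous s hs)
    hΘc (abs_integral_sub_integral_le hθc hθM)
  have hdec : ∀ a, 0 < a → a ≤ t → ∫ x in Ω, Θ (w t x) ≤ ∫ x in Ω, Θ (w a x) := by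
    intro a ha hat
    have hT : 0 < t + 1 := by linarith
    have hQm : AEStronglyMeasurable (fun z : ℝ × EuclideanSpace ℝ (Fin d) =>
        β' (pressure κ (max (w z.1 z.2) 0)))
        ((volume.restrict (Ioc 0 (t + 1))).prod (volume.restrict Ω)) :=
      (hβc.comp (continuous_pressure_max hκ)).comp_aestronglyMeasurable
        (sol.aestronglyMeasurable_w (t + 1))
    have hQ : MemLp (fun z : ℝ × EuclideanSpace ℝ (Fin d) =>
        β' (pressure κ (max (w z.1 z.2) 0)) • Gp z.1 z.2) 2
        ((volume.restrict (Ioc 0 (t + 1))).prod (volume.restrict Ω)) := by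
      refine (sol.flux_w _ hT).mono (hQm.smul (sol.flux_w _ hT).1) (.of_forall fun z => ?_)
      rw [norm_smul, Real.norm_eq_abs, abs_of_nonneg (hβ0 _)]
      exact mul_le_of_le_one_left (norm_nonneg _) (hβ1 _)
    have key := sol.integral_comp_w_sub hΩ.measurableSet hv hθc hθm hθM ha hat
      (lt_add_one t) hQ ?_
    · rw [← sub_nonpos]
      refine key.trans_le (integral_nonpos_of_ae ?_)
      filter_upwards [ae_mono (restrict_Ioc_prod_le Ω ha.le (by linarith : t ≤ t + 1))
        (sol.ae_le_w_prod sol.w_nonneg (t + 1))] with z hz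
      simp only [real_inner_smul_right, real_inner_self_eq_norm_sq, Pi.zero_apply]
      have h1 := mul_nonneg (hβ0 (pressure κ (max (w z.1 z.2) 0))) (sq_nonneg ‖Gp z.1 z.2‖)
      have h2 := mul_nonpos_of_nonneg_of_nonpos
        (mul_nonneg (hη _ hz) (sq_nonneg ‖Gv z.1 z.2‖)) (hθn (w z.1 z.2))
      linarith
    · filter_upwards [MemLp.ae_slice hQ, ae_restrict_of_ae_restrict_of_subset Ioc_subset_Ioi_self
        sol.grad_pressure, ae_restrict_mem measurableSet_Ioc] with s hs hgs hsT
      have hws := sol.w_nonneg s hsT.1.le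
      refine ⟨?_, hs, ?_⟩
      · exact MemLp.of_bound (hθc.comp_aestronglyMeasurable (sol.w_integrable s hsT.1.le).1)
          (-β 0) (.of_forall fun x => hθM _)
      · refine (hgs.comp hΩ hβ hβc (M := 1) fun s => ?_).congr ?_ ?_
        · rw [abs_of_nonneg (hβ0 s)]
          exact hβ1 s
        · filter_upwards [hws] with x hx
          simp only [hθ, max_eq_left hx]
        · filter_upwards [hws] with x hx
          simp only [max_eq_left hx]
  have hle := le_of_continuousOn_of_forall_pos_le hcont ht hdec
  have h0' : ∫ x in Ω, Θ (w 0 x) = ∫ x in Ω, Θ c := by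
    refine integral_congr_ae ?_
    filter_upwards [h0] with x hx using hΘr _ hx
  -- `Θ` attains its minimum exactly on `[c, ∞)`, and `∫ Θ(w)` does not exceed `|Ω| Θ(c)`
  have hzero : (fun x => Θ (w t x) - Θ c) =ᵐ[volume.restrict Ω] 0 := by
    refine (integral_eq_zero_iff_of_nonneg (fun x => sub_nonneg.2 (hΘge _))
      ((hi t ht.le).sub (integrable_const _))).1 (le_antisymm ?_ ?_)
    · rw [integral_sub (hi t ht.le) (integrable_const _)]
      linarith
    · exact integral_nonneg fun x => sub_nonneg.2 (hΘge _)
  filter_upwards [hzero] with x hx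
  by_contra! hlt
  exact absurd hx (sub_pos.2 (hΘl _ hlt)).ne'

/-- Where `w` is bounded below the viscosity is nondegenerate, and the integrability of the heat
source bounds `∇v`. -/
theorem memLp_Gv (sol : IsWeakSolutionWith Ω η κ v w Gv Gp) {c e : ℝ}
    (hcw : ∀ t, 0 ≤ t → ∀ᵐ x ∂(volume.restrict Ω), c ≤ w t x) (he : 0 < e)
    (hη : ∀ s, c ≤ s → e ≤ η s) {T : ℝ} (hT : 0 < T) :
    MemLp (fun p : ℝ × EuclideanSpace ℝ (Fin d) => Gv p.1 p.2) 2
      ((volume.restrict (Ioc 0 T)).prod (volume.restrict Ω)) := by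
  refine (memLp_two_iff_integrable_sq_norm (sol.aestronglyMeasurable_Gv T)).2 ?_
  refine ((sol.source T hT).const_mul e⁻¹).mono'
    ((sol.aestronglyMeasurable_Gv T).norm.pow 2) ?_
  filter_upwards [sol.ae_le_w_prod hcw T] with z hz
  have h1 := mul_le_mul_of_nonneg_right (hη _ hz) (sq_nonneg ‖Gv z.1 z.2‖)
  rw [Real.norm_of_nonneg (sq_nonneg _), ← div_eq_inv_mul, le_div_iff₀ he]
  linarith

theorem memSobolevH1_v (sol : IsWeakSolutionWith Ω η κ v w Gv Gp) {T : ℝ}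
    (hG : MemLp (fun p : ℝ × EuclideanSpace ℝ (Fin d) => Gv p.1 p.2) 2
      ((volume.restrict (Ioc 0 T)).prod (volume.restrict Ω))) :
    ∀ᵐ s ∂(volume.restrict (Ioc 0 T)), MemSobolevH1 Ω (v s) (Gv s) := by
  filter_upwards [MemLp.ae_slice hG, ae_restrict_of_ae_restrict_of_subset Ioc_subset_Ioi_self
    sol.grad_v, ae_restrict_mem measurableSet_Ioc] with s hs hgs hsT
  exact ⟨sol.v_memLp s hsT.1.le, hs, hgs⟩

theorem momentum_eq (sol : IsWeakSolutionWith Ω η κ v w Gv Gp)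
    (hv : volume Ω ≠ ⊤) {t : ℝ} (ht : 0 ≤ t) : momentum Ω (v t) = momentum Ω (v 0) := by
  have := sol.eq_v _ _ (memSobolevH1_const hv 1) t ht
  simpa [momentum, sub_eq_zero] using this

/-- Conservation of the total energy: the dissipated kinetic energy reappears as heat. -/
theorem energy_eq (sol : IsWeakSolutionWith Ω η κ v w Gv Gp) (hΩ : IsOpen Ω)
    (hv : volume Ω ≠ ⊤) {c e : ℝ}
    (hcw : ∀ t, 0 ≤ t → ∀ᵐ x ∂(volume.restrict Ω), c ≤ w t x) (he : 0 < e)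
    (hη : ∀ s, c ≤ s → e ≤ η s) {t : ℝ} (ht : 0 ≤ t) :
    energy Ω (v t) (w t) = energy Ω (v 0) (w 0) := by
  have : IsFiniteMeasure (volume.restrict Ω) := ⟨by simpa using hv.lt_top⟩
  have hE : ∀ t, 0 ≤ t → energy Ω (v t) (w t)
      = (1 / 2) * (∫ x in Ω, v t x ^ 2) + ∫ x in Ω, w t x := fun t ht => by
    rw [energy, integral_add ((sol.v_memLp t ht).integrable_sq.const_mul _)
      (sol.w_integrable t ht), integral_const_mul]
  have hpos : ∀ a b, 0 < a → a ≤ b → energy Ω (v b) (w b) = energy Ω (v a) (w a) := by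
    intro a b ha hab
    have hG := sol.memLp_Gv hcw he hη (by linarith : 0 < b + 1)
    have h1 := sol.integral_sq_v_sub hΩ.measurableSet ha hab (lt_add_one b) hG
      (sol.memSobolevH1_v hG)
    -- with `θ = 1` this is the balance of `∫ w`
    have h2 := sol.integral_comp_w_sub hΩ.measurableSet hv (θ := fun _ => 1) continuous_const
      monotone_const (M := 1) (by simp) ha hab (lt_add_one b) (Q := fun _ => 0)
      (MemLp.zero' ) (.of_forall fun s => memSobolevH1_const hv 1)
    simp only [intervalIntegral.integral_const, sub_zero, smul_eq_mul, mul_one, inner_zero_right,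
      neg_zero, zero_add] at h2
    rw [hE a ha.le, hE b (ha.le.trans hab)]
    linarith
  have hcont : ContinuousOn (fun t => energy Ω (v t) (w t)) (Ici 0) := by
    have h1 := continuousOn_integral_sq (S := Ici 0) (fun t ht => sol.v_memLp t ht)
      (fun s hs => sol.v_continuous s hs)
    have h2 := (continuousOn_integral_comp_of_lipschitz (S := Ici 0) (f := fun y => y) (M := 1)
      (fun t ht => sol.w_integrable t ht) (fun s hs => sol.w_continuous s hs) continuous_id
      (by simp)).2
    exact ((h1.const_smul (1 / 2 : ℝ)).add h2).congr hE
  rcases ht.eq_or_lt with rfl | ht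
  · rfl
  refine le_antisymm ?_ ?_
  · exact le_of_continuousOn_of_forall_pos_le hcont ht fun a ha hat => (hpos a t ha hat).le
  · have := le_of_continuousOn_of_forall_pos_le hcont.neg ht (C := -energy Ω (v t) (w t))
      fun a ha hat => neg_le_neg (hpos a t ha hat).ge
    exact neg_le_neg_iff.1 this

end IsWeakSolutionWith

end

/-! ### The entropy inequality -/

section

variable {d : ℕ} {Ω : Set (EuclideanSpace ℝ (Fin d))}

theorem memLp_sqrt {α : Type*} [MeasurableSpace α] {μ : Measure α} {f : α → ℝ}
    (hf : Integrable f μ) (h0 : ∀ᵐ x ∂μ, 0 ≤ f x) : MemLp (fun x => √(f x)) 2 μ := by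
  refine (memLp_two_iff_integrable_sq (Real.continuous_sqrt.comp_aestronglyMeasurable hf.1)).2 ?_
  refine hf.congr ?_
  filter_upwards [h0] with x hx
  rw [Real.sq_sqrt hx]

theorem integral_sq_sqrt {α : Type*} [MeasurableSpace α] {μ : Measure α} {f : α → ℝ}
    (h0 : ∀ᵐ x ∂μ, 0 ≤ f x) : ∫ x, √(f x) ^ 2 ∂μ = ∫ x, f x ∂μ := by
  refine integral_congr_ae ?_
  filter_upwards [h0] with x hx
  rw [Real.sq_sqrt hx]

theorem hasDerivAt_neg_inv_sqrt {y : ℝ} (hy : 0 < y) :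
    HasDerivAt (fun y => -(√y)⁻¹) (2 * √y * y)⁻¹ y := by
  have hs := Real.sqrt_pos.2 hy
  have h := ((Real.hasDerivAt_sqrt hy.ne').inv hs.ne').neg
  refine h.congr_deriv ?_
  rw [Real.sq_sqrt hy.le]
  field_simp

theorem continuous_neg_inv_sqrt_max {c : ℝ} (hc : 0 < c) :
    Continuous fun y => -(√(max y c))⁻¹ :=
  ((Real.continuous_sqrt.comp (by fun_prop : Continuous fun y : ℝ => max y c)).inv₀
    fun y => (Real.sqrt_pos.2 (hc.trans_le (le_max_right y c))).ne').neg

theorem integral_neg_inv_sqrt_max {c y : ℝ} (hc : 0 < c) (hy : c ≤ y) :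
    ∫ s in (0 : ℝ)..y, -(√(max s c))⁻¹
      = (∫ s in (0 : ℝ)..c, -(√(max s c))⁻¹) + 2 * √c - 2 * √y := by
  have hi := continuous_neg_inv_sqrt_max hc
  rw [← intervalIntegral.integral_add_adjacent_intervals (hi.intervalIntegrable 0 c)
    (hi.intervalIntegrable c y), intervalIntegral.integral_eq_sub_of_hasDerivAt
    (a := c) (b := y) (f := fun y => -(2 * √y)) (fun s hs => ?_) (hi.intervalIntegrable c y)]
  · ring
  · rw [uIcc_of_le hy] at hs
    have hs0 := hc.trans_le hs.1
    have h := ((Real.hasDerivAt_sqrt hs0.ne').const_mul 2).neg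
    refine h.congr_deriv ?_
    rw [max_eq_left hs.1]
    have := Real.sqrt_pos.2 hs0
    field_simp

variable {η κ : ℝ → ℝ} {v w : ℝ → EuclideanSpace ℝ (Fin d) → ℝ}
  {Gv Gp : ℝ → EuclideanSpace ℝ (Fin d) → EuclideanSpace ℝ (Fin d)}

namespace IsWeakSolutionWith

/-- The formal gradient `G'(w)∇w` of `G(w)`, written in terms of `∇Π(w) = κ(w)∇w`. -/
theorem memLp_comp_smul_Gp (sol : IsWeakSolutionWith Ω η κ v w Gv Gp) {c k M : ℝ}
    (hcw : ∀ t, 0 ≤ t → ∀ᵐ x ∂(volume.restrict Ω), c ≤ w t x)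
    (hκ : ContinuousOn κ (Ici c)) (hk : 0 < k) (hκk : ∀ y, c ≤ y → k ≤ κ y)
    {G' : ℝ → ℝ} (hG' : ContinuousOn G' (Ici c)) (hM : ∀ y, c ≤ y → |G' y| ≤ M) {T : ℝ}
    (hT : 0 < T) :
    MemLp (fun z : ℝ × EuclideanSpace ℝ (Fin d) =>
      (G' (w z.1 z.2) / κ (w z.1 z.2)) • Gp z.1 z.2) 2
      ((volume.restrict (Ioc 0 T)).prod (volume.restrict Ω)) := by
  have hcw' := sol.ae_le_w_prod hcw T
  have hm : AEStronglyMeasurable (fun z : ℝ × EuclideanSpace ℝ (Fin d) =>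
      G' (w z.1 z.2) / κ (w z.1 z.2))
      ((volume.restrict (Ioc 0 T)).prod (volume.restrict Ω)) := by
    have h1 : ContinuousOn (fun y => G' y / κ y) (Ici c) :=
      hG'.div hκ fun y hy => (hk.trans_le (hκk y hy)).ne'
    refine ((continuous_comp_max_of_continuousOn h1).comp_aestronglyMeasurable
      (sol.aestronglyMeasurable_w T)).congr ?_
    filter_upwards [hcw'] with z hz
    simp only [max_eq_left hz]
  refine (sol.flux_w T hT).of_le_mul (c := M / k) (hm.smul (sol.flux_w T hT).1) ?_
  filter_upwards [hcw'] with z hz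
  rw [norm_smul, Real.norm_eq_abs, abs_div, abs_of_pos (hk.trans_le (hκk _ hz))]
  have hM0 := (abs_nonneg _).trans (hM _ hz)
  have h1 := hM _ hz
  have h2 := hκk _ hz
  gcongr

theorem memSobolevH1_comp_w (sol : IsWeakSolutionWith Ω η κ v w Gv Gp) (hΩ : IsOpen Ω) {c k M : ℝ}
    (hcw : ∀ t, 0 ≤ t → ∀ᵐ x ∂(volume.restrict Ω), c ≤ w t x) (hc : 0 ≤ c)
    (hκ : ContinuousOn κ (Ici 0)) (hk : 0 < k) (hκk : ∀ y, c ≤ y → k ≤ κ y)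
    {G G' : ℝ → ℝ} (hG : ∀ y, c ≤ y → HasDerivAt G (G' y) y)
    (hG' : ContinuousOn G' (Ici c)) (hM : ∀ y, c ≤ y → |G' y| ≤ M)
    (hGw : ∀ t, 0 ≤ t → MemLp (fun x => G (w t x)) 2 (volume.restrict Ω)) {T : ℝ} (hT : 0 < T) :
    ∀ᵐ s ∂(volume.restrict (Ioc 0 T)), MemSobolevH1 Ω (fun x => G (w s x))
      (fun x => (G' (w s x) / κ (w s x)) • Gp s x) := by
  filter_upwards [MemLp.ae_slice (sol.memLp_comp_smul_Gp hcw (hκ.mono (Ici_subset_Ici.2 hc)) hk hκk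
    hG' hM hT), ae_restrict_of_ae_restrict_of_subset Ioc_subset_Ioi_self sol.grad_pressure,
    ae_restrict_mem measurableSet_Ioc] with s hs hgs hsT
  exact ⟨hGw s hsT.1.le, hs, hgs.comp_of_pressure hΩ hκ hc hk hκk (hcw s hsT.1.le) hG hG' hM⟩

/-- `√w` is a Sobolev function at almost every time, with gradient `∇w / (2√w)`. -/
theorem memLp_grad_sqrt_w (sol : IsWeakSolutionWith Ω η κ v w Gv Gp) {c k : ℝ}
    (hcw : ∀ t, 0 ≤ t → ∀ᵐ x ∂(volume.restrict Ω), c ≤ w t x) (hc : 0 < c)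
    (hκ : ContinuousOn κ (Ici 0)) (hk : 0 < k) (hκk : ∀ y, c ≤ y → k ≤ κ y) {T : ℝ} (hT : 0 < T) :
    MemLp (fun z : ℝ × EuclideanSpace ℝ (Fin d) =>
      (1 / (2 * √(w z.1 z.2)) / κ (w z.1 z.2)) • Gp z.1 z.2) 2
      ((volume.restrict (Ioc 0 T)).prod (volume.restrict Ω)) ∧
    (IsOpen Ω → ∀ᵐ s ∂(volume.restrict (Ioc 0 T)), MemSobolevH1 Ω (fun x => √(w s x))
      (fun x => (1 / (2 * √(w s x)) / κ (w s x)) • Gp s x)) := by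
  have hG' : ContinuousOn (fun y => 1 / (2 * √y)) (Ici c) :=
    continuousOn_const.div (by fun_prop) fun y hy =>
      (mul_pos two_pos (Real.sqrt_pos.2 (hc.trans_le hy))).ne'
  have hM : ∀ y, c ≤ y → |1 / (2 * √y)| ≤ 1 / (2 * √c) := fun y hy => by
    rw [abs_of_nonneg (by positivity)]
    have := Real.sqrt_pos.2 hc
    gcongr
  exact ⟨sol.memLp_comp_smul_Gp hcw (hκ.mono (Ici_subset_Ici.2 hc.le)) hk hκk hG' hM hT,
    fun hΩ => sol.memSobolevH1_comp_w hΩ hcw hc.le hκ hk hκk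
      (fun y hy => Real.hasDerivAt_sqrt (hc.trans_le hy).ne') hG' hM
      (fun t ht => memLp_sqrt (sol.w_integrable t ht) (sol.w_nonneg t ht)) hT⟩

/-- The entropy inequality: testing the equation for `w` with `-1 / √w` bounds the dissipation by
the production of the entropy `∫ √w`. -/
theorem mul_integral_le_integral_sqrt_sub (sol : IsWeakSolutionWith Ω η κ v w Gv Gp)
    (hΩ : IsOpen Ω) (hv : volume Ω ≠ ⊤) (hκ : ContinuousOn κ (Ici 0)) {cη cκ : ℝ} (hcη : 0 < cη)
    (hcκ : 0 < cκ) (hη : ∀ s, 0 ≤ s → cη * √s ≤ η s) (hκl : ∀ s, 0 ≤ s → cκ * √s ≤ κ s) {c : ℝ}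
    (hc : 0 < c) (hcw : ∀ t, 0 ≤ t → ∀ᵐ x ∂(volume.restrict Ω), c ≤ w t x) {a b : ℝ} (ha : 0 < a)
    (hab : a ≤ b) :
    min cη cκ * ∫ z in Ioc a b ×ˢ Ω, ((1 / 2) * ‖Gv z.1 z.2‖ ^ 2
        + ‖(1 / (2 * √(w z.1 z.2)) / κ (w z.1 z.2)) • Gp z.1 z.2‖ ^ 2)
      ≤ (∫ x in Ω, √(w b x)) - ∫ x in Ω, √(w a x) := by
  have : IsFiniteMeasure (volume.restrict Ω) := ⟨by simpa using hv.lt_top⟩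
  have hT : 0 < b + 1 := by linarith
  have hsc := Real.sqrt_pos.2 hc
  have hk : 0 < cκ * √c := by positivity
  have hκk : ∀ y, c ≤ y → cκ * √c ≤ κ y := fun y hy => (hκl y (hc.le.trans hy)).trans' (by gcongr)
  have hηk : ∀ y, c ≤ y → cη * √c ≤ η y := fun y hy => (hη y (hc.le.trans hy)).trans' (by gcongr)
  have hG' : ContinuousOn (fun y => (2 * √y * y)⁻¹) (Ici c) :=
    ContinuousOn.inv₀ (by fun_prop) fun y hy => by
      have := hc.trans_le hy
      positivity
  have hM : ∀ y, c ≤ y → |(2 * √y * y)⁻¹| ≤ (2 * √c * c)⁻¹ := fun y hy => by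
    have := hc.trans_le hy
    rw [abs_of_nonneg (by positivity)]
    gcongr
  have hθM : ∀ y, |-(√(max y c))⁻¹| ≤ (√c)⁻¹ := fun y => by
    rw [abs_neg, abs_of_nonneg (by positivity)]
    gcongr
    exact le_max_right _ _
  have hθc := continuous_neg_inv_sqrt_max hc
  have hθm : Monotone fun y => -(√(max y c))⁻¹ := fun x y hxy => by
    have : 0 < √(max x c) := Real.sqrt_pos.2 (hc.trans_le (le_max_right _ _))
    dsimp only
    gcongr
  have hQ := sol.memLp_comp_smul_Gp hcw (hκ.mono (Ici_subset_Ici.2 hc.le)) hk hκk hG' hM hT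
  have hGw : ∀ t, 0 ≤ t → MemLp (fun x => -(√(w t x))⁻¹) 2 (volume.restrict Ω) := fun t ht => by
    refine MemLp.ae_eq ?_ (MemLp.of_bound
      (hθc.comp_aestronglyMeasurable (sol.w_integrable t ht).1) (√c)⁻¹ (.of_forall fun x => hθM _))
    filter_upwards [hcw t ht] with x hx
    simp only [max_eq_left hx]
  have hS := sol.memSobolevH1_comp_w hΩ hcw hc.le hκ hk hκk
    (fun y hy => hasDerivAt_neg_inv_sqrt (hc.trans_le hy)) hG' hM hGw hT
  have key := sol.integral_comp_w_sub hΩ.measurableSet hv hθc hθm hθM ha hab (lt_add_one b) hQ ?_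
  · have hΘ : ∀ t, 0 ≤ t → ∫ x in Ω, ∫ y in (0 : ℝ)..w t x, -(√(max y c))⁻¹
        = (∫ x in Ω, ((∫ s in (0 : ℝ)..c, -(√(max s c))⁻¹) + 2 * √c))
          - 2 * ∫ x in Ω, √(w t x) := fun t ht => by
      rw [← integral_const_mul, ← integral_sub (integrable_const _)
        (((memLp_sqrt (sol.w_integrable t ht) (sol.w_nonneg t ht)).integrable
          one_le_two).const_mul 2)]
      refine integral_congr_ae ?_
      filter_upwards [hcw t ht] with x hx using integral_neg_inv_sqrt_max hc hx
    rw [hΘ b (by linarith), hΘ a ha.le] at key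
    have hle := restrict_Ioc_prod_le Ω ha.le (by linarith : b ≤ b + 1)
    have hGv := sol.memLp_Gv hcw (by positivity : 0 < cη * √c) hηk hT
    have hR := (sol.memLp_grad_sqrt_w hcw hc hκ hk hκk hT).1
    have i1 : IntegrableOn (fun z : ℝ × EuclideanSpace ℝ (Fin d) => (1 / 2) * ‖Gv z.1 z.2‖ ^ 2
        + ‖(1 / (2 * √(w z.1 z.2)) / κ (w z.1 z.2)) • Gp z.1 z.2‖ ^ 2) (Ioc a b ×ˢ Ω) :=
      ((((memLp_two_iff_integrable_sq_norm hGv.1).1 hGv).const_mul (1 / 2)).add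
        ((memLp_two_iff_integrable_sq_norm hR.1).1 hR)).mono_measure hle
    have i2 : IntegrableOn (fun z : ℝ × EuclideanSpace ℝ (Fin d) => - inner ℝ (Gp z.1 z.2)
        (((2 * √(w z.1 z.2) * w z.1 z.2)⁻¹ / κ (w z.1 z.2)) • Gp z.1 z.2)
          + η (w z.1 z.2) * ‖Gv z.1 z.2‖ ^ 2 * -(√(max (w z.1 z.2) c))⁻¹) (Ioc a b ×ˢ Ω) := by
      refine Integrable.mono_measure ?_ hle
      exact (integrable_inner_of_memLp (p := 2) (q := 2) (sol.flux_w _ hT) hQ).neg.add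
        ((sol.source _ hT).mul_bdd (hθc.comp_aestronglyMeasurable
          (sol.aestronglyMeasurable_w _)) (.of_forall fun _ => hθM _))
    have hmono := setIntegral_mono_ae_restrict i2 (i1.const_mul (-(2 * min cη cκ))) ?_
    · rw [integral_const_mul] at hmono
      linarith
    · filter_upwards [ae_mono hle (sol.ae_le_w_prod hcw (b + 1))] with z hz
      have hw0 : 0 < w z.1 z.2 := hc.trans_le hz
      have hx := Real.sqrt_pos.2 hw0
      have hη' := hη _ hw0.le
      have hκ' := hκl _ hw0.le
      have hκ0 := hk.trans_le (hκk _ hz)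
      have hsq := Real.sq_sqrt hw0.le
      rw [max_eq_left hz, real_inner_smul_right, real_inner_self_eq_norm_sq, norm_smul, mul_pow,
        Real.norm_eq_abs, sq_abs]
      generalize √(w z.1 z.2) = x at *
      generalize κ (w z.1 z.2) = K at *
      generalize η (w z.1 z.2) = H at *
      rw [← hsq]
      have e1 : cη * ‖Gv z.1 z.2‖ ^ 2 ≤ H * ‖Gv z.1 z.2‖ ^ 2 * x⁻¹ := by
        rw [← div_eq_mul_inv, le_div_iff₀ hx]
        have := mul_le_mul_of_nonneg_right hη' (sq_nonneg ‖Gv z.1 z.2‖)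
        linarith
      have e2 : 2 * cκ * (1 / (2 * x) / K) ^ 2 ≤ (2 * x * x ^ 2)⁻¹ / K := by
        rw [div_pow, div_pow, ← sub_nonneg]
        have : (2 * x * x ^ 2)⁻¹ / K - 2 * cκ * (1 ^ 2 / (2 * x) ^ 2 / K ^ 2)
          = (K - cκ * x) / (2 * x ^ 3 * K ^ 2) := by
          field_simp
        rw [this]
        exact div_nonneg (sub_nonneg.2 hκ') (by positivity)
      have e3 := mul_le_mul_of_nonneg_right e2 (sq_nonneg ‖Gp z.1 z.2‖)
      have e4 := mul_le_mul_of_nonneg_right (min_le_left cη cκ) (sq_nonneg ‖Gv z.1 z.2‖)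
      have e5 := mul_le_mul_of_nonneg_right (min_le_right cη cκ)
        (mul_nonneg (sq_nonneg (1 / (2 * x) / K)) (sq_nonneg ‖Gp z.1 z.2‖))
      nlinarith
  · filter_upwards [hS, ae_restrict_mem measurableSet_Ioc] with s hs hsT
    have he : (fun x => -(√(w s x))⁻¹) =ᵐ[volume.restrict Ω] fun x => -(√(max (w s x) c))⁻¹ := by
      filter_upwards [hcw s hsT.1.le] with x hx
      rw [max_eq_left hx]
    exact ⟨hs.memLp.ae_eq he, hs.memLp_grad, hs.hasWeakGradient.congr he (ae_eq_refl _)⟩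

end IsWeakSolutionWith

end

/-! ### Convergence to equilibrium -/

section

variable {d : ℕ} {Ω : Set (EuclideanSpace ℝ (Fin d))}
  {g g' : EuclideanSpace ℝ (Fin d) → EuclideanSpace ℝ (Fin d)}

/-- Grönwall's inequality in integrated form, for positive times and a function continuous up to
time `0`. -/
theorem le_exp_mul_of_sub_le {H : ℝ → ℝ} (hH : ContinuousOn H (Ici 0)) {Λ : ℝ}
    (h : ∀ a b, 0 < a → a ≤ b → H b - H a ≤ -(Λ * ∫ s in a..b, H s)) {t : ℝ} (ht : 0 ≤ t) :
    H t ≤ Real.exp (-Λ * t) * H 0 := by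
  rcases ht.eq_or_lt with rfl | ht
  · simp
  set K : ℝ → ℝ := fun t => H (max t 0)
  have hK : Continuous K := continuous_comp_max_of_continuousOn hH
  have hKH : ∀ s, 0 ≤ s → K s = H s := fun s hs => by simp only [K, max_eq_left hs]
  have key : ∀ a, 0 < a → a ≤ t → H t ≤ H a * Real.exp (-Λ * (t - a)) := by
    intro a ha hat
    have hg := le_gronwallBound_of_liminf_deriv_right_le (f := K) (f' := fun s => -Λ * K s)
      (δ := H a) (K := -Λ) (ε := 0) (a := a) (b := t) hK.continuousOn ?_
      (hKH a ha.le).le (fun x _ => by simp) t ⟨hat, le_rfl⟩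
    · rwa [gronwallBound_ε0, hKH t ht.le] at hg
    · intro x hx r hr
      have hx0 : 0 < x := ha.trans_le hx.1
      have h1 : HasDerivAt (fun z => -Λ * ∫ s in x..z, K s) (-Λ * K x) x :=
        (hasDerivAt_integral_of_continuous hK x x).const_mul (-Λ)
      have h2 := hasDerivWithinAt_iff_tendsto_slope.1 (h1.hasDerivWithinAt (s := Ioi x))
      have h3 : Ioi x \ {x} = Ioi x := sdiff_singleton_eq_self self_notMem_Ioi
      rw [h3] at h2
      refine ((h2.eventually (gt_mem_nhds hr)).and self_mem_nhdsWithin).frequently.mono ?_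
      rintro z ⟨hz, hxz⟩
      refine lt_of_le_of_lt ?_ hz
      rw [slope_def_field, intervalIntegral.integral_same, mul_zero, sub_zero, inv_mul_eq_div]
      have hxz' : x < z := hxz
      have hi : ∫ s in x..z, K s = ∫ s in x..z, H s :=
        intervalIntegral.integral_congr fun s hs => by
          rw [uIcc_of_le hxz'.le] at hs
          exact hKH s (hx0.le.trans hs.1)
      have := h x z hx0 hxz'.le
      rw [hKH z (hx0.le.trans hxz'.le), hKH x hx0.le, hi]
      have h0 : 0 < z - x := sub_pos.2 hxz'
      gcongr
      linarith
  have hc : ContinuousOn (fun a => H a * Real.exp (-Λ * (t - a))) (Ici 0) :=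
    hH.mul (by fun_prop)
  have := le_of_continuousOn_of_forall_pos_le hc ht key
  rwa [sub_zero, mul_comm] at this

theorem integral_sub_const_sq {α : Type*} [MeasurableSpace α] {μ : Measure α}
    [IsFiniteMeasure μ] {f : α → ℝ} (hf : MemLp f 2 μ) (k : ℝ) :
    ∫ x, (f x - k) ^ 2 ∂μ = (∫ x, f x ^ 2 ∂μ) - 2 * k * (∫ x, f x ∂μ) + k ^ 2 * μ.real univ := by
  have h1 := hf.integrable one_le_two
  have h : ∀ x, (f x - k) ^ 2 = f x ^ 2 - 2 * k * f x + k ^ 2 := fun x => by ring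
  have h2 : Integrable (fun x => f x ^ 2 - 2 * k * f x) μ :=
    hf.integrable_sq.sub (h1.const_mul _)
  simp only [h]
  rw [integral_add h2 (integrable_const _),
    integral_sub hf.integrable_sq (h1.const_mul _), integral_const_mul, integral_const, smul_eq_mul]
  ring

section Equilibrium

variable {v w : EuclideanSpace ℝ (Fin d) → ℝ}

/-- `|Ω| ŵ` is the internal energy left after adding the kinetic energy relative to the mean
velocity. -/
theorem volume_mul_wHat (hv0 : 0 < volume.real Ω) (hv1 : volume Ω ≠ ⊤)
    (hv : MemLp v 2 (volume.restrict Ω)) (hw : Integrable w (volume.restrict Ω)) :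
    volume.real Ω * wHat Ω (momentum Ω v) (energy Ω v w)
      = (1 / 2) * (∫ x in Ω, (v x - vHat Ω (momentum Ω v)) ^ 2) + ∫ x in Ω, w x := by
  have : IsFiniteMeasure (volume.restrict Ω) := ⟨by simpa using hv1.lt_top⟩
  rw [integral_sub_const_sq hv, wHat, energy, vHat, measureReal_restrict_apply_univ,
    integral_add (hv.integrable_sq.const_mul _) hw, integral_const_mul,
    show ∫ x in Ω, v x = momentum Ω v from rfl]
  field_simp
  ring

/-- For given momentum and energy, the distance from equilibrium is an affine function of the
entropy `∫ √w`. -/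
theorem distEquilibrium_eq (hv0 : 0 < volume.real Ω) (hv1 : volume Ω ≠ ⊤)
    (hv : MemLp v 2 (volume.restrict Ω)) (hw : Integrable w (volume.restrict Ω))
    (hw0 : ∀ᵐ x ∂(volume.restrict Ω), 0 ≤ w x)
    (hE : 0 ≤ wHat Ω (momentum Ω v) (energy Ω v w)) :
    distEquilibrium Ω v w (vHat Ω (momentum Ω v)) (wHat Ω (momentum Ω v) (energy Ω v w))
      = 2 * volume.real Ω * wHat Ω (momentum Ω v) (energy Ω v w)
        - 2 * √(wHat Ω (momentum Ω v) (energy Ω v w)) * ∫ x in Ω, √(w x) := by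
  have : IsFiniteMeasure (volume.restrict Ω) := ⟨by simpa using hv1.lt_top⟩
  have hs := integral_sq_sqrt hw0
  have hsw := memLp_sqrt hw hw0
  have h1 := volume_mul_wHat hv0 hv1 hv hw
  have h2 := Real.sq_sqrt hE
  have i1 : ∀ k, Integrable (fun x => (1 / 2) * (v x - k) ^ 2) (volume.restrict Ω) := fun k =>
    (hv.sub (memLp_const k)).integrable_sq.const_mul _
  have i2 : ∀ k, Integrable (fun x => (√(w x) - k) ^ 2) (volume.restrict Ω) := fun k =>
    (hsw.sub (memLp_const k)).integrable_sq
  simp only [distEquilibrium, sq_abs]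
  rw [integral_add (i1 _) (i2 _), integral_const_mul, integral_sub_const_sq hsw,
    hs, h2, measureReal_restrict_apply_univ]
  linarith

/-- The Poincaré inequality bounds the distance from equilibrium by the dissipation. -/
theorem mul_distEquilibrium_le {l : ℝ} (hl : 0 ≤ l) (hΩ : IsOpen Ω)
    (hP : ∀ u g, MemSobolevH1 Ω u g → ∫ x in Ω, u x = 0 →
      l * ∫ x in Ω, u x ^ 2 ≤ ∫ x in Ω, ‖g x‖ ^ 2)
    (hv0 : 0 < volume.real Ω) (hv1 : volume Ω ≠ ⊤)
    (hw : Integrable w (volume.restrict Ω))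
    (hw0 : ∀ᵐ x ∂(volume.restrict Ω), 0 ≤ w x)
    (hE : 0 ≤ wHat Ω (momentum Ω v) (energy Ω v w))
    (hvg : MemSobolevH1 Ω v g) (hwg : MemSobolevH1 Ω (fun x => √(w x)) g') :
    l * distEquilibrium Ω v w (vHat Ω (momentum Ω v)) (wHat Ω (momentum Ω v) (energy Ω v w))
      ≤ 2 * ∫ x in Ω, ((1 / 2) * ‖g x‖ ^ 2 + ‖g' x‖ ^ 2) := by
  have : IsFiniteMeasure (volume.restrict Ω) := ⟨by simpa using hv1.lt_top⟩
  have hv0' : volume Ω ≠ 0 := fun h => by simp [Measure.real, h] at hv0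
  have hs := integral_sq_sqrt hw0
  have h1 := volume_mul_wHat hv0 hv1 hvg.memLp hw
  have h2 := Real.sq_sqrt hE
  have h3 := Real.sqrt_nonneg (wHat Ω (momentum Ω v) (energy Ω v w))
  have a1 := hvg.sub_mean hΩ hv1 hv0'
  have a2 := hwg.sub_mean hΩ hv1 hv0'
  have p1 := hP _ _ a1.1 a1.2
  have p2 := hP _ _ a2.1 a2.2
  rw [distEquilibrium_eq hv0 hv1 hvg.memLp hw hw0 hE,
    integral_add
      (((memLp_two_iff_integrable_sq_norm hvg.memLp_grad.1).1 hvg.memLp_grad).const_mul _)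
      ((memLp_two_iff_integrable_sq_norm hwg.memLp_grad.1).1 hwg.memLp_grad), integral_const_mul]
  have e1 := integral_sub_const_sq hwg.memLp ((∫ y in Ω, √(w y)) / volume.real Ω)
  rw [hs, measureReal_restrict_apply_univ] at e1
  rw [show ∫ x in Ω, v x = momentum Ω v from rfl, ← vHat] at p1
  have hJ : 0 ≤ ∫ y in Ω, √(w y) := integral_nonneg fun _ => Real.sqrt_nonneg _
  have n1 : 0 ≤ ∫ x in Ω, (v x - vHat Ω (momentum Ω v)) ^ 2 :=
    integral_nonneg fun _ => sq_nonneg _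
  have n2 : 0 ≤ ∫ x in Ω, (√(w x) - (∫ y in Ω, √(w y)) / volume.real Ω) ^ 2 :=
    integral_nonneg fun _ => sq_nonneg _
  generalize wHat Ω (momentum Ω v) (energy Ω v w) = W at *
  have e2 : ∃ m, 0 ≤ m ∧ ∫ y in Ω, √(w y) = m * volume.real Ω :=
    ⟨_, div_nonneg hJ hv0.le, (div_mul_cancel₀ _ hv0.ne').symm⟩
  obtain ⟨m, hm, hmJ⟩ := e2
  rw [hmJ, mul_div_cancel_right₀ _ hv0.ne'] at e1 p2 n2
  rw [hmJ]
  set D := ∫ x in Ω, (v x - vHat Ω (momentum Ω v)) ^ 2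
  set B := ∫ x in Ω, (√(w x) - m) ^ 2
  generalize √W = r at *
  -- the dissipation controls `|Ω| (r² - m²)`, and `r (r - m) ≤ (r + m) (r - m)`
  have hsum : (1 / 2) * D + B = volume.real Ω * (r ^ 2 - m ^ 2) := by
    rw [h2]; linarith
  have hrm : m ≤ r := by
    have : 0 ≤ r ^ 2 - m ^ 2 := by
      by_contra! hlt
      nlinarith
    nlinarith
  have hD : 2 * volume.real Ω * W - 2 * r * (m * volume.real Ω) ≤ 2 * ((1 / 2) * D + B) := by
    rw [hsum, ← h2]
    have := mul_nonneg (mul_nonneg hv0.le hm) (sub_nonneg.2 hrm)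
    nlinarith
  have := mul_le_mul_of_nonneg_left hD hl
  linarith

end Equilibrium

end

theorem theorem2p3 {d : ℕ} (hd : 0 < d)
    (Ω : Set (EuclideanSpace ℝ (Fin d))) (hΩ : IsBoundedLipschitzDomain Ω)
    (η κ : ℝ → ℝ) (hη_cont : ContinuousOn η (Ici 0)) (hκ_cont : ContinuousOn κ (Ici 0))
    (cη cκ : ℝ) (hcη : 0 < cη) (hcκ : 0 < cκ)
    (hη : ∀ s, 0 ≤ s → cη * Real.sqrt s ≤ η s)
    (hκ : ∀ s, 0 ≤ s → cκ * Real.sqrt s ≤ κ s) :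
    IsLeast (positiveNeumannEigenvalues Ω) (firstNeumannEigenvalue Ω) ∧
    ∀ (v w : ℝ → EuclideanSpace ℝ (Fin d) → ℝ), IsWeakSolution Ω η κ v w →
      ∀ V₀ E₀ : ℝ, momentum Ω (v 0) = V₀ → energy Ω (v 0) (w 0) = E₀ →
      (∃ c : ℝ, 0 < c ∧ ∀ᵐ x ∂(volume.restrict Ω), c ≤ w 0 x) →
        0 < Real.sqrt (wHat Ω V₀ E₀) * min cη cκ * firstNeumannEigenvalue Ω ∧
        ∀ t : ℝ, 0 ≤ t →
          distEquilibrium Ω (v t) (w t) (vHat Ω V₀) (wHat Ω V₀ E₀)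
            ≤ Real.exp (-(Real.sqrt (wHat Ω V₀ E₀) * min cη cκ * firstNeumannEigenvalue Ω) * t)
              * distEquilibrium Ω (v 0) (w 0) (vHat Ω V₀) (wHat Ω V₀ E₀) := by
  obtain ⟨l, hl, hleast, hP⟩ := hΩ.exists_firstNeumannEigenvalue hd
  have hfirst : firstNeumannEigenvalue Ω = l := hleast.csInf_eq
  rw [hfirst]
  refine ⟨hleast, ?_⟩
  rintro v w ⟨Gv, Gp, sol⟩ _ _ rfl rfl ⟨c, hc, hc0⟩
  have hv1 : volume Ω ≠ ⊤ := hΩ.volume_ne_top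
  have hv0 : 0 < volume.real Ω :=
    ENNReal.toReal_pos (hΩ.isOpen.measure_pos volume hΩ.isConnected.nonempty).ne' hv1
  have : IsFiniteMeasure (volume.restrict Ω) := ⟨by simpa using hv1.lt_top⟩
  have hη0 : ∀ s, 0 ≤ s → 0 ≤ η s := fun s hs => (hη s hs).trans' (by positivity)
  have hκ0 : ∀ s, 0 < s → 0 < κ s := fun s hs =>
    (hκ s hs.le).trans_lt' (mul_pos hcκ (Real.sqrt_pos.2 hs))
  have hcw : ∀ t, 0 ≤ t → ∀ᵐ x ∂(volume.restrict Ω), c ≤ w t x := fun t ht =>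
    sol.le_w hΩ.isOpen hv1 hη0 hκ_cont hκ0 hc hc0 ht
  have hsc := Real.sqrt_pos.2 hc
  have hηk : ∀ y, c ≤ y → cη * √c ≤ η y := fun y hy => (hη y (hc.le.trans hy)).trans' (by gcongr)
  have hκk : ∀ y, c ≤ y → cκ * √c ≤ κ y := fun y hy => (hκ y (hc.le.trans hy)).trans' (by gcongr)
  have hV : ∀ t, 0 ≤ t → momentum Ω (v t) = momentum Ω (v 0) := fun t ht => sol.momentum_eq hv1 ht
  have hE : ∀ t, 0 ≤ t → energy Ω (v t) (w t) = energy Ω (v 0) (w 0) := fun t ht =>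
    sol.energy_eq hΩ.isOpen hv1 hcw (by positivity) hηk ht
  have hwHat : 0 < wHat Ω (momentum Ω (v 0)) (energy Ω (v 0) (w 0)) := by
    have h1 := volume_mul_wHat hv0 hv1 (sol.v_memLp 0 le_rfl) (sol.w_integrable 0 le_rfl)
    have h2 : ∫ _ in Ω, c ≤ ∫ x in Ω, w 0 x :=
      integral_mono_ae (integrable_const _) (sol.w_integrable 0 le_rfl) hc0
    rw [integral_const, measureReal_restrict_apply_univ, smul_eq_mul] at h2
    have h3 : 0 ≤ ∫ x in Ω, (v 0 x - vHat Ω (momentum Ω (v 0))) ^ 2 :=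
      integral_nonneg fun _ => sq_nonneg _
    have h4 := mul_pos hv0 hc
    exact (mul_pos_iff_of_pos_left hv0).1 (by linarith)
  have hmin : 0 < min cη cκ := lt_min hcη hcκ
  refine ⟨by positivity, fun t ht => ?_⟩
  set W := wHat Ω (momentum Ω (v 0)) (energy Ω (v 0) (w 0)) with hW
  set H : ℝ → ℝ := fun t => distEquilibrium Ω (v t) (w t) (vHat Ω (momentum Ω (v 0))) W with hH
  have hHeq : ∀ t, 0 ≤ t → H t = 2 * volume.real Ω * W - 2 * √W * ∫ x in Ω, √(w t x) := by
    intro t ht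
    have := distEquilibrium_eq hv0 hv1 (sol.v_memLp t ht) (sol.w_integrable t ht)
      (sol.w_nonneg t ht) (by rw [hV t ht, hE t ht]; exact hwHat.le)
    rwa [hV t ht, hE t ht] at this
  have hHc : ContinuousOn H (Ici 0) := by
    -- above the lower bound `c` of `w` the square root is Lipschitz
    have hlip : ∀ x y, |√(max x c) - √(max y c)| ≤ (√c)⁻¹ * |x - y| := fun x y => by
      have hx := Real.sqrt_le_sqrt (le_max_right x c)
      have hy := Real.sqrt_le_sqrt (le_max_right y c)
      have h1 : (√(max x c) - √(max y c)) * (√(max x c) + √(max y c)) = max x c - max y c := by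
        have e1 := Real.sq_sqrt (hc.le.trans (le_max_right x c))
        have e2 := Real.sq_sqrt (hc.le.trans (le_max_right y c))
        linarith
      have h2 : |max x c - max y c| ≤ |x - y| := abs_max_sub_max_le_abs x y c
      rw [← div_eq_inv_mul, le_div_iff₀ hsc]
      rw [← h1, abs_mul, abs_of_nonneg (by linarith : 0 ≤ √(max x c) + √(max y c))] at h2
      refine le_trans ?_ h2
      gcongr
      linarith
    have h1 := (continuousOn_integral_comp_of_lipschitz (S := Ici 0)
      (fun t ht => sol.w_integrable t ht) (fun s hs => sol.w_continuous s hs)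
      (f := fun y => √(max y c)) (by fun_prop) hlip).2
    have h2 : ContinuousOn (fun t => ∫ x in Ω, √(w t x)) (Ici 0) := h1.congr fun t ht => by
      refine integral_congr_ae ?_
      filter_upwards [hcw t ht] with x hx
      rw [max_eq_left hx]
    exact (continuousOn_const.sub (continuousOn_const.mul h2)).congr hHeq
  refine le_exp_mul_of_sub_le hHc (fun a b ha hab => ?_) ht
  have hb : 0 < b := ha.trans_le hab
  have hdiss := sol.mul_integral_le_integral_sqrt_sub hΩ.isOpen hv1 hκ_cont hcη hcκ hη hκ hc hcw
    ha hab
  have hGv := sol.memLp_Gv hcw (by positivity : 0 < cη * √c) hηk hb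
  have hR := sol.memLp_grad_sqrt_w hcw hc hκ_cont (by positivity : 0 < cκ * √c) hκk hb
  have i1 : IntegrableOn (fun z : ℝ × EuclideanSpace ℝ (Fin d) => (1 / 2) * ‖Gv z.1 z.2‖ ^ 2
      + ‖(1 / (2 * √(w z.1 z.2)) / κ (w z.1 z.2)) • Gp z.1 z.2‖ ^ 2) (Ioc a b ×ˢ Ω) :=
    ((((memLp_two_iff_integrable_sq_norm hGv.1).1 hGv).const_mul (1 / 2)).add
      ((memLp_two_iff_integrable_sq_norm hR.1.1).1 hR.1)).mono_measure
      (restrict_Ioc_prod_le Ω ha.le le_rfl)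
  have i1' := i1
  rw [IntegrableOn, Measure.volume_eq_prod, ← Measure.prod_restrict] at i1'
  have hmono : ∫ s in a..b, l * H s ≤ ∫ s in Ioc a b, 2 * ∫ x in Ω, ((1 / 2) * ‖Gv s x‖ ^ 2
      + ‖(1 / (2 * √(w s x)) / κ (w s x)) • Gp s x‖ ^ 2) := by
    rw [intervalIntegral.integral_of_le hab]
    refine setIntegral_mono_ae_restrict ?_ (i1'.integral_prod_left.const_mul 2) ?_
    · refine Integrable.const_mul ?_ _
      refine (hHc.mono ?_).integrableOn_Icc.mono_set Ioc_subset_Icc_self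
      exact fun s hs => ha.le.trans hs.1
    · have hsub : Ioc a b ⊆ Ioc 0 b := Ioc_subset_Ioc_left ha.le
      filter_upwards [ae_restrict_of_ae_restrict_of_subset hsub (sol.memSobolevH1_v hGv),
        ae_restrict_of_ae_restrict_of_subset hsub (hR.2 hΩ.isOpen),
        ae_restrict_mem measurableSet_Ioc] with s h1 h2 hs
      have hs0 : 0 ≤ s := (ha.trans hs.1).le
      have := mul_distEquilibrium_le hl.le hΩ.isOpen hP hv0 hv1 (sol.w_integrable s hs0)
        (sol.w_nonneg s hs0) (by rw [hV s hs0, hE s hs0]; exact hwHat.le) h1 h2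
      rwa [hV s hs0, hE s hs0] at this
  rw [Measure.volume_eq_prod, setIntegral_prod _ i1] at hdiss
  rw [intervalIntegral.integral_const_mul, integral_const_mul] at hmono
  rw [hHeq a ha.le, hHeq b hb.le]
  have hr := Real.sqrt_pos.2 hwHat
  have m1 := mul_le_mul_of_nonneg_left hmono (mul_pos hr hmin).le
  have m2 := mul_le_mul_of_nonneg_left hdiss hr.le
  linarith
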